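/- **Conventions.** A *coloured category* is a category $C$ with a subcategory $W$ containing all objects, whose arrows are called coloured; $\mathbf{CCat}$ is the category of coloured categories and colour-preserving functors. A colour-preserving functor $\varphi:(C,W)\to(C',W')$ is an *equifunctor* if it induces an equivalence of Dwyer–Kan simplicial localisations, i.e. if $\pi_0L\varphi:\pi_0LC\to\pi_0LC'$ is an equivalence of categories and $LC(x,y)\to LC'(\varphi x,\varphi y)$ is a weak equivalence of simplicial sets for all objects $x,y$ of $C$ ($L$ is taken in the form of the hammock localisation). The *fat delta* $\underline\Delta$ has as objects the finite non-empty coloured semi-ordinals, i.e. finite strings of arrows some of which are coloured (an arrow $a<b$ between vertices is coloured when all elementary arrows between $a$ and $b$ are), and as arrows the strictly increasing maps on vertices that preserve coloured arrows. Contracting the coloured arrows defines a functor $\pi:\underline\Delta\to\Delta$; an arrow is *vertical* if $\pi$ sends it to an identity. A *fair monoid in $\mathbf{CCat}$* is a functor $X:\underline\Delta^{\mathrm{op}}\to\mathbf{CCat}$ such that (1) the value of $X$ at the single dot is the discrete category with one object; (2) $X$ sends each pushout in $\underline\Delta$ of $K\leftarrow\bullet\to L$, where the dot $\bullet$ is the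 last vertex of $K$ and the first vertex of $L$, to a pullback; (3) $X$ sends vertical arrows to equifunctors. Write $A$ and $U$ for the values of $X$ at one uncoloured arrow, respectively at one coloured arrow; the composition laws of $A$ and $U$ and the functor $U\to A$ are given by the functoriality of $X$. The objects of $U$ are the *weak units*. **Lemma.** Let $(M,\otimes,I)$ be a monoidal model category in the sense of Hovey: a model category with functorial factorisations and a monoidal category, closed on both sides, that satisfies the pushout-product axiom and the unit axiom (for every weak equivalence $Z\to I$ with $Z$ cofibrant and every cofibrant $X$, the composites $Z\otimes X\to I\otimes X\cong X$ and $X\otimes Z\to X\otimes I\cong X$ are weak equivalences). The unit $I$ need not be cofibrant. Let $M^c$ be the full subcategory of cofibrant objects, coloured by the weak equivalences, and let $U_M$ be the category whose objects are the weak equivalences $Z\to I$ with $Z$ cofibrant and whose arrows are the triangles over $I$, all of them coloured. Then there is a fair monoid $X$ in $\mathbf{CCat}$ such that * there is an equivalence of categories $F:A\to M^c$, under which the coloured arrows of $A$ are exactly those sent to weak equivalences, together with a natural isomorphism, compatible with the associativity constraint of $M$, between the composition law of $A$ and $\otimes$; * there is a natural weak equivalence from the composite $U\to A\to M^c\subset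 M$ to the constant functor $I$ such that the induced functor $U\to U_M$ is an equivalence of categories, all arrows of $U$ are coloured, and the composition law of $U$ corresponds to $(Z\to I,\ Z'\to I)\mapsto(Z\otimes Z'\to I\otimes I\cong I)$. Thus $M^c$ is a fair monoidal coloured category whose weak units are the weak equivalences $Z\to I$ with $Z$ cofibrant. If $\otimes$ is strictly associative, then $X$ can be chosen so that $A\to M^c$ and $U\to U_M$ are isomorphisms of categories and the composition law of $A$ is equal to $\otimes$. -/

import Mathlib

open CategoryTheory Category Limits MonoidalCategory HomotopicalAlgebra Opposite

universe v u

noncomputable section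

/-! ## Coloured categories -/

set_option linter.checkUnivs false in
/-- A coloured category: a category with a specified subcategory comprising all the objects,
whose arrows are called the coloured arrows, or equiarrows. -/
structure CCat where
  /-- the objects -/
  carrier : Type u
  [category : Category.{v} carrier]
  /-- the coloured arrows -/
  equi : MorphismProperty carrier
  [isMultiplicative : equi.IsMultiplicative]

namespace CCat

instance : CoeSort CCat.{v, u} (Type u) := ⟨CCat.carrier⟩

attribute [instance] CCat.category CCat.isMultiplicative

/-- The category of coloured categories and colour-preserving functors. -/
instance : Category CCat.{v, u} where
  Hom C D := LocalizerMorphism C.equi D.equi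
  id C := LocalizerMorphism.id C.equi
  comp F G := LocalizerMorphism.comp F G

/-- The functor underlying a morphism of coloured categories. -/
abbrev functor {C D : CCat.{v, u}} (φ : C ⟶ D) : C ⥤ D := LocalizerMorphism.functor φ

lemma functor_map_equi {C D : CCat.{v, u}} (φ : C ⟶ D) {x y : C} {f : x ⟶ y} (hf : C.equi f) :
    D.equi ((functor φ).map f) :=
  LocalizerMorphism.map φ f hf

/-- The discrete objects: the coloured categories all of whose arrows are identities. -/
def discrete : ObjectProperty CCat.{v, u} := fun C => IsDiscrete C

/-! ### Hammock localisation -/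

/-- Zigzags in `C` ending at `z`, in which the arrows that go backwards are coloured. -/
inductive Zigzag (C : CCat.{v, u}) (z : C) : C → Type (max u v)
  | nil : Zigzag C z z
  | fwd {x y : C} (f : x ⟶ y) (h : Zigzag C z y) : Zigzag C z x
  | bwd {x y : C} (w : y ⟶ x) (hw : C.equi w) (h : Zigzag C z y) : Zigzag C z x

namespace Zigzag

variable {C D E : CCat.{v, u}}

/-- The elementary reductions of zigzags: omit an identity, compose two consecutive arrows that go
in the same direction. -/
inductive Step {z : C} : {x : C} → Zigzag C z x → Zigzag C z x → Prop
  | fwd_id {x : C} (h : Zigzag C z x) : Step (.fwd (𝟙 x) h) h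
  | bwd_id {x : C} (hx : C.equi (𝟙 x)) (h : Zigzag C z x) : Step (.bwd (𝟙 x) hx h) h
  | fwd_fwd {x y y' : C} (f : x ⟶ y) (g : y ⟶ y') (h : Zigzag C z y') :
      Step (.fwd f (.fwd g h)) (.fwd (f ≫ g) h)
  | bwd_bwd {x y y' : C} (w : y ⟶ x) (hw : C.equi w) (w' : y' ⟶ y) (hw' : C.equi w')
      (h : Zigzag C z y') :
      Step (.bwd w hw (.bwd w' hw' h)) (.bwd (w' ≫ w) (C.equi.comp_mem _ _ hw' hw) h)
  | fwd_congr {x y : C} (f : x ⟶ y) {h h' : Zigzag C z y} (s : Step h h') :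
      Step (.fwd f h) (.fwd f h')
  | bwd_congr {x y : C} (w : y ⟶ x) (hw : C.equi w) {h h' : Zigzag C z y} (s : Step h h') :
      Step (.bwd w hw h) (.bwd w hw h')

/-- Concatenation of zigzags. -/
def append {y z : C} : {x : C} → Zigzag C y x → Zigzag C z y → Zigzag C z x
  | _, .nil, k => k
  | _, .fwd f h, k => .fwd f (append h k)
  | _, .bwd w hw h, k => .bwd w hw (append h k)

lemma append_nil {z x : C} (h : Zigzag C z x) : append h .nil = h := by
  induction h with
  | nil => rfl
  | fwd f h ih => simp [append, ih]
  | bwd w hw h ih => simp [append, ih]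

lemma append_assoc {y z t x : C} (h : Zigzag C y x) (k : Zigzag C z y) (l : Zigzag C t z) :
    append (append h k) l = append h (append k l) := by
  induction h with
  | nil => rfl
  | fwd f h ih => simp [append, ih]
  | bwd w hw h ih => simp [append, ih]

lemma Step.append_left {x y z : C} (h : Zigzag C y x) {k k' : Zigzag C z y} (s : Step k k') :
    Step (append h k) (append h k') := by
  induction h with
  | nil => exact s
  | fwd f h ih => exact .fwd_congr f ih
  | bwd w hw h ih => exact .bwd_congr w hw ih

lemma Step.append_right {x y z : C} {h h' : Zigzag C y x} (s : Step h h') (k : Zigzag C z y) :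
    Step (append h k) (append h' k) := by
  induction s with
  | fwd_id h => exact .fwd_id _
  | bwd_id hx h => exact .bwd_id hx _
  | fwd_fwd f g h => exact .fwd_fwd f g _
  | bwd_bwd w hw w' hw' h => exact .bwd_bwd w hw w' hw' _
  | fwd_congr f s ih => exact .fwd_congr f ih
  | bwd_congr w hw s ih => exact .bwd_congr w hw ih

/-- The image of a zigzag under a colour-preserving functor. -/
def map (φ : C ⟶ D) {z : C} : {x : C} → Zigzag C z x → Zigzag D ((functor φ).obj z) ((functor φ).obj x)
  | _, .nil => .nil
  | _, .fwd f h => .fwd ((functor φ).map f) (map φ h)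
  | _, .bwd w hw h => .bwd ((functor φ).map w) (functor_map_equi φ hw) (map φ h)

lemma Step.map (φ : C ⟶ D) {z x : C} {h h' : Zigzag C z x} (s : Step h h') :
    Step (Zigzag.map φ h) (Zigzag.map φ h') := by
  induction s with
  | fwd_id h => simpa [Zigzag.map] using Step.fwd_id (Zigzag.map φ h)
  | bwd_id hx h =>
    simpa [Zigzag.map] using Step.bwd_id (D.equi.id_mem _) (Zigzag.map φ h)
  | fwd_fwd f g h =>
    simpa [Zigzag.map] using Step.fwd_fwd ((functor φ).map f) ((functor φ).map g) (Zigzag.map φ h)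
  | bwd_bwd w hw w' hw' h =>
    simpa [Zigzag.map] using Step.bwd_bwd _ (functor_map_equi φ hw) _ (functor_map_equi φ hw')
      (Zigzag.map φ h)
  | fwd_congr f s ih => exact .fwd_congr _ ih
  | bwd_congr w hw s ih => exact .bwd_congr _ _ ih

lemma map_append (φ : C ⟶ D) {y z x : C} (h : Zigzag C y x) (k : Zigzag C z y) :
    map φ (append h k) = append (map φ h) (map φ k) := by
  induction h with
  | nil => rfl
  | fwd f h ih => simp [append, map, ih]
  | bwd w hw h ih => simp [append, map, ih]

lemma map_id {z x : C} (h : Zigzag C z x) : map (𝟙 C) h = h := by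
  induction h with
  | nil => rfl
  | fwd f h ih => exact congrArg (Zigzag.fwd f) ih
  | bwd w hw h ih => exact congrArg (Zigzag.bwd w hw) ih

lemma map_comp (φ : C ⟶ D) (ψ : D ⟶ E) {z x : C} (h : Zigzag C z x) :
    map (φ ≫ ψ) h = map ψ (map φ h) := by
  induction h with
  | nil => rfl
  | fwd f h ih => exact congrArg (Zigzag.fwd ((functor (φ ≫ ψ)).map f)) ih
  | bwd w hw h ih =>
    exact congrArg (Zigzag.bwd ((functor (φ ≫ ψ)).map w) (functor_map_equi (φ ≫ ψ) hw)) ih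

/-- Zigzags from `x` to `z`, up to reduction. -/
def Reduced (C : CCat.{v, u}) (x z : C) : Type (max u v) := Quot (Step (C := C) (z := z) (x := x))

/-- The map induced on reduced zigzags by a colour-preserving functor. -/
def Reduced.map (φ : C ⟶ D) {x z : C} :
    Reduced C x z → Reduced D ((functor φ).obj x) ((functor φ).obj z) :=
  Quot.map (Zigzag.map φ) (fun _ _ s => s.map φ)

/-- Concatenation of reduced zigzags. -/
def Reduced.comp {x y z : C} : Reduced C x y → Reduced C y z → Reduced C x z :=
  Quot.map₂ append (fun h _ _ s => s.append_left h) (fun _ _ k s => s.append_right k)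

/-- Transport of reduced zigzags along equalities of the end points. -/
def Reduced.cast {x x' z z' : C} (hx : x = x') (hz : z = z') (h : Reduced C x z) :
    Reduced C x' z' :=
  hx ▸ hz ▸ h

lemma Reduced.map_cast (φ : C ⟶ D) {x x' z z' : C} (hx : x = x') (hz : z = z')
    (h : Reduced C x z) :
    Reduced.map φ (Reduced.cast hx hz h) =
      Reduced.cast (congrArg _ hx) (congrArg _ hz) (Reduced.map φ h) := by
  subst hx hz
  rfl

lemma Reduced.cast_comp {x x' y y' z z' : C} (hx : x = x') (hy : y = y') (hz : z = z')
    (h : Reduced C x y) (k : Reduced C y z) :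
    Reduced.cast hx hz (h.comp k) = (Reduced.cast hx hy h).comp (Reduced.cast hy hz k) := by
  subst hx hy hz
  rfl

lemma Reduced.cast_nil {x x' : C} (hx : x = x') :
    Reduced.cast hx hx (Quot.mk _ .nil) = Quot.mk _ .nil := by
  subst hx
  rfl

lemma Reduced.map_comp (φ : C ⟶ D) {x y z : C} (h : Reduced C x y) (k : Reduced C y z) :
    Reduced.map φ (h.comp k) = (Reduced.map φ h).comp (Reduced.map φ k) := by
  obtain ⟨h⟩ := h
  obtain ⟨k⟩ := k
  exact congrArg (Quot.mk _) (Zigzag.map_append φ h k)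

lemma Reduced.map_map (φ : C ⟶ D) (ψ : D ⟶ E) {x y : C} (h : Reduced C x y) :
    Reduced.map ψ (Reduced.map φ h) = Reduced.map (φ ≫ ψ) h := by
  obtain ⟨h⟩ := h
  exact congrArg (Quot.mk _) (Zigzag.map_comp φ ψ h).symm

end Zigzag

/-- The category of strings of `n` composable coloured arrows in `C`, whose arrows are the natural
transformations. -/
abbrev Strings (C : CCat.{v, u}) (n : SimplexCategory) : Type (max u v) :=
  ObjectProperty.FullSubcategory
    (fun F : Fin (n.len + 1) ⥤ C => ∀ ⦃i j : Fin (n.len + 1)⦄ (f : i ⟶ j), C.equi (F.map f))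

/-- The category of strings of `n` coloured arrows in `C`, the coloured transformations being
those with coloured components. -/
abbrev diag (C : CCat.{v, u}) (n : SimplexCategory) : CCat.{v, max u v} where
  carrier := C.Strings n
  equi := fun F G (α : F ⟶ G) => ∀ i, C.equi (α.hom.app i)
  isMultiplicative :=
    { id_mem := fun _ _ => C.equi.id_mem _
      comp_mem := fun _ _ hf hg i => C.equi.comp_mem _ _ (hf i) (hg i) }

/-- The string of identity arrows of `x`. -/
def constDiag (C : CCat.{v, u}) (n : SimplexCategory) (x : C) : C.diag n :=
  ⟨(Functor.const _).obj x, fun _ _ _ => C.equi.id_mem x⟩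

/-- The simplicial operators on strings of coloured arrows. -/
def diagRestrict (C : CCat.{v, u}) {m n : SimplexCategory} (θ : m ⟶ n) : C.diag n ⟶ C.diag m where
  functor :=
    { obj := fun (F : C.Strings n) =>
        (⟨θ.toOrderHom.monotone.functor ⋙ F.obj, fun _ _ _ => F.property _⟩ : C.Strings m)
      map := fun α => ⟨Functor.whiskerLeft θ.toOrderHom.monotone.functor α.hom⟩ }
  map := fun _ _ _ hα _ => hα _

/-- The map induced by a colour-preserving functor on strings of coloured arrows. -/
def diagMap {C D : CCat.{v, u}} (φ : C ⟶ D) (n : SimplexCategory) : C.diag n ⟶ D.diag n where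
  functor :=
    { obj := fun (F : C.Strings n) =>
        (⟨F.obj ⋙ functor φ, fun _ _ f => functor_map_equi φ (F.property f)⟩ : D.Strings n)
      map := fun α => ⟨Functor.whiskerRight α.hom (functor φ)⟩ }
  map := fun _ _ _ hα i => functor_map_equi φ (hα i)

lemma diagRestrict_id (C : CCat.{v, u}) (n : SimplexCategory) : C.diagRestrict (𝟙 n) = 𝟙 _ := rfl

lemma diagRestrict_comp (C : CCat.{v, u}) {l m n : SimplexCategory} (θ : l ⟶ m) (η : m ⟶ n) :
    C.diagRestrict (θ ≫ η) = C.diagRestrict η ≫ C.diagRestrict θ := rfl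

lemma diagRestrict_obj_const (C : CCat.{v, u}) {m n : SimplexCategory} (θ : m ⟶ n) (x : C) :
    (functor (C.diagRestrict θ)).obj (C.constDiag n x) = C.constDiag m x := rfl

lemma diagMap_naturality {C D : CCat.{v, u}} (φ : C ⟶ D) {m n : SimplexCategory} (θ : m ⟶ n) :
    C.diagRestrict θ ≫ diagMap φ m = diagMap φ n ≫ D.diagRestrict θ := rfl

lemma diagMap_obj_const {C D : CCat.{v, u}} (φ : C ⟶ D) (n : SimplexCategory) (x : C) :
    (functor (diagMap φ n)).obj (C.constDiag n x) = D.constDiag n ((functor φ).obj x) :=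
  ObjectProperty.FullSubcategory.ext (CategoryTheory.Functor.hext (fun _ => rfl)
    (fun _ _ _ => heq_of_eq ((functor φ).map_id x)))

/-- The mapping space `LC(x, y)` of the hammock localisation of `C`. Its `n`-simplices are the
reduced hammocks of width `n` from `x` to `y`, i.e. the reduced zigzags of strings of `n` coloured
arrows that start at the identities of `x` and end at the identities of `y`. -/
def mappingSpace (C : CCat.{v, u}) (x y : C) : SSet.{max u v} where
  obj n := Zigzag.Reduced (C.diag n.unop) (C.constDiag n.unop x) (C.constDiag n.unop y)
  map θ := ↾(Zigzag.Reduced.map (C.diagRestrict θ.unop))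
  map_id n := by
    ext ⟨h⟩
    exact congrArg (Quot.mk _) (Zigzag.map_id h)
  map_comp θ η := by
    ext ⟨h⟩
    exact congrArg (Quot.mk _) (Zigzag.map_comp (C.diagRestrict θ.unop) (C.diagRestrict η.unop) h)

/-- The map `LC(x, y) → LD(φ x, φ y)` induced by a colour-preserving functor `φ`. -/
def mappingSpaceMap {C D : CCat.{v, u}} (φ : C ⟶ D) (x y : C) :
    C.mappingSpace x y ⟶ D.mappingSpace ((functor φ).obj x) ((functor φ).obj y) where
  app n := ↾fun h => Zigzag.Reduced.cast (diagMap_obj_const φ n.unop x)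
    (diagMap_obj_const φ n.unop y) (Zigzag.Reduced.map (diagMap φ n.unop) h)
  naturality m n θ := by
    ext h
    have h₁ := Zigzag.Reduced.map_map (C.diagRestrict θ.unop) (diagMap φ n.unop) h
    have h₂ := Zigzag.Reduced.map_map (diagMap φ m.unop) (D.diagRestrict θ.unop) h
    have h₃ := Zigzag.Reduced.map_cast (D.diagRestrict θ.unop) (diagMap_obj_const φ m.unop x)
      (diagMap_obj_const φ m.unop y) (Zigzag.Reduced.map (diagMap φ m.unop) h)
    refine Eq.trans ?_ h₃.symm
    exact congrArg (Zigzag.Reduced.cast _ _) (h₁.trans h₂.symm)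

/-- The category of `0`-simplices of the hammock localisation: its objects are those of `C`, and its
arrows are the `0`-simplices of the mapping spaces, composed by concatenation. -/
structure Hammock₀ (C : CCat.{v, u}) where
  /-- the underlying object of `C` -/
  as : C

instance (C : CCat.{v, u}) : Category.{max u v} C.Hammock₀ where
  Hom x y := (C.mappingSpace x.as y.as).obj (op (SimplexCategory.mk 0))
  id x := Quot.mk _ .nil
  comp h k := Zigzag.Reduced.comp h k
  id_comp := by
    rintro _ _ ⟨h⟩
    rfl
  comp_id := by
    rintro _ _ ⟨h⟩
    exact congrArg (Quot.mk _) h.append_nil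
  assoc := by
    rintro _ _ _ _ ⟨h⟩ ⟨k⟩ ⟨l⟩
    exact congrArg (Quot.mk _) (h.append_assoc k l)

/-- Two `0`-simplices of a mapping space are related when some `1`-simplex joins them. -/
def homotopyRel (C : CCat.{v, u}) : HomRel C.Hammock₀ :=
  fun x y => SSet.π₀Rel (X := C.mappingSpace x.as y.as)

/-- The category `π₀ LC`: its objects are those of `C`, and its arrows from `x` to `y` are the
connected components of the mapping space `LC(x, y)`. -/
abbrev Pi₀ (C : CCat.{v, u}) := CategoryTheory.Quotient C.homotopyRel

/-- The functor induced by `φ` on categories of `0`-simplices. -/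
def hammock₀Map {C D : CCat.{v, u}} (φ : C ⟶ D) : C.Hammock₀ ⥤ D.Hammock₀ where
  obj x := ⟨(functor φ).obj x.as⟩
  map {x y} h := (mappingSpaceMap φ x.as y.as).app _ h
  map_id x := Zigzag.Reduced.cast_nil (diagMap_obj_const φ (SimplexCategory.mk 0) x.as)
  map_comp {x y z} h k :=
    (congrArg (Zigzag.Reduced.cast _ _)
      (Zigzag.Reduced.map_comp (diagMap φ (SimplexCategory.mk 0)) h k)).trans
    (Zigzag.Reduced.cast_comp (diagMap_obj_const φ (SimplexCategory.mk 0) x.as)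
      (diagMap_obj_const φ (SimplexCategory.mk 0) y.as)
      (diagMap_obj_const φ (SimplexCategory.mk 0) z.as) _ _)

/-- The functor `π₀ Lφ : π₀ LC ⥤ π₀ LD`. -/
def pi₀Map {C D : CCat.{v, u}} (φ : C ⟶ D) : C.Pi₀ ⥤ D.Pi₀ :=
  CategoryTheory.Quotient.lift C.homotopyRel
    (hammock₀Map φ ⋙ CategoryTheory.Quotient.functor D.homotopyRel)
    (fun x y _ _ ⟨e⟩ => CategoryTheory.Quotient.sound D.homotopyRel
      ⟨e.map (mappingSpaceMap φ x.as y.as)⟩)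

end CCat

/-- Homotopy classes of maps of simplicial sets (for the equivalence relation generated by
simplicial homotopies). -/
def SSet.HomotopyClasses (X Y : SSet.{u}) : Type u :=
  Quot (fun f g : X ⟶ Y => Nonempty (SSet.Homotopy f g))

/-- The map `[Y, Z] → [X, Z]` induced by `f : X ⟶ Y`. -/
def SSet.HomotopyClasses.precomp {X Y : SSet.{u}} (f : X ⟶ Y) (Z : SSet.{u}) :
    SSet.HomotopyClasses Y Z → SSet.HomotopyClasses X Z :=
  Quot.map (fun g => f ≫ g) (fun _ _ ⟨H⟩ =>
    ⟨SSet.RelativeMorphism.Homotopy.precomp H (SSet.RelativeMorphism.botEquiv.symm f)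
      (SSet.Subcomplex.isInitialBot.hom_ext _ _)⟩)

/-- Weak equivalences of simplicial sets: the maps `X ⟶ Y` that induce a bijection
`[Y, Z] → [X, Z]` for every Kan complex `Z`. -/
def SSet.IsWeakEquivalence {X Y : SSet.{u}} (f : X ⟶ Y) : Prop :=
  ∀ (Z : SSet.{u}) [SSet.KanComplex Z], Function.Bijective (SSet.HomotopyClasses.precomp f Z)

/-- The equifunctors: the colour-preserving functors that induce an equivalence of simplicial
categories on the simplicial localisations. -/
def CCat.equifunctors : MorphismProperty CCat.{v, u} := fun C _ φ =>
  (CCat.pi₀Map φ).IsEquivalence ∧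
    ∀ x y : C, SSet.IsWeakEquivalence (CCat.mappingSpaceMap φ x y)

/-! ## The fat delta -/

/-- The objects of the fat delta: the finite non-empty coloured semi-ordinals, i.e. the finite
strings of arrows, some of which (the links) are coloured. The vertices are `0, …, edges`, and the
edge `j` goes from the vertex `j.castSucc` to the vertex `j.succ`. -/
structure FatDelta where
  /-- the number of arrows in the string -/
  edges : ℕ
  /-- the coloured arrows -/
  linked : Fin edges → Bool

namespace FatDelta

/-- The arrow `a < b` of the coloured semi-ordinal `K` is coloured when all the edges between `a`
and `b` are. -/
def Equi (K : FatDelta) (a b : Fin (K.edges + 1)) : Prop :=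
  ∀ j : Fin K.edges, a ≤ j.castSucc → j.succ ≤ b → K.linked j = true

/-- The arrows of the fat delta: the strictly increasing maps on vertices that preserve the
coloured arrows. -/
@[ext]
structure Hom (K L : FatDelta) where
  /-- the map on vertices -/
  toFun : Fin (K.edges + 1) → Fin (L.edges + 1)
  strictMono : StrictMono toFun
  map_equi : ∀ a b, a < b → K.Equi a b → L.Equi (toFun a) (toFun b)

instance : Category FatDelta where
  Hom := Hom
  id K := ⟨id, strictMono_id, fun _ _ _ h => h⟩
  comp f g := ⟨g.toFun ∘ f.toFun, g.strictMono.comp f.strictMono,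
    fun _ _ hab h => g.map_equi _ _ (f.strictMono hab) (f.map_equi _ _ hab h)⟩

/-- The equi-connected component of the vertex `a`, the components being numbered from `0`
upwards: the number of uncoloured edges below `a`. -/
def component (K : FatDelta) (a : Fin (K.edges + 1)) : ℕ :=
  (Finset.univ.filter (fun j : Fin K.edges => j.castSucc < a ∧ K.linked j = false)).card

/-- The vertical arrows: those that induce an identity arrow on the ordinals of equi-connected
components. -/
def vertical : MorphismProperty FatDelta := fun K L f =>
  K.component (Fin.last _) = L.component (Fin.last _) ∧
    ∀ a, L.component (f.toFun a) = K.component a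

/-- The string of `n` uncoloured arrows. `hops 0` is the single dot. -/
def hops (n : ℕ) : FatDelta := ⟨n, fun _ => false⟩

/-- The string of `n` coloured arrows. -/
def links (n : ℕ) : FatDelta := ⟨n, fun _ => true⟩

/-- The single dot. -/
abbrev dot : FatDelta := hops 0

/-- Every strictly increasing map out of a string of uncoloured arrows preserves the colours. -/
def ofHops {n : ℕ} {K : FatDelta} (f : Fin (n + 1) → Fin (K.edges + 1)) (hf : StrictMono f) :
    hops n ⟶ K where
  toFun := f
  strictMono := hf
  map_equi a b hab h := by
    have ha : (a : ℕ) < n := lt_of_lt_of_le hab (Nat.lt_succ_iff.mp b.isLt)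
    exact absurd (h ⟨a, ha⟩ le_rfl hab) (by simp [hops])

/-- Every strictly increasing map into a string of coloured arrows preserves the colours. -/
def toLinks {n : ℕ} {K : FatDelta} (f : Fin (K.edges + 1) → Fin (n + 1)) (hf : StrictMono f) :
    K ⟶ links n where
  toFun := f
  strictMono := hf
  map_equi _ _ _ _ _ _ _ := rfl

/-- The first dot of `K`. -/
def first (K : FatDelta) : dot ⟶ K :=
  ofHops (fun _ => 0) (Subsingleton.strictMono (α := Fin 1) _)

/-- The last dot of `K`. -/
def last (K : FatDelta) : dot ⟶ K :=
  ofHops (fun _ => Fin.last _) (Subsingleton.strictMono (α := Fin 1) _)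

lemma strictMono_two {n : ℕ} {a b : Fin n} (hab : a < b) : StrictMono ![a, b] := by
  simpa [Fin.strictMono_iff_lt_succ] using hab

/-- The arrow from the vertex `a` to the vertex `b` of `K`. -/
def arrow (K : FatDelta) (a b : Fin (K.edges + 1)) (hab : a < b) : hops 1 ⟶ K :=
  ofHops ![a, b] (strictMono_two hab)

/-- The composable pair of arrows of `K` from `a` to `b` to `c`. -/
def pair (K : FatDelta) (a b c : Fin (K.edges + 1)) (hab : a < b) (hbc : b < c) : hops 2 ⟶ K :=
  ofHops ![a, b, c] (by
    rw [Fin.strictMono_iff_lt_succ]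
    intro i
    fin_cases i
    exacts [hab, hbc])

/-- The coloured arrow from the vertex `a` to the vertex `b` of a string of links. -/
def link {n : ℕ} (a b : Fin (n + 1)) (hab : a < b) : links 1 ⟶ links n :=
  toLinks (K := links 1) ![a, b] (strictMono_two hab)

end FatDelta

/-! ## Fair categories and fair monoids -/

/-- A fair category in a category `S` with coloured arrows `equi` and discrete objects `disc`:
a diagram on the opposite of the fat delta that preserves the discrete objects (the single dot is
the only discrete object of the fat delta), the colours, and the fibre products over discrete
objects (i.e. it sends the pushouts of the last dot of `K` with the first dot of `L` to
pullbacks). -/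
structure IsFairCategory {S : Type*} [Category* S] (equi : MorphismProperty S)
    (disc : ObjectProperty S) (X : FatDeltaᵒᵖ ⥤ S) : Prop where
  discrete : disc (X.obj (op FatDelta.dot))
  segal : ∀ {K L P : FatDelta} (i : K ⟶ P) (j : L ⟶ P), IsPushout K.last L.first i j →
    IsPullback (X.map i.op) (X.map j.op) (X.map K.last.op) (X.map L.first.op)
  colours : ∀ {K L : FatDelta} (f : K ⟶ L), FatDelta.vertical f → equi (X.map f.op)

/-- A fair monoid in coloured categories, or fair monoidal coloured category: a fair category in
`CCat`, for the equifunctors, whose space of objects is a singleton. -/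
structure IsFairMonoid (X : FatDeltaᵒᵖ ⥤ CCat.{v, u}) : Prop extends
    IsFairCategory CCat.equifunctors CCat.discrete X where
  singleton : Nonempty (Unique (X.obj (op FatDelta.dot)))

namespace FatDelta

variable (X : FatDeltaᵒᵖ ⥤ CCat.{v, u})

/-- The functor `X L ⥤ X K` given by an arrow `K ⟶ L` of the fat delta. -/
abbrev res {K L : FatDelta} (f : K ⟶ L) : X.obj (op L) ⥤ X.obj (op K) := CCat.functor (X.map f.op)

lemma res_res_obj {K L P : FatDelta} {f : K ⟶ L} {g : L ⟶ P} {h : K ⟶ P} (w : f ≫ g = h)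
    (T : X.obj (op P)) : (res X f).obj ((res X g).obj T) = (res X h).obj T := by
  subst w
  exact (congrArg (fun φ => (CCat.functor φ).obj T) (X.map_comp g.op f.op)).symm

lemma arrow_pair₀₁ (K : FatDelta) (a b c : Fin (K.edges + 1)) (hab : a < b) (hbc : b < c) :
    arrow (hops 2) (0 : Fin 3) (1 : Fin 3) (by decide) ≫ pair K a b c hab hbc = arrow K a b hab := by
  apply Hom.ext
  funext i
  fin_cases i <;> rfl

lemma arrow_pair₁₂ (K : FatDelta) (a b c : Fin (K.edges + 1)) (hab : a < b) (hbc : b < c) :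
    arrow (hops 2) (1 : Fin 3) (2 : Fin 3) (by decide) ≫ pair K a b c hab hbc = arrow K b c hbc := by
  apply Hom.ext
  funext i
  fin_cases i <;> rfl

lemma arrow_pair₀₂ (K : FatDelta) (a b c : Fin (K.edges + 1)) (hab : a < b) (hbc : b < c) :
    arrow (hops 2) (0 : Fin 3) (2 : Fin 3) (by decide) ≫ pair K a b c hab hbc =
      arrow K a c (hab.trans hbc) := by
  apply Hom.ext
  funext i
  fin_cases i <;> rfl

lemma arrow_link {n : ℕ} (a b : Fin (n + 1)) (hab : a < b) :
    arrow (links 1) (0 : Fin 2) (1 : Fin 2) (by decide) ≫ link a b hab =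
      arrow (links n) a b hab := by
  apply Hom.ext
  funext i
  fin_cases i <;> rfl

end FatDelta

/-! ## Monoidal model categories -/

section

variable (M : Type u) [Category.{v} M] [MonoidalCategory M] [ModelCategory M]

/-- Monoidal model categories in the sense of Hovey: the factorisations of the model structure can
be chosen functorial, the tensor product is closed on both sides, it satisfies the pushout-product
axiom, and it satisfies the unit axiom. The unit object need not be cofibrant. -/
class MonoidalModelCategory : Prop where
  functorial₁ : MorphismProperty.HasFunctorialFactorization (cofibrations M) (trivialFibrations M)
  functorial₂ : MorphismProperty.HasFunctorialFactorization (trivialCofibrations M) (fibrations M)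
  closed_left (X : M) : (tensorLeft X).IsLeftAdjoint
  closed_right (X : M) : (tensorRight X).IsLeftAdjoint
  pushoutProduct_cofibration (i j : Arrow M) : Cofibration i.hom → Cofibration j.hom →
    Cofibration ((MonoidalCategory.Arrow.pushoutProduct.obj i).obj j).hom
  pushoutProduct_weakEquivalence (i j : Arrow M) : Cofibration i.hom → Cofibration j.hom →
    WeakEquivalence i.hom ∨ WeakEquivalence j.hom →
    WeakEquivalence ((MonoidalCategory.Arrow.pushoutProduct.obj i).obj j).hom
  unit_left {Z : M} (w : Z ⟶ 𝟙_ M) (X : M) : IsCofibrant Z → WeakEquivalence w → IsCofibrant X →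
    WeakEquivalence (w ▷ X ≫ (λ_ X).hom)
  unit_right {Z : M} (w : Z ⟶ 𝟙_ M) (X : M) : IsCofibrant Z → WeakEquivalence w → IsCofibrant X →
    WeakEquivalence (X ◁ w ≫ (ρ_ X).hom)

/-- The tensor product of `M` is strictly associative. -/
def StrictlyAssociative : Prop :=
  ∀ X Y Z : M, ∃ h : (X ⊗ Y) ⊗ Z = X ⊗ Y ⊗ Z, (α_ X Y Z).hom = eqToHom h

/-- The category of weak units of `M`: its objects are the weak equivalences `Z ⟶ 𝟙_ M` with `Z`
cofibrant, its arrows are the triangles over `𝟙_ M`. -/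
abbrev WeakUnits : Type (max u v) :=
  ObjectProperty.FullSubcategory
    (fun w : CostructuredArrow (CofibrantObject.ι (C := M)) (𝟙_ M) => WeakEquivalence w.hom)

variable {M}

/-- The functor into the category of weak units given by a functor `G` into the cofibrant objects
and a natural weak equivalence from `G` to the unit object. -/
def toWeakUnits {Y : Type*} [Category* Y] (G : Y ⥤ CofibrantObject M)
    (ε : G ⋙ CofibrantObject.ι ⟶ (Functor.const Y).obj (𝟙_ M))
    (hε : ∀ S, WeakEquivalence (ε.app S)) : Y ⥤ WeakUnits M where
  obj S := ⟨CostructuredArrow.mk (S := CofibrantObject.ι) (ε.app S), hε S⟩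
  map f := ⟨CostructuredArrow.homMk (G.map f) (by simpa using ε.naturality f)⟩

variable (M)

namespace FatDelta

/-- A functor `F` from the space of arrows of `X` to the cofibrant objects of `M`, together with a
natural isomorphism `μ` between the composition law of `X` and the tensor product of `M`. -/
structure TensorData (X : FatDeltaᵒᵖ ⥤ CCat.{v, max u v}) where
  /-- the functor to the cofibrant objects -/
  F : X.obj (op (hops 1)) ⥤ CofibrantObject M
  /-- the comparison of the composition law with the tensor product -/
  μ : res X (arrow (hops 2) (0 : Fin 3) (2 : Fin 3) (by decide)) ⋙ F ⋙ CofibrantObject.ι ≅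
    Functor.prod'
      (res X (arrow (hops 2) (0 : Fin 3) (1 : Fin 3) (by decide)) ⋙ F ⋙ CofibrantObject.ι)
      (res X (arrow (hops 2) (1 : Fin 3) (2 : Fin 3) (by decide)) ⋙ F ⋙ CofibrantObject.ι) ⋙
    MonoidalCategory.tensor M

namespace TensorData

variable {M} {X : FatDeltaᵒᵖ ⥤ CCat.{v, max u v}} (R : TensorData M X)

/-- The object of `M` underlying an arrow of `X`. -/
def obj (a : X.obj (op (hops 1))) : M := (R.F.obj a).obj

/-- The object of `M` underlying the arrow from `a` to `b` of a diagram `T` of shape `K`. -/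
def edge {K : FatDelta} (T : X.obj (op K)) (a b : Fin (K.edges + 1)) (hab : a < b) : M :=
  R.obj ((res X (arrow K a b hab)).obj T)

/-- The isomorphism `T_ac ≅ T_ab ⊗ T_bc` given by `μ`, for a diagram `T` of shape `K` and vertices
`a < b < c` of `K`. -/
def mul {K : FatDelta} (T : X.obj (op K)) (a b c : Fin (K.edges + 1)) (hab : a < b) (hbc : b < c) :
    R.edge T a c (hab.trans hbc) ⟶ R.edge T a b hab ⊗ R.edge T b c hbc :=
  eqToHom (congrArg R.obj (res_res_obj X (arrow_pair₀₂ K a b c hab hbc) T).symm) ≫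
    R.μ.hom.app ((res X (pair K a b c hab hbc)).obj T) ≫
    (eqToHom (congrArg R.obj (res_res_obj X (arrow_pair₀₁ K a b c hab hbc) T)) ⊗ₘ
      eqToHom (congrArg R.obj (res_res_obj X (arrow_pair₁₂ K a b c hab hbc) T)))

end TensorData

end FatDelta

open FatDelta in
/-- The datum that exhibits a diagram `X` on the opposite of the fat delta as being the fair monoid
of cofibrant objects of `M`.

* The coloured category `A = X (hops 1)` is identified, by the equivalence `F`, with the category of
  cofibrant objects of `M`, coloured by the weak equivalences.
* The composition law of `A` is identified, by the natural isomorphism `μ`, with the tensor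
  product, compatibly with the associativity constraint.
* The coloured category `U = X (links 1)` is identified, by means of `ε`, with the category of
  weak equivalences `Z ⟶ 𝟙_ M` with `Z` cofibrant, all of whose arrows are coloured, in such a way
  that `U ⥤ A` is the functor `(Z ⟶ 𝟙_ M) ↦ Z` and that the composition law of `U` sends the pair
  `(Z ⟶ 𝟙_ M, Z' ⟶ 𝟙_ M)` to the composite `Z ⊗ Z' ⟶ 𝟙_ M ⊗ 𝟙_ M ⟶ 𝟙_ M`. -/
structure CofibrantFairMonoid (X : FatDeltaᵒᵖ ⥤ CCat.{v, max u v}) extends TensorData M X where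
  isEquivalence : F.IsEquivalence
  equi_iff : ∀ {a b : X.obj (op (hops 1))} (f : a ⟶ b),
    (X.obj (op (hops 1))).equi f ↔ WeakEquivalence (CofibrantObject.ι.map (F.map f))
  associativity : ∀ T : X.obj (op (hops 3)),
    toTensorData.mul T (0 : Fin 4) (1 : Fin 4) (3 : Fin 4) (by decide) (by decide) ≫
        (_ ◁ toTensorData.mul T (1 : Fin 4) (2 : Fin 4) (3 : Fin 4) (by decide) (by decide)) =
      toTensorData.mul T (0 : Fin 4) (2 : Fin 4) (3 : Fin 4) (by decide) (by decide) ≫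
        (toTensorData.mul T (0 : Fin 4) (1 : Fin 4) (2 : Fin 4) (by decide) (by decide) ▷ _) ≫
        (α_ _ _ _).hom
  /-- the weak equivalences `Z ⟶ 𝟙_ M` that correspond to the objects of `U` -/
  ε : (res X (arrow (links 1) (0 : Fin 2) (1 : Fin 2) (by decide)) ⋙ F) ⋙ CofibrantObject.ι ⟶
    (Functor.const _).obj (𝟙_ M)
  ε_weakEquivalence : ∀ S, WeakEquivalence (ε.app S)
  isEquivalence_units : (toWeakUnits _ ε ε_weakEquivalence).IsEquivalence
  equi_units : (X.obj (op (links 1))).equi = ⊤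
  unit_mul : ∀ T : X.obj (op (links 2)),
    eqToHom (congrArg toTensorData.obj
        (res_res_obj X (arrow_link (0 : Fin 3) (2 : Fin 3) (by decide)) T).symm) ≫
      ε.app ((res X (link (0 : Fin 3) (2 : Fin 3) (by decide))).obj T) =
    toTensorData.mul T (0 : Fin 3) (1 : Fin 3) (2 : Fin 3) (by decide) (by decide) ≫
      ((eqToHom (congrArg toTensorData.obj
          (res_res_obj X (arrow_link (0 : Fin 3) (1 : Fin 3) (by decide)) T).symm) ≫
        ε.app ((res X (link (0 : Fin 3) (1 : Fin 3) (by decide))).obj T)) ⊗ₘ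
      (eqToHom (congrArg toTensorData.obj
          (res_res_obj X (arrow_link (1 : Fin 3) (2 : Fin 3) (by decide)) T).symm) ≫
        ε.app ((res X (link (1 : Fin 3) (2 : Fin 3) (by decide))).obj T))) ≫
      (λ_ (𝟙_ M)).hom

variable {M} in
/-- The identifications of a `CofibrantFairMonoid` hold on the nose: `A` and `U` are isomorphic to
the categories of cofibrant objects and of weak units, and the composition law is equal to the
tensor product. -/
structure CofibrantFairMonoid.IsStrict {X : FatDeltaᵒᵖ ⥤ CCat.{v, max u v}}
    (R : CofibrantFairMonoid M X) : Prop where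
  bijective : Function.Bijective R.F.obj
  bijective_units : Function.Bijective (toWeakUnits _ R.ε R.ε_weakEquivalence).obj
  μ_eq : ∀ T, ∃ h, R.μ.hom.app T = eqToHom h

end

end

/-! The Segal condition asks for strict pullbacks, whereas the tensor product is associative only up
to isomorphism. The objects are therefore rigidified first. A `Strictification` is a semigroup `S`
with a map `r` onto the cofibrant objects and isomorphisms `r (s * t) ≅ r s ⊗ r t` compatible with
the associator. The free semigroup on the cofibrant objects always provides one; if the tensor
product is strictly associative, the cofibrant objects themselves do. A diagram of shape `K` is then
a multiplicative family in `S` on the arrows of `K`, with a multiplicative family of weak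
equivalences to the unit on the coloured arrows.

Segal condition. Diagrams and their morphisms are determined, without constraint, by what they are
on the edges of `K`: products, composites with the comparison isomorphisms and tensor products of
weak units fill in the rest. So `spine` is an isomorphism of categories, and concatenating strings
amounts to taking products.

Vertical arrows. If `K ⟶ L` is vertical, each edge of `K` is matched with an edge of `L` of the same
colour inside its image, and every other edge of `L` is coloured (`exists_edges_of_vertical`). The
unit axiom gives natural weak equivalences `Z ⊗ X ⊗ Z' ⟶ X` for weak units `Z`, `Z'`, so restriction
along the arrow is homotopic to the functor that forgets the unmatched edges. That functor is a
homotopy equivalence because weak units form a contractible category: given a fixed weak unit `Z₀`,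
the functorial factorisation of `Z ⨿ Z₀ ⟶ 𝟙_ M` produces a natural cospan from `Z` and `Z₀`.

Homotopy equivalences are equifunctors. A natural transformation `α : φ ⟶ ψ` with coloured
components yields an explicit simplicial homotopy of hammocks from `φ` followed by `α_y` to `α_x`
followed by `ψ` (`ColouredTrans.homotopyFamily`), and composing with a coloured arrow is itself a
homotopy equivalence of mapping spaces. Hence homotopic functors have isomorphic effects on `π₀` and
are simultaneously weak equivalences on mapping spaces. -/

noncomputable section

/-! ## Simplicial homotopies and weak equivalences -/

namespace SSet

open Simplicial

/-- A homotopy, given by a family of operations on simplices indexed by the simplices of `Δ[1]`. -/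
structure HomotopyFamily {X Y : SSet.{u}} (f g : X ⟶ Y) where
  /-- the operations -/
  op : ∀ n : SimplexCategory, (n ⟶ ⦋1⦌) → X.obj (Opposite.op n) → Y.obj (Opposite.op n)
  naturality : ∀ {m n : SimplexCategory} (θ : m ⟶ n) (k : n ⟶ ⦋1⦌) (x : X.obj (Opposite.op n)),
    Y.map θ.op (op n k x) = op m (θ ≫ k) (X.map θ.op x)
  zero : ∀ (n : SimplexCategory) (x : X.obj (Opposite.op n)),
    op n (SimplexCategory.const n ⦋1⦌ 0) x = f.app _ x
  one : ∀ (n : SimplexCategory) (x : X.obj (Opposite.op n)),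
    op n (SimplexCategory.const n ⦋1⦌ 1) x = g.app _ x

namespace HomotopyFamily

variable {X Y : SSet.{u}} {f g : X ⟶ Y}

/-- The simplicial homotopy given by a family of operations. -/
def toHomotopy (H : HomotopyFamily f g) : SSet.Homotopy f g where
  h :=
    { app n := ↾fun x => H.op n.unop (stdSimplex.objEquiv x.2) x.1
      naturality m n θ := by
        ext x
        exact (H.naturality θ.unop (stdSimplex.objEquiv x.2) x.1).symm }
  h₀ := by
    ext n x
    exact H.zero n.unop x
  h₁ := by
    ext n x
    exact H.one n.unop x
  rel := by
    ext n ⟨⟨x, hx⟩, y⟩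
    exact hx.elim

/-- The path is the operation indexed by the identity of `⦋1⦌`, applied to the degenerate
`1`-simplex on `x`. -/
lemma π₀Rel (H : HomotopyFamily f g) (x : X.obj (Opposite.op ⦋0⦌)) :
    SSet.π₀Rel (X := Y) (f.app _ x) (g.app _ x) := by
  -- Naturality along a coface turns the index into a constant map and cancels the degeneracy. The
  -- face `δ 1` is the source of the path, and it corresponds to the constant `0`.
  have key : ∀ (i : Fin 2) (j : Fin 2), SimplexCategory.δ (n := 0) i ≫ 𝟙 ⦋1⦌ = SimplexCategory.const ⦋0⦌ ⦋1⦌ j →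
      Y.δ i (H.op ⦋1⦌ (𝟙 _) (X.σ 0 x)) = H.op ⦋0⦌ (SimplexCategory.const ⦋0⦌ ⦋1⦌ j) x := by
    intro i j hij
    refine (H.naturality (SimplexCategory.δ (n := 0) i) (𝟙 _) (X.σ 0 x)).trans ?_
    rw [hij]
    congr 1
    have := ConcreteCategory.congr_hom (X.map_comp (SimplexCategory.σ (n := 0) 0).op (SimplexCategory.δ i).op) x
    refine this.symm.trans ?_
    rw [← op_comp, Subsingleton.elim (SimplexCategory.δ i ≫ SimplexCategory.σ (n := 0) 0) (𝟙 _)]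
    simp
  refine ⟨SSet.Edge.mk (H.op ⦋1⦌ (𝟙 _) (X.σ 0 x)) ?_ ?_⟩
  · refine (key 1 0 ?_).trans (H.zero _ x)
    ext i; fin_cases i; rfl
  · refine (key 0 1 ?_).trans (H.one _ x)
    ext i; fin_cases i; rfl

end HomotopyFamily

lemma HomotopyClasses.precomp_comp {X Y Z : SSet.{u}} (f : X ⟶ Y) (g : Y ⟶ Z) (T : SSet.{u}) :
    HomotopyClasses.precomp (f ≫ g) T =
      HomotopyClasses.precomp f T ∘ HomotopyClasses.precomp g T := by
  funext h
  obtain ⟨h⟩ := h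
  exact congrArg (Quot.mk _) (Category.assoc f g h)

lemma HomotopyClasses.precomp_id (X T : SSet.{u}) : HomotopyClasses.precomp (𝟙 X) T = id := by
  funext h
  obtain ⟨h⟩ := h
  exact congrArg (Quot.mk _) (Category.id_comp h)

lemma HomotopyFamily.precomp_eq {X Y : SSet.{u}} {f g : X ⟶ Y} (H : HomotopyFamily f g)
    (T : SSet.{u}) : HomotopyClasses.precomp f T = HomotopyClasses.precomp g T := by
  funext h
  obtain ⟨h⟩ := h
  exact Quot.sound ⟨RelativeMorphism.Homotopy.postcomp H.toHomotopy (RelativeMorphism.botEquiv.symm h)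
      (SSet.Subcomplex.isInitialBot.hom_ext _ _)⟩

end SSet

/-! ### Calculus of reduced zigzags and composition with an arrow -/

namespace CCat

namespace Zigzag

variable {C D : CCat.{v, u}}

/-- The empty zigzag. -/
def Reduced.nil (x : C) : Reduced C x x := Quot.mk _ .nil

/-- The reduced zigzag given by an arrow. -/
def Reduced.fwd {x y : C} (f : x ⟶ y) : Reduced C x y := Quot.mk _ (.fwd f .nil)

/-- The reduced zigzag given by a coloured arrow, taken backwards. -/
def Reduced.bwd {x y : C} (w : x ⟶ y) (hw : C.equi w) : Reduced C y x :=
  Quot.mk _ (.bwd w hw .nil)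

lemma Reduced.comp_assoc {x y z t : C} (h : Reduced C x y) (k : Reduced C y z) (l : Reduced C z t) :
    (h.comp k).comp l = h.comp (k.comp l) := by
  obtain ⟨h⟩ := h
  obtain ⟨k⟩ := k
  obtain ⟨l⟩ := l
  exact congrArg (Quot.mk _) (h.append_assoc k l)

lemma Reduced.comp_nil {x y : C} (h : Reduced C x y) : h.comp (Reduced.nil y) = h := by
  obtain ⟨h⟩ := h
  exact congrArg (Quot.mk _) h.append_nil

lemma Reduced.nil_comp {x y : C} (h : Reduced C x y) : (Reduced.nil x).comp h = h := by
  obtain ⟨h⟩ := h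
  rfl

lemma Reduced.fwd_id (x : C) : Reduced.fwd (𝟙 x) = Reduced.nil x :=
  Quot.sound (.fwd_id _)

lemma Reduced.bwd_id (x : C) (hx : C.equi (𝟙 x)) : Reduced.bwd (𝟙 x) hx = Reduced.nil x :=
  Quot.sound (.bwd_id hx _)

lemma Reduced.fwd_comp {x y z : C} (f : x ⟶ y) (g : y ⟶ z) :
    (Reduced.fwd f).comp (Reduced.fwd g) = Reduced.fwd (f ≫ g) :=
  Quot.sound (.fwd_fwd f g _)

lemma Reduced.cast_rfl {x y : C} (h : Reduced C x y) : Reduced.cast rfl rfl h = h := rfl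

/-- Transport becomes composition with zigzags of length one, so that all casts can be merged by the
rules for composing forward arrows. -/
lemma Reduced.cast_eq {x x' y y' : C} (hx : x = x') (hy : y = y') (h : Reduced C x y) :
    Reduced.cast hx hy h =
      ((Reduced.fwd (eqToHom hx.symm)).comp h).comp (Reduced.fwd (eqToHom hy)) := by
  subst hx hy
  simp only [eqToHom_refl, Reduced.fwd_id, Reduced.nil_comp, Reduced.comp_nil, Reduced.cast_rfl]

lemma Reduced.map_eq {φ ψ : C ⟶ D} (e : φ = ψ) {x y : C} (h : Reduced C x y) :
    Reduced.map φ h = Reduced.cast (by rw [e]) (by rw [e]) (Reduced.map ψ h) := by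
  subst e
  rfl

/-- A round trip does not depend on the name of its turning point. This serves when two strings are
equal but not definitionally so. -/
lemma Reduced.fwd_bwd_eqToHom {x y y' : C} (f : x ⟶ y) (hf : C.equi f) (f' : x ⟶ y')
    (hf' : C.equi f') (e : y = y') (he : f ≫ eqToHom e = f') :
    (Reduced.fwd f).comp (Reduced.bwd f hf) = (Reduced.fwd f').comp (Reduced.bwd f' hf') := by
  subst e
  obtain rfl : f = f' := by simpa using he
  rfl

lemma Reduced.bwd_fwd_eqToHom {x y y' : C} (f : y ⟶ x) (hf : C.equi f) (f' : y' ⟶ x)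
    (hf' : C.equi f') (e : y' = y) (he : eqToHom e ≫ f = f') :
    (Reduced.bwd f hf).comp (Reduced.fwd f) = (Reduced.bwd f' hf').comp (Reduced.fwd f') := by
  subst e
  obtain rfl : f = f' := by simpa using he
  rfl

end Zigzag

open Zigzag Simplicial

variable {C D E : CCat.{v, u}}

lemma Strings.eqToHom_app {n : SimplexCategory} {F G : D.diag n} (h : F = G)
    (i : Fin (n.len + 1)) :
    (eqToHom h : F ⟶ G).hom.app i = eqToHom (by rw [h]) := by
  subst h
  rfl

@[ext]
lemma Strings.hom_ext {n : SimplexCategory} {F G : D.diag n} {f g : F ⟶ G}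
    (h : ∀ i, f.hom.app i = g.hom.app i) : f = g :=
  ObjectProperty.hom_ext _ (NatTrans.ext (funext h))

/-- The map of constant strings given by an arrow. -/
def constMap (D : CCat.{v, u}) (n : SimplexCategory) {x y : D} (f : x ⟶ y) :
    D.constDiag n x ⟶ D.constDiag n y :=
  ⟨(Functor.const _).map f⟩

lemma constMap_equi (n : SimplexCategory) {x y : D} {f : x ⟶ y} (hf : D.equi f) :
    (D.diag n).equi (D.constMap n f) := fun _ => hf

/-- Composition with an arrow, on the right. -/
def postFwd (D : CCat.{v, u}) (x : D) {y z : D} (f : y ⟶ z) :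
    D.mappingSpace x y ⟶ D.mappingSpace x z where
  app n := ↾fun h => Reduced.comp h (Reduced.fwd (D.constMap n.unop f))
  naturality m n θ := by
    ext h
    exact (Reduced.map_comp (D.diagRestrict θ.unop) h (Reduced.fwd (D.constMap m.unop f))).symm

/-- Composition with a coloured arrow taken backwards, on the right. -/
def postBwd (D : CCat.{v, u}) (x : D) {y z : D} (f : y ⟶ z) (hf : D.equi f) :
    D.mappingSpace x z ⟶ D.mappingSpace x y where
  app n := ↾fun h => Reduced.comp h (Reduced.bwd (D.constMap n.unop f) (constMap_equi _ hf))
  naturality m n θ := by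
    ext h
    exact (Reduced.map_comp (D.diagRestrict θ.unop) h
      (Reduced.bwd (D.constMap m.unop f) (constMap_equi _ hf))).symm

/-- Composition with an arrow, on the left. -/
def preFwd (D : CCat.{v, u}) {x y : D} (f : x ⟶ y) (z : D) :
    D.mappingSpace y z ⟶ D.mappingSpace x z where
  app n := ↾fun h => Reduced.comp (Reduced.fwd (D.constMap n.unop f)) h
  naturality m n θ := by
    ext h
    exact (Reduced.map_comp (D.diagRestrict θ.unop) (Reduced.fwd (D.constMap m.unop f)) h).symm

/-- Composition with a coloured arrow taken backwards, on the left. -/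
def preBwd (D : CCat.{v, u}) {x y : D} (f : x ⟶ y) (hf : D.equi f) (z : D) :
    D.mappingSpace x z ⟶ D.mappingSpace y z where
  app n := ↾fun h => Reduced.comp (Reduced.bwd (D.constMap n.unop f) (constMap_equi _ hf)) h
  naturality m n θ := by
    ext h
    exact (Reduced.map_comp (D.diagRestrict θ.unop)
      (Reduced.bwd (D.constMap m.unop f) (constMap_equi _ hf)) h).symm

end CCat

/-! ### Coloured arrows act on mapping spaces by homotopy equivalences -/

namespace CCat

open Zigzag Simplicial

variable {C D E : CCat.{v, u}}

lemma equi_mk₁_map {y z : D} {w : y ⟶ z} (hw : D.equi w) {i j : Fin 2} (f : i ⟶ j) :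
    D.equi ((ComposableArrows.mk₁ w).map f) := by
  have hij := leOfHom f
  obtain rfl := Subsingleton.elim f (homOfLE hij)
  fin_cases i <;> fin_cases j
  · exact D.equi.id_mem _
  · exact hw
  · exact absurd hij (by decide)
  · exact D.equi.id_mem _

/-- The string of coloured arrows that goes from `y` to `z` along `w` at the place prescribed
by `k`. -/
def stepString {y z : D} (w : y ⟶ z) (hw : D.equi w) {n : SimplexCategory} (k : n ⟶ ⦋1⦌) :
    D.diag n :=
  ⟨k.toOrderHom.monotone.functor ⋙ ComposableArrows.mk₁ w,
    fun _ _ f => equi_mk₁_map hw (k.toOrderHom.monotone.functor.map f)⟩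

/-- The map from the constant string. -/
def toStepString {y z : D} (w : y ⟶ z) (hw : D.equi w) {n : SimplexCategory} (k : n ⟶ ⦋1⦌) :
    D.constDiag n y ⟶ stepString w hw k where
  hom :=
    { app i := (ComposableArrows.mk₁ w).map (homOfLE (Fin.zero_le (k.toOrderHom i)))
      naturality i j f := by
        refine Eq.trans ?_ ((ComposableArrows.mk₁ w).map_comp (homOfLE (Fin.zero_le (k.toOrderHom i)))
          (k.toOrderHom.monotone.functor.map f))
        exact Category.id_comp _ }

/-- The map to the constant string. -/
def fromStepString {y z : D} (w : y ⟶ z) (hw : D.equi w) {n : SimplexCategory} (k : n ⟶ ⦋1⦌) :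
    stepString w hw k ⟶ D.constDiag n z where
  hom :=
    { app i := (ComposableArrows.mk₁ w).map (homOfLE (Fin.le_last (k.toOrderHom i)))
      naturality i j f := by
        refine ((ComposableArrows.mk₁ w).map_comp (k.toOrderHom.monotone.functor.map f)
          (homOfLE (Fin.le_last (k.toOrderHom j)))).symm.trans ?_
        exact (Category.comp_id _).symm }

lemma toStepString_equi {y z : D} (w : y ⟶ z) (hw : D.equi w) {n : SimplexCategory}
    (k : n ⟶ ⦋1⦌) : (D.diag n).equi (toStepString w hw k) := fun i =>
  equi_mk₁_map hw (homOfLE (Fin.zero_le (k.toOrderHom i)))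

lemma fromStepString_equi {y z : D} (w : y ⟶ z) (hw : D.equi w) {n : SimplexCategory}
    (k : n ⟶ ⦋1⦌) : (D.diag n).equi (fromStepString w hw k) := fun i =>
  equi_mk₁_map hw (homOfLE (Fin.le_last (k.toOrderHom i)))

lemma stepString_zero {y z : D} (w : y ⟶ z) (hw : D.equi w) (n : SimplexCategory) :
    stepString w hw (SimplexCategory.const n ⦋1⦌ 0) = D.constDiag n y :=
  ObjectProperty.FullSubcategory.ext (CategoryTheory.Functor.hext (fun _ => rfl)
    (fun _ _ _ => heq_of_eq rfl))

lemma stepString_one {y z : D} (w : y ⟶ z) (hw : D.equi w) (n : SimplexCategory) :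
    stepString w hw (SimplexCategory.const n ⦋1⦌ 1) = D.constDiag n z :=
  ObjectProperty.FullSubcategory.ext (CategoryTheory.Functor.hext (fun _ => rfl)
    (fun _ _ _ => heq_of_eq rfl))

/-- At the constant `0` the intermediate string stays at `y` and the map to it is an identity, which
reduction deletes in both directions. -/
lemma fwd_bwd_zero {y z : D} (w : y ⟶ z) (hw : D.equi w) (n : SimplexCategory) :
    (Reduced.fwd (toStepString w hw (SimplexCategory.const n ⦋1⦌ 0))).comp
      (Reduced.bwd _ (toStepString_equi w hw (SimplexCategory.const n ⦋1⦌ 0))) =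
      Reduced.nil _ := by
  rw [Reduced.fwd_bwd_eqToHom _ (toStepString_equi w hw (SimplexCategory.const n ⦋1⦌ 0))
    (𝟙 _) (fun _ => D.equi.id_mem _) (stepString_zero w hw n), Reduced.fwd_id, Reduced.bwd_id,
    Reduced.nil_comp]
  ext i
  exact Category.comp_id _

lemma fwd_bwd_one {y z : D} (w : y ⟶ z) (hw : D.equi w) (n : SimplexCategory) :
    (Reduced.fwd (toStepString w hw (SimplexCategory.const n ⦋1⦌ 1))).comp
      (Reduced.bwd _ (toStepString_equi w hw (SimplexCategory.const n ⦋1⦌ 1))) =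
      (Reduced.fwd (D.constMap n w)).comp (Reduced.bwd (D.constMap n w) (constMap_equi _ hw)) := by
  refine Reduced.fwd_bwd_eqToHom _ (toStepString_equi w hw (SimplexCategory.const n ⦋1⦌ 1))
    _ _ (stepString_one w hw n) ?_
  ext i
  exact Category.comp_id _

lemma bwd_fwd_zero {y z : D} (w : y ⟶ z) (hw : D.equi w) (n : SimplexCategory) :
    (Reduced.bwd _ (fromStepString_equi w hw (SimplexCategory.const n ⦋1⦌ 0))).comp
      (Reduced.fwd (fromStepString w hw (SimplexCategory.const n ⦋1⦌ 0))) =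
      (Reduced.bwd (D.constMap n w) (constMap_equi _ hw)).comp (Reduced.fwd (D.constMap n w)) := by
  refine Reduced.bwd_fwd_eqToHom _ (fromStepString_equi w hw (SimplexCategory.const n ⦋1⦌ 0))
    _ _ (stepString_zero w hw n).symm ?_
  ext i
  exact Category.id_comp _

lemma bwd_fwd_one {y z : D} (w : y ⟶ z) (hw : D.equi w) (n : SimplexCategory) :
    (Reduced.bwd _ (fromStepString_equi w hw (SimplexCategory.const n ⦋1⦌ 1))).comp
      (Reduced.fwd (fromStepString w hw (SimplexCategory.const n ⦋1⦌ 1))) =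
      Reduced.nil _ := by
  rw [Reduced.bwd_fwd_eqToHom _ (fromStepString_equi w hw (SimplexCategory.const n ⦋1⦌ 1))
    (𝟙 _) (fun _ => D.equi.id_mem _) (stepString_one w hw n).symm, Reduced.fwd_id, Reduced.bwd_id,
    Reduced.nil_comp]
  ext i
  exact Category.id_comp _

/-- Going along a coloured arrow and back is homotopic to the identity. -/
def postFwdBwd (x : D) {y z : D} (w : y ⟶ z) (hw : D.equi w) :
    SSet.HomotopyFamily (𝟙 _) (D.postFwd x w ≫ D.postBwd x w hw) where
  -- The index `k` decides where the detour really leaves `y`: at a vertex sent to `0` the component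
  -- is an identity, at a vertex sent to `1` it is `w`. The two constant indices give the empty
  -- detour and the full round trip.
  op n k h := Reduced.comp h
    ((Reduced.fwd (toStepString w hw k)).comp (Reduced.bwd _ (toStepString_equi w hw k)))
  naturality θ k h := Reduced.map_comp (D.diagRestrict θ) h
    ((Reduced.fwd (toStepString w hw k)).comp (Reduced.bwd _ (toStepString_equi w hw k)))
  zero n h := by
    refine (congrArg (Reduced.comp h) (fwd_bwd_zero w hw n)).trans ?_
    exact Reduced.comp_nil h
  one n h := by
    refine (congrArg (Reduced.comp h) (fwd_bwd_one w hw n)).trans ?_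
    exact (Reduced.comp_assoc h _ _).symm

/-- Going back along a coloured arrow and forth is homotopic to the identity. -/
def postBwdFwd (x : D) {y z : D} (w : y ⟶ z) (hw : D.equi w) :
    SSet.HomotopyFamily (D.postBwd x w hw ≫ D.postFwd x w) (𝟙 _) where
  op n k h := Reduced.comp h
    ((Reduced.bwd _ (fromStepString_equi w hw k)).comp (Reduced.fwd (fromStepString w hw k)))
  naturality θ k h := Reduced.map_comp (D.diagRestrict θ) h
    ((Reduced.bwd _ (fromStepString_equi w hw k)).comp (Reduced.fwd (fromStepString w hw k)))
  zero n h := by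
    refine (congrArg (Reduced.comp h) (bwd_fwd_zero w hw n)).trans ?_
    exact (Reduced.comp_assoc h _ _).symm
  one n h := by
    refine (congrArg (Reduced.comp h) (bwd_fwd_one w hw n)).trans ?_
    exact Reduced.comp_nil h

/-- Going back along a coloured arrow and forth is homotopic to the identity. -/
def preFwdBwd {x y : D} (w : x ⟶ y) (hw : D.equi w) (z : D) :
    SSet.HomotopyFamily (D.preFwd w z ≫ D.preBwd w hw z) (𝟙 _) where
  op n k h := Reduced.comp
    ((Reduced.bwd _ (fromStepString_equi w hw k)).comp (Reduced.fwd (fromStepString w hw k))) h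
  naturality θ k h := Reduced.map_comp (D.diagRestrict θ)
    ((Reduced.bwd _ (fromStepString_equi w hw k)).comp (Reduced.fwd (fromStepString w hw k))) h
  zero n h := by
    refine (congrArg (fun a => Reduced.comp a h) (bwd_fwd_zero w hw n)).trans ?_
    exact Reduced.comp_assoc _ _ h
  one n h := by
    refine (congrArg (fun a => Reduced.comp a h) (bwd_fwd_one w hw n)).trans ?_
    exact Reduced.nil_comp h

/-- Going along a coloured arrow and back is homotopic to the identity. -/
def preBwdFwd {x y : D} (w : x ⟶ y) (hw : D.equi w) (z : D) :
    SSet.HomotopyFamily (𝟙 _) (D.preBwd w hw z ≫ D.preFwd w z) where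
  op n k h := Reduced.comp
    ((Reduced.fwd (toStepString w hw k)).comp (Reduced.bwd _ (toStepString_equi w hw k))) h
  naturality θ k h := Reduced.map_comp (D.diagRestrict θ)
    ((Reduced.fwd (toStepString w hw k)).comp (Reduced.bwd _ (toStepString_equi w hw k))) h
  zero n h := by
    refine (congrArg (fun a => Reduced.comp a h) (fwd_bwd_zero w hw n)).trans ?_
    exact Reduced.nil_comp h
  one n h := by
    refine (congrArg (fun a => Reduced.comp a h) (fwd_bwd_one w hw n)).trans ?_
    exact Reduced.comp_assoc _ _ h

lemma bijective_of_homotopyFamily {X Y : SSet.{u}} {f : X ⟶ Y} {g : Y ⟶ X}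
    (T : SSet.{u}) (h₁ : SSet.HomotopyClasses.precomp (f ≫ g) T = SSet.HomotopyClasses.precomp (𝟙 X) T)
    (h₂ : SSet.HomotopyClasses.precomp (g ≫ f) T = SSet.HomotopyClasses.precomp (𝟙 Y) T) :
    Function.Bijective (SSet.HomotopyClasses.precomp f T) := by
  rw [SSet.HomotopyClasses.precomp_comp, SSet.HomotopyClasses.precomp_id] at h₁ h₂
  exact Function.bijective_iff_has_inverse.mpr ⟨SSet.HomotopyClasses.precomp g T,
    congrFun h₂, congrFun h₁⟩

/-- The arrow taken backwards provides a homotopy inverse, by the two detour homotopies. -/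
lemma bijective_precomp_postFwd (x : D) {y z : D} (w : y ⟶ z) (hw : D.equi w) (T : SSet) :
    Function.Bijective (SSet.HomotopyClasses.precomp (D.postFwd x w) T) :=
  bijective_of_homotopyFamily T ((postFwdBwd x w hw).precomp_eq T).symm
    ((postBwdFwd x w hw).precomp_eq T)

lemma bijective_precomp_preFwd {x y : D} (w : x ⟶ y) (hw : D.equi w) (z : D) (T : SSet) :
    Function.Bijective (SSet.HomotopyClasses.precomp (D.preFwd w z) T) :=
  bijective_of_homotopyFamily T ((preFwdBwd w hw z).precomp_eq T)
    ((preBwdFwd w hw z).precomp_eq T).symm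

end CCat

/-! ### Coloured natural transformations induce homotopies of hammocks -/

namespace CategoryTheory.Functor

variable {J C D : Type*} [Category* J] [Category* C] [Category* D]

/-- The evaluation of a family of functors at a family of objects. -/
def evalFamily (H : J ⥤ C ⥤ D) (F : J ⥤ C) : J ⥤ D where
  obj j := (H.obj j).obj (F.obj j)
  map {i j} f := (H.map f).app (F.obj i) ≫ (H.obj j).map (F.map f)

/-- The functoriality of the evaluation of a family of functors at a family of objects. -/
def evalFamilyMap (H : J ⥤ C ⥤ D) {F G : J ⥤ C} (β : F ⟶ G) : H.evalFamily F ⟶ H.evalFamily G where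
  app j := (H.obj j).map (β.app j)
  naturality i j f := by
    dsimp only [evalFamily]
    rw [assoc, ← Functor.map_comp, β.naturality, Functor.map_comp, NatTrans.naturality_assoc]

end CategoryTheory.Functor

namespace CCat

open Zigzag Simplicial

variable {C D E : CCat.{v, u}}

/-- The coloured natural transformations. -/
structure ColouredTrans (φ ψ : C ⟶ D) where
  /-- the natural transformation -/
  trans : functor φ ⟶ functor ψ
  equi (x : C) : D.equi (trans.app x)

lemma hom_ext {φ ψ : C ⟶ D} (h : functor φ = functor ψ) : φ = ψ := by
  have aux : ∀ φ ψ : LocalizerMorphism C.equi D.equi, φ.functor = ψ.functor → φ = ψ := by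
    rintro ⟨F, _⟩ ⟨G, _⟩ h
    obtain rfl : F = G := h
    rfl
  exact aux φ ψ h

namespace ColouredTrans

variable {φ ψ : C ⟶ D} (α : ColouredTrans φ ψ)

/-- A natural transformation, seen as a diagram of functors. -/
abbrev cyl : ComposableArrows (C ⥤ D) 1 := ComposableArrows.mk₁ α.trans

lemma equi_cyl_obj_map (i : Fin 2) {x y : C} {f : x ⟶ y} (hf : C.equi f) :
    D.equi ((α.cyl.obj i).map f) := by
  fin_cases i
  · exact functor_map_equi φ hf
  · exact functor_map_equi ψ hf

lemma equi_cyl_map_app {i j : Fin 2} (f : i ⟶ j) (x : C) :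
    D.equi ((α.cyl.map f).app x) := by
  have hij := leOfHom f
  obtain rfl := Subsingleton.elim f (homOfLE hij)
  fin_cases i <;> fin_cases j
  · exact D.equi.id_mem _
  · exact α.equi x
  · exact absurd hij (by decide)
  · exact D.equi.id_mem _

/-- The map on strings of coloured arrows that is given by `φ`, then by `ψ`. -/
def mixDiag {n : SimplexCategory} (k : n ⟶ ⦋1⦌) : C.diag n ⟶ D.diag n where
  functor :=
    { obj := fun (F : C.Strings n) =>
        -- The object at place `i` is `φ` or `ψ` of the `i`-th object, according to `k i`. The arrow
        -- where `k` jumps is a component of `α` followed by an image under `ψ`, both coloured.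
        (⟨(k.toOrderHom.monotone.functor ⋙ α.cyl).evalFamily F.obj,
          fun i j f => D.equi.comp_mem _ _
            (α.equi_cyl_map_app (k.toOrderHom.monotone.functor.map f) (F.obj.obj i))
            (α.equi_cyl_obj_map (k.toOrderHom j) (F.property f))⟩ : D.Strings n)
      map := fun {F G} β => ⟨(k.toOrderHom.monotone.functor ⋙ α.cyl).evalFamilyMap β.hom⟩
      map_id := fun F => by
        ext i
        exact (α.cyl.obj (k.toOrderHom i)).map_id _
      map_comp := fun β γ => by
        ext i
        exact (α.cyl.obj (k.toOrderHom i)).map_comp _ _ }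
  map := fun _ _ _ hα i => α.equi_cyl_obj_map (k.toOrderHom i) (hα i)

/-- The arrows of the mixed string carry an additional factor `𝟙`, coming from the transformation
that does not move. The equality is thus not definitional, which is the origin of the casts below.
-/
lemma mixDiag_zero (n : SimplexCategory) :
    α.mixDiag (SimplexCategory.const n ⦋1⦌ 0) = diagMap φ n := by
  have hobj (F : C.diag n) : (functor (α.mixDiag (SimplexCategory.const n ⦋1⦌ 0))).obj F =
      (functor (diagMap φ n)).obj F :=
    ObjectProperty.FullSubcategory.ext (CategoryTheory.Functor.hext (fun _ => rfl)
      (fun _ _ _ => heq_of_eq (Category.id_comp _)))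
  have hfun : functor (α.mixDiag (SimplexCategory.const n ⦋1⦌ 0)) = functor (diagMap φ n) := by
    refine CategoryTheory.Functor.ext hobj (fun F G β => ?_)
    ext i
    refine Eq.trans ?_ (congrArg₂ (· ≫ ·) (Strings.eqToHom_app (hobj F) i)
      (congrArg (((functor φ).map (β.hom.app i)) ≫ ·) (Strings.eqToHom_app (hobj G).symm i))).symm
    exact ((Category.id_comp _).trans (Category.comp_id ((functor φ).map (β.hom.app i)))).symm
  exact hom_ext hfun

lemma mixDiag_one (n : SimplexCategory) :
    α.mixDiag (SimplexCategory.const n ⦋1⦌ 1) = diagMap ψ n := by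
  have hobj (F : C.diag n) : (functor (α.mixDiag (SimplexCategory.const n ⦋1⦌ 1))).obj F =
      (functor (diagMap ψ n)).obj F :=
    ObjectProperty.FullSubcategory.ext (CategoryTheory.Functor.hext (fun _ => rfl)
      (fun _ _ _ => heq_of_eq (Category.id_comp _)))
  have hfun : functor (α.mixDiag (SimplexCategory.const n ⦋1⦌ 1)) = functor (diagMap ψ n) := by
    refine CategoryTheory.Functor.ext hobj (fun F G β => ?_)
    ext i
    refine Eq.trans ?_ (congrArg₂ (· ≫ ·) (Strings.eqToHom_app (hobj F) i)
      (congrArg (((functor ψ).map (β.hom.app i)) ≫ ·) (Strings.eqToHom_app (hobj G).symm i))).symm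
    exact ((Category.id_comp _).trans (Category.comp_id ((functor ψ).map (β.hom.app i)))).symm
  exact hom_ext hfun

/-- The map from a constant string. -/
def toMix {n : SimplexCategory} (k : n ⟶ ⦋1⦌) (x : C) :
    D.constDiag n ((functor φ).obj x) ⟶ (functor (α.mixDiag k)).obj (C.constDiag n x) where
  hom :=
    { app i := (α.cyl.map (homOfLE (Fin.zero_le (k.toOrderHom i)))).app x
      naturality i j f := by
        refine (Category.id_comp _).trans ?_
        refine Eq.trans ?_ (congrArg (_ ≫ ·) (Category.comp_id _).symm |>.trans
          (congrArg (_ ≫ ·) (congrArg (_ ≫ ·) ((α.cyl.obj (k.toOrderHom j)).map_id x).symm)))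
        refine (congrArg (fun t : α.cyl.obj 0 ⟶ _ => t.app x) (α.cyl.map_comp (homOfLE (Fin.zero_le (k.toOrderHom i)))
          (k.toOrderHom.monotone.functor.map f))) }

/-- The map to a constant string. -/
def fromMix {n : SimplexCategory} (k : n ⟶ ⦋1⦌) (x : C) :
    (functor (α.mixDiag k)).obj (C.constDiag n x) ⟶ D.constDiag n ((functor ψ).obj x) where
  hom :=
    { app i := (α.cyl.map (homOfLE (Fin.le_last (k.toOrderHom i)))).app x
      naturality i j f := by
        refine Eq.trans ?_ (Category.comp_id _).symm
        refine (congrArg (· ≫ _) ((congrArg (_ ≫ ·) ((α.cyl.obj (k.toOrderHom j)).map_id x)).trans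
          (Category.comp_id _))).trans ?_
        exact (congrArg (fun t : _ ⟶ α.cyl.obj 1 => t.app x)
          (α.cyl.map_comp (k.toOrderHom.monotone.functor.map f)
            (homOfLE (Fin.le_last (k.toOrderHom j))))).symm }


lemma toMix_zero (n : SimplexCategory) (x : C)
    (h : D.constDiag n ((functor φ).obj x) =
      (functor (α.mixDiag (SimplexCategory.const n ⦋1⦌ 0))).obj (C.constDiag n x)) :
    α.toMix (SimplexCategory.const n ⦋1⦌ 0) x = eqToHom h := by
  ext i
  exact (Strings.eqToHom_app h i).symm

lemma fromMix_zero (n : SimplexCategory) (x : C)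
    (h : (functor (α.mixDiag (SimplexCategory.const n ⦋1⦌ 0))).obj (C.constDiag n x) =
      D.constDiag n ((functor φ).obj x)) :
    α.fromMix (SimplexCategory.const n ⦋1⦌ 0) x = eqToHom h ≫ D.constMap n (α.trans.app x) := by
  ext i
  refine Eq.trans ?_ (congrArg (· ≫ α.trans.app x) (Strings.eqToHom_app h i)).symm
  exact (Category.id_comp (α.trans.app x)).symm

lemma toMix_one (n : SimplexCategory) (x : C)
    (h : D.constDiag n ((functor ψ).obj x) =
      (functor (α.mixDiag (SimplexCategory.const n ⦋1⦌ 1))).obj (C.constDiag n x)) :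
    α.toMix (SimplexCategory.const n ⦋1⦌ 1) x = D.constMap n (α.trans.app x) ≫ eqToHom h := by
  ext i
  refine Eq.trans ?_ (congrArg (α.trans.app x ≫ ·) (Strings.eqToHom_app h i)).symm
  exact (Category.comp_id (α.trans.app x)).symm

lemma fromMix_one (n : SimplexCategory) (x : C)
    (h : (functor (α.mixDiag (SimplexCategory.const n ⦋1⦌ 1))).obj (C.constDiag n x) =
      D.constDiag n ((functor ψ).obj x)) :
    α.fromMix (SimplexCategory.const n ⦋1⦌ 1) x = eqToHom h := by
  ext i
  exact (Strings.eqToHom_app h i).symm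

/-- At the constant `0` the entrance `toMix` is a mere transport and the exit `fromMix` carries
`α_y`. Once casts are written as conjugations by `eqToHom`, the transports on either side compose to
those of the right-hand side. -/
lemma mix_zero (n : SimplexCategory) (x y : C)
    (h : Reduced (C.diag n) (C.constDiag n x) (C.constDiag n y)) :
    ((Reduced.fwd (α.toMix (SimplexCategory.const n ⦋1⦌ 0) x)).comp
      (Reduced.map (α.mixDiag (SimplexCategory.const n ⦋1⦌ 0)) h)).comp
        (Reduced.fwd (α.fromMix (SimplexCategory.const n ⦋1⦌ 0) y)) =
      (Reduced.cast (diagMap_obj_const φ n x) (diagMap_obj_const φ n y)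
        (Reduced.map (diagMap φ n) h)).comp (Reduced.fwd (D.constMap n (α.trans.app y))) := by
  have e₁ := diagMap_obj_const φ n x
  have e₂ := diagMap_obj_const φ n y
  have d := α.mixDiag_zero n
  rw [Reduced.map_eq d, α.toMix_zero n x (by rw [d, e₁]), α.fromMix_zero n y (by rw [d, e₂]),
    ← Reduced.fwd_comp, ← Reduced.comp_assoc, Reduced.cast_eq, Reduced.cast_eq]
  simp only [Reduced.comp_assoc]
  rw [← Reduced.comp_assoc (Reduced.fwd (eqToHom _)) (Reduced.fwd (eqToHom _)), Reduced.fwd_comp,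
    ← Reduced.comp_assoc (Reduced.fwd (eqToHom _)) (Reduced.fwd (eqToHom _))
      (Reduced.fwd (D.constMap n (α.trans.app y))), Reduced.fwd_comp, eqToHom_trans, eqToHom_trans]

/-- Symmetrically, at the constant `1` the entrance carries `α_x` and the exit is a transport. -/
lemma mix_one (n : SimplexCategory) (x y : C)
    (h : Reduced (C.diag n) (C.constDiag n x) (C.constDiag n y)) :
    ((Reduced.fwd (α.toMix (SimplexCategory.const n ⦋1⦌ 1) x)).comp
      (Reduced.map (α.mixDiag (SimplexCategory.const n ⦋1⦌ 1)) h)).comp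
        (Reduced.fwd (α.fromMix (SimplexCategory.const n ⦋1⦌ 1) y)) =
      (Reduced.fwd (D.constMap n (α.trans.app x))).comp
        (Reduced.cast (diagMap_obj_const ψ n x) (diagMap_obj_const ψ n y)
          (Reduced.map (diagMap ψ n) h)) := by
  have e₁ := diagMap_obj_const ψ n x
  have e₂ := diagMap_obj_const ψ n y
  have d := α.mixDiag_one n
  rw [Reduced.map_eq d, α.toMix_one n x (by rw [d, e₁]), α.fromMix_one n y (by rw [d, e₂]),
    ← Reduced.fwd_comp, Reduced.cast_eq, Reduced.cast_eq]
  simp only [Reduced.comp_assoc]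
  rw [← Reduced.comp_assoc (Reduced.fwd (eqToHom _)) (Reduced.fwd (eqToHom _)), Reduced.fwd_comp,
    Reduced.fwd_comp, eqToHom_trans, eqToHom_trans]

/-- The homotopy given by a coloured natural transformation. -/
def homotopyFamily (x y : C) :
    SSet.HomotopyFamily (mappingSpaceMap φ x y ≫ D.postFwd _ (α.trans.app y))
      (mappingSpaceMap ψ x y ≫ D.preFwd (α.trans.app x) _) where
  -- The image of the hammock under the mixture of `φ` and `ψ` does not begin and end at constant
  -- strings. It is completed by `toMix` at the start and `fromMix` at the end, so that `α` moves
  -- from the end of the zigzag to its beginning as `k` goes from `0` to `1`.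
  op n k h := (Reduced.comp (Reduced.fwd (α.toMix k x)) (Reduced.map (α.mixDiag k) h)).comp
    (Reduced.fwd (α.fromMix k y))
  naturality {m n} θ k h := by
    refine (Reduced.map_comp (D.diagRestrict θ)
      (Reduced.comp (Reduced.fwd (α.toMix k x)) (Reduced.map (α.mixDiag k) h))
      (Reduced.fwd (α.fromMix k y))).trans ?_
    refine congrArg (fun t => Reduced.comp t (Reduced.fwd (α.fromMix (θ ≫ k) y))) ?_
    refine (Reduced.map_comp (D.diagRestrict θ) (Reduced.fwd (α.toMix k x))
      (Reduced.map (α.mixDiag k) h)).trans ?_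
    refine congrArg (fun t => Reduced.comp (Reduced.fwd (α.toMix (θ ≫ k) x)) t) ?_
    exact (Reduced.map_map (α.mixDiag k) (D.diagRestrict θ) h).trans
      (Reduced.map_map (C.diagRestrict θ) (α.mixDiag (θ ≫ k)) h).symm
  zero n h := α.mix_zero n x y h
  one n h := α.mix_one n x y h

end ColouredTrans
end CCat

/-! ### Homotopy equivalences of coloured categories are equifunctors -/

namespace CCat

open Zigzag Simplicial

variable {C D E : CCat.{v, u}}

lemma Zigzag.Reduced.cast_cast {x x' x'' y y' y'' : C} (hx : x = x') (hx' : x' = x'') (hy : y = y')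
    (hy' : y' = y'') (h : Reduced C x y) :
    Reduced.cast hx' hy' (Reduced.cast hx hy h) =
      Reduced.cast (hx.trans hx') (hy.trans hy') h := by
  subst hx hx' hy hy'
  rfl

lemma mappingSpaceMap_id (x y : C) : mappingSpaceMap (𝟙 C) x y = 𝟙 _ := by
  ext n h
  obtain ⟨h⟩ := h
  exact congrArg (Quot.mk _) (Zigzag.map_id h)

lemma mappingSpaceMap_comp (φ : C ⟶ D) (ψ : D ⟶ E) (x y : C) :
    mappingSpaceMap (φ ≫ ψ) x y =
      mappingSpaceMap φ x y ≫ mappingSpaceMap ψ ((functor φ).obj x) ((functor φ).obj y) := by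
  ext n h
  have h₁ := Reduced.map_map (diagMap φ n.unop) (diagMap ψ n.unop) h
  have h₂ := Reduced.map_cast (diagMap ψ n.unop) (diagMap_obj_const φ n.unop x)
    (diagMap_obj_const φ n.unop y) (Reduced.map (diagMap φ n.unop) h)
  have h₃ := Reduced.cast_cast (congrArg (functor (diagMap ψ n.unop)).obj (diagMap_obj_const φ n.unop x))
    (diagMap_obj_const ψ n.unop ((functor φ).obj x))
    (congrArg (functor (diagMap ψ n.unop)).obj (diagMap_obj_const φ n.unop y))
    (diagMap_obj_const ψ n.unop ((functor φ).obj y))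
    (Reduced.map (diagMap ψ n.unop) (Reduced.map (diagMap φ n.unop) h))
  refine Eq.trans ?_ (congrArg (Reduced.cast _ _) h₂).symm
  refine Eq.trans ?_ h₃.symm
  exact congrArg (Reduced.cast _ _) h₁.symm

/-- An arrow, seen in the category of `0`-simplices of the hammock localisation. -/
def hammockFwd {x y : D} (w : x ⟶ y) : (⟨x⟩ : D.Hammock₀) ⟶ ⟨y⟩ :=
  Reduced.fwd (D.constMap ⦋0⦌ w)

/-- The inverse of a coloured arrow, in the category of `0`-simplices of the hammock
localisation. -/
def hammockBwd {x y : D} (w : x ⟶ y) (hw : D.equi w) : (⟨y⟩ : D.Hammock₀) ⟶ ⟨x⟩ :=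
  Reduced.bwd (D.constMap ⦋0⦌ w) (constMap_equi _ hw)

/-- The isomorphism given by a coloured arrow. -/
def pi₀Iso {x y : D} (w : x ⟶ y) (hw : D.equi w) :
    (CategoryTheory.Quotient.functor D.homotopyRel).obj ⟨x⟩ ≅ (CategoryTheory.Quotient.functor D.homotopyRel).obj ⟨y⟩ where
  hom := (CategoryTheory.Quotient.functor D.homotopyRel).map (hammockFwd w)
  inv := (CategoryTheory.Quotient.functor D.homotopyRel).map (hammockBwd w hw)
  hom_inv_id := by
    rw [← Functor.map_comp, ← CategoryTheory.Functor.map_id]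
    exact (CategoryTheory.Quotient.sound D.homotopyRel ((postFwdBwd x w hw).π₀Rel (𝟙 (⟨x⟩ : D.Hammock₀)))).symm
  inv_hom_id := by
    rw [← Functor.map_comp, ← CategoryTheory.Functor.map_id]
    exact CategoryTheory.Quotient.sound D.homotopyRel ((postBwdFwd y w hw).π₀Rel (𝟙 (⟨y⟩ : D.Hammock₀)))

/-- The natural isomorphism given by a coloured natural transformation. -/
def ColouredTrans.pi₀Iso {φ ψ : C ⟶ D} (α : ColouredTrans φ ψ) : pi₀Map φ ≅ pi₀Map ψ :=
  NatIso.ofComponents (fun X => CCat.pi₀Iso (α.trans.app X.as.as) (α.equi X.as.as)) (by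
    rintro X Y ⟨f⟩
    exact CategoryTheory.Quotient.sound D.homotopyRel ((α.homotopyFamily X.as.as Y.as.as).π₀Rel f))

/-- The compatibility of `π₀` with identities. -/
def pi₀MapId (C : CCat.{v, u}) : pi₀Map (𝟙 C) ≅ 𝟭 _ :=
  NatIso.ofComponents (fun X => Iso.refl _) (by
    rintro X Y ⟨f⟩
    refine (Category.comp_id _).trans (Eq.trans ?_ (Category.id_comp _).symm)
    obtain ⟨f⟩ := f
    exact congrArg (fun t => (CategoryTheory.Quotient.functor C.homotopyRel).map
        (X := X.as) (Y := Y.as) t) (congrArg (Quot.mk _) (Zigzag.map_id f)))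

/-- The compatibility of `π₀` with composition. -/
def pi₀MapComp (φ : C ⟶ D) (ψ : D ⟶ E) : pi₀Map (φ ≫ ψ) ≅ pi₀Map φ ⋙ pi₀Map ψ :=
  NatIso.ofComponents (fun X => Iso.refl _) (by
    rintro X Y ⟨f⟩
    refine (Category.comp_id _).trans (Eq.trans ?_ (Category.id_comp _).symm)
    exact congrArg (fun t => (CategoryTheory.Quotient.functor E.homotopyRel).map
        (X := (hammock₀Map (φ ≫ ψ)).obj X.as) (Y := (hammock₀Map (φ ≫ ψ)).obj Y.as) t)
      (congrArg (fun t : C.mappingSpace X.as.as Y.as.as ⟶ E.mappingSpace _ _ => t.app (op ⦋0⦌) f)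
        (mappingSpaceMap_comp φ ψ X.as.as Y.as.as)))

/-- On homotopy classes, the homotopy of `α` becomes a commutative square whose other two sides are
composition with the coloured arrows `α_y` and `α_x`. These are bijective and can be cancelled. -/
lemma ColouredTrans.bijective_iff {φ ψ : C ⟶ D} (α : ColouredTrans φ ψ) (x y : C) (T : SSet) :
    Function.Bijective (SSet.HomotopyClasses.precomp (mappingSpaceMap φ x y) T) ↔
      Function.Bijective (SSet.HomotopyClasses.precomp (mappingSpaceMap ψ x y) T) := by
  have h := (α.homotopyFamily x y).precomp_eq T
  rw [SSet.HomotopyClasses.precomp_comp, SSet.HomotopyClasses.precomp_comp] at h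
  rw [← Function.Bijective.of_comp_iff _ (bijective_precomp_postFwd _ _ (α.equi y) T), h,
    Function.Bijective.of_comp_iff _ (bijective_precomp_preFwd _ (α.equi x) _ T)]

/-- The homotopy relation on colour-preserving functors, generated by the coloured natural
transformations. -/
def homotopic : HomRel CCat.{v, u} := fun _ _ φ ψ =>
  Relation.EqvGen (fun φ ψ => Nonempty (ColouredTrans φ ψ)) φ ψ

/-- Compatibility with composition is whiskering. The relation has to be generated, since a coloured
transformation need not be reversible. -/
instance : Congruence homotopic.{v, u} where
  equivalence := Relation.EqvGen.is_equivalence _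
  comp_left {C D E} φ {ψ ψ'} h := by
    induction h with
    | rel _ _ h =>
      obtain ⟨α⟩ := h
      exact .rel _ _ ⟨⟨Functor.whiskerLeft (functor φ) α.trans, fun x => α.equi _⟩⟩
    | refl _ => exact .refl _
    | symm _ _ _ h => exact .symm _ _ h
    | trans _ _ _ _ _ h h' => exact .trans _ _ _ h h'
  comp_right {C D E} φ {ψ ψ'} h := by
    induction h with
    | rel _ _ h =>
      obtain ⟨α⟩ := h
      exact .rel _ _ ⟨⟨Functor.whiskerRight α.trans (functor ψ'), fun x =>
        functor_map_equi ψ' (α.equi x)⟩⟩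
    | refl _ => exact .refl _
    | symm _ _ _ h => exact .symm _ _ h
    | trans _ _ _ _ _ h h' => exact .trans _ _ _ h h'

lemma homotopic.nonempty_pi₀Iso {φ ψ : C ⟶ D} (h : homotopic φ ψ) :
    Nonempty (pi₀Map φ ≅ pi₀Map ψ) := by
  induction h with
  | rel _ _ h => exact h.map ColouredTrans.pi₀Iso
  | refl _ => exact ⟨Iso.refl _⟩
  | symm _ _ _ h => exact h.map Iso.symm
  | trans _ _ _ _ _ h h' =>
    obtain ⟨h⟩ := h
    exact h'.map (h.trans ·)

lemma homotopic.bijective_iff {φ ψ : C ⟶ D} (h : homotopic φ ψ) (x y : C) (T : SSet) :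
    Function.Bijective (SSet.HomotopyClasses.precomp (mappingSpaceMap φ x y) T) ↔
      Function.Bijective (SSet.HomotopyClasses.precomp (mappingSpaceMap ψ x y) T) := by
  induction h with
  | rel _ _ h =>
    obtain ⟨α⟩ := h
    exact α.bijective_iff x y T
  | refl _ => exact Iff.rfl
  | symm _ _ _ h => exact h.symm
  | trans _ _ _ _ _ h h' => exact h.trans h'

lemma precomp_mappingSpaceMap_comp (φ : C ⟶ D) (ψ : D ⟶ E) (x y : C) (T : SSet) :
    SSet.HomotopyClasses.precomp (mappingSpaceMap (φ ≫ ψ) x y) T =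
      SSet.HomotopyClasses.precomp (mappingSpaceMap φ x y) T ∘
        SSet.HomotopyClasses.precomp
          (mappingSpaceMap ψ ((functor φ).obj x) ((functor φ).obj y)) T :=
  (congrArg (fun t => SSet.HomotopyClasses.precomp t T) (mappingSpaceMap_comp φ ψ x y)).trans
    (SSet.HomotopyClasses.precomp_comp _ _ T)

lemma bijective_precomp_mappingSpaceMap_id (x y : C) (T : SSet) :
    Function.Bijective (SSet.HomotopyClasses.precomp (mappingSpaceMap (𝟙 C) x y) T) := by
  have h := (congrArg (fun t => SSet.HomotopyClasses.precomp t T) (mappingSpaceMap_id x y)).trans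
    (SSet.HomotopyClasses.precomp_id _ T)
  exact h.symm ▸ Function.bijective_id

/-- Homotopy equivalences of coloured categories are equifunctors. -/
lemma equifunctors_of_homotopic {φ : C ⟶ D} {ψ : D ⟶ C} (h₁ : homotopic (φ ≫ ψ) (𝟙 C))
    (h₂ : homotopic (ψ ≫ φ) (𝟙 D)) : equifunctors φ := by
  refine ⟨?_, fun x y T _ => ?_⟩
  · obtain ⟨e₁⟩ := h₁.nonempty_pi₀Iso
    obtain ⟨e₂⟩ := h₂.nonempty_pi₀Iso
    exact Functor.IsEquivalence.mk' (pi₀Map ψ)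
      ((pi₀MapId C).symm ≪≫ e₁.symm ≪≫ pi₀MapComp φ ψ)
      ((pi₀MapComp ψ φ).symm ≪≫ e₂ ≪≫ pi₀MapId D)
  · have b₁ := (h₁.bijective_iff x y T).mpr (bijective_precomp_mappingSpaceMap_id x y T)
    have b₂ := (h₂.bijective_iff ((functor φ).obj x) ((functor φ).obj y) T).mpr
      (bijective_precomp_mappingSpaceMap_id _ _ T)
    rw [precomp_mappingSpaceMap_comp] at b₁ b₂
    -- Two-out-of-six: the map of `ψ` is injective on classes by `b₁` and surjective by `b₂`, hence
    -- bijective, and then `b₁` gives the map of `φ`. The map of `φ` in `b₂` is taken at other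
    -- objects, so two-out-of-three would not suffice.
    exact (Function.Bijective.of_comp_iff _ ⟨b₁.injective.of_comp, b₂.surjective.of_comp⟩).mp b₁

/-- The homotopy category of coloured categories. -/
abbrev toHo : CCat.{v, u} ⥤ CategoryTheory.Quotient homotopic.{v, u} := CategoryTheory.Quotient.functor _

/-- The functor to the quotient is full, so an inverse there lifts to a homotopy inverse. Phrasing
homotopy equivalences as isomorphisms of a category makes cancellation available. -/
lemma equifunctors_of_isIso (φ : C ⟶ D) [IsIso (toHo.map φ)] : equifunctors φ := by
  obtain ⟨ψ, hψ⟩ := toHo.map_surjective (inv (toHo.map φ))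
  refine equifunctors_of_homotopic (ψ := ψ) ?_ ?_
  · refine (CategoryTheory.Quotient.functor_map_eq_iff homotopic (φ ≫ ψ) (𝟙 C)).mp ?_
    rw [CategoryTheory.Functor.map_comp, hψ, IsIso.hom_inv_id, CategoryTheory.Functor.map_id]
  · refine (CategoryTheory.Quotient.functor_map_eq_iff homotopic (ψ ≫ φ) (𝟙 D)).mp ?_
    rw [CategoryTheory.Functor.map_comp, hψ, IsIso.inv_hom_id, CategoryTheory.Functor.map_id]

lemma toHo_map_eq {φ ψ : C ⟶ D} (α : ColouredTrans φ ψ) : toHo.map φ = toHo.map ψ :=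
  CategoryTheory.Quotient.sound _ (.rel _ _ ⟨α⟩)

end CCat

/-! ## Monoidal model categories -/

namespace MonoidalModelCategory

lemma cofibration_isIso_comp {C : Type*} [Category* C] [ModelCategory C] {X Y Z : C} (e : X ⟶ Y)
    [IsIso e] (f : Y ⟶ Z) (hf : Cofibration f) : Cofibration (e ≫ f) :=
  inferInstance

lemma weakEquivalence_isIso_comp {C : Type*} [Category* C] [ModelCategory C] {X Y Z : C} (e : X ⟶ Y)
    [IsIso e] (f : Y ⟶ Z) (hf : WeakEquivalence f) : WeakEquivalence (e ≫ f) :=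
  inferInstance

section Tensor

variable {M : Type u} [Category.{v} M] [MonoidalCategory M] [ModelCategory M]
  [MonoidalModelCategory M]

/-- Tensoring on the right is a left adjoint and so preserves the initial object: both ends are
initial. -/
lemma isIso_whiskerLeft_initial {Y Y' : M} (i : Y ⟶ Y') : IsIso ((⊥_ M) ◁ i) := by
  have (Z : M) : PreservesColimitsOfSize.{0, 0} (tensorRight Z) :=
    have := closed_right Z
    (Adjunction.ofIsLeftAdjoint (tensorRight Z)).leftAdjoint_preservesColimits
  have hY (Z : M) : IsInitial ((⊥_ M) ⊗ Z) :=
    initialIsInitial.isInitialObj (tensorRight Z) _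
  exact isIso_of_isInitial (hY Y) (hY Y') _

lemma isIso_initial_whiskerRight {Y Y' : M} (i : Y ⟶ Y') : IsIso (i ▷ (⊥_ M)) := by
  have (Z : M) : PreservesColimitsOfSize.{0, 0} (tensorLeft Z) :=
    have := closed_left Z
    (Adjunction.ofIsLeftAdjoint (tensorLeft Z)).leftAdjoint_preservesColimits
  have hY (Z : M) : IsInitial (Z ⊗ (⊥_ M)) :=
    initialIsInitial.isInitialObj (tensorLeft Z) _
  exact isIso_of_isInitial (hY Y) (hY Y') _

/-- Tensoring an arrow with an object is a pushout-product. -/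
lemma exists_pushoutProduct_left (X : M) {Y Y' : M} (i : Y ⟶ Y') :
    ∃ (e : X ⊗ Y ⟶ ((MonoidalCategory.Arrow.pushoutProduct.obj
        (Arrow.mk (initial.to X))).obj (Arrow.mk i)).left), IsIso e ∧
      e ≫ ((MonoidalCategory.Arrow.pushoutProduct.obj
        (Arrow.mk (initial.to X))).obj (Arrow.mk i)).hom = X ◁ i := by
  let sq := Functor.PushoutObjObj.ofHasPushout (curriedTensor M) (initial.to X) i
  have h := sq.isPushout
  -- One leg of the span is an isomorphism between initial objects, so the opposite leg of the
  -- pushout is one as well.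
  have : IsIso (((curriedTensor M).obj (⊥_ M)).map i) := isIso_whiskerLeft_initial i
  exact ⟨sq.inl, h.isIso_inl_of_isIso, sq.inl_ι⟩

lemma exists_pushoutProduct_right {Y Y' : M} (i : Y ⟶ Y') (X : M) :
    ∃ (e : Y ⊗ X ⟶ ((MonoidalCategory.Arrow.pushoutProduct.obj
        (Arrow.mk i)).obj (Arrow.mk (initial.to X))).left), IsIso e ∧
      e ≫ ((MonoidalCategory.Arrow.pushoutProduct.obj
        (Arrow.mk i)).obj (Arrow.mk (initial.to X))).hom = i ▷ X := by
  let sq := Functor.PushoutObjObj.ofHasPushout (curriedTensor M) i (initial.to X)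
  have h := sq.isPushout
  have : IsIso (((curriedTensor M).map i).app (⊥_ M)) := isIso_initial_whiskerRight i
  exact ⟨sq.inr, h.isIso_inr_of_isIso, sq.inr_ι⟩

lemma cofibration_whiskerLeft (X : M) [IsCofibrant X] {Y Y' : M} (i : Y ⟶ Y') [Cofibration i] :
    Cofibration (X ◁ i) := by
  obtain ⟨e, _, he⟩ := exists_pushoutProduct_left X i
  have := pushoutProduct_cofibration (Arrow.mk (initial.to X)) (Arrow.mk i) ‹_› ‹_›
  exact he ▸ cofibration_isIso_comp e _ this

lemma weakEquivalence_whiskerLeft_of_cofibration (X : M) [IsCofibrant X] {Y Y' : M} (i : Y ⟶ Y')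
    [Cofibration i] [WeakEquivalence i] : WeakEquivalence (X ◁ i) := by
  obtain ⟨e, _, he⟩ := exists_pushoutProduct_left X i
  have := pushoutProduct_weakEquivalence (Arrow.mk (initial.to X)) (Arrow.mk i) ‹_› ‹_› (.inr ‹_›)
  exact he ▸ weakEquivalence_isIso_comp e _ this

lemma weakEquivalence_whiskerRight_of_cofibration {Y Y' : M} (i : Y ⟶ Y')
    [Cofibration i] [WeakEquivalence i] (X : M) [IsCofibrant X] : WeakEquivalence (i ▷ X) := by
  obtain ⟨e, _, he⟩ := exists_pushoutProduct_right i X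
  have := pushoutProduct_weakEquivalence (Arrow.mk i) (Arrow.mk (initial.to X)) ‹_› ‹_› (.inl ‹_›)
  exact he ▸ weakEquivalence_isIso_comp e _ this

lemma isCofibrant_tensor (X Y : M) [IsCofibrant X] [IsCofibrant Y] : IsCofibrant (X ⊗ Y) := by
  have : PreservesColimitsOfSize.{0, 0} (tensorLeft X) :=
    have := closed_left X
    (Adjunction.ofIsLeftAdjoint (tensorLeft X)).leftAdjoint_preservesColimits
  have h : IsInitial (X ⊗ (⊥_ M)) := initialIsInitial.isInitialObj (tensorLeft X) _
  rw [isCofibrant_iff_of_isInitial (X ◁ initial.to Y) h]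
  exact cofibration_whiskerLeft X (initial.to Y)

/-- Ken Brown's lemma: a functor that sends trivial cofibrations between cofibrant objects to weak
equivalences preserves the weak equivalences between cofibrant objects. -/
lemma weakEquivalence_map_of_isCofibrant {C D : Type*} [Category* C] [Category* D] [ModelCategory C]
    [ModelCategory D] (F : C ⥤ D)
    (hF : ∀ ⦃X Y : C⦄ (i : X ⟶ Y) [Cofibration i] [WeakEquivalence i], WeakEquivalence (F.map i))
    {X Y : C} (f : X ⟶ Y) [IsCofibrant X] [IsCofibrant Y] [WeakEquivalence f] :
    WeakEquivalence (F.map f) := by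
  obtain ⟨h⟩ : Nonempty (CofibrantBrownFactorization f) := inferInstance
  have h₁ := hF h.i
  have h₂ := hF h.s
  -- `p` is a retraction of the trivial cofibration `s`, so two-out-of-three applies to `F.map h.p`.
  have h₃ : WeakEquivalence (F.map h.p) := by
    have : F.map h.s ≫ F.map h.p = 𝟙 _ := by rw [← F.map_comp, h.s_p, F.map_id]
    exact weakEquivalence_of_precomp_of_fac this
  rw [← h.fac, F.map_comp]
  infer_instance

lemma weakEquivalence_whiskerLeft (X : M) [IsCofibrant X] {Y Y' : M} (f : Y ⟶ Y') [IsCofibrant Y]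
    [IsCofibrant Y'] [WeakEquivalence f] : WeakEquivalence (X ◁ f) :=
  weakEquivalence_map_of_isCofibrant (tensorLeft X)
    (fun _ _ i _ _ => weakEquivalence_whiskerLeft_of_cofibration X i) f

lemma weakEquivalence_whiskerRight {Y Y' : M} (f : Y ⟶ Y') [IsCofibrant Y]
    [IsCofibrant Y'] [WeakEquivalence f] (X : M) [IsCofibrant X] : WeakEquivalence (f ▷ X) :=
  weakEquivalence_map_of_isCofibrant (tensorRight X)
    (fun _ _ i _ _ => weakEquivalence_whiskerRight_of_cofibration i X) f

lemma weakEquivalence_tensorHom {X X' Y Y' : M} (f : X ⟶ X') (g : Y ⟶ Y') [IsCofibrant X]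
    [IsCofibrant X'] [IsCofibrant Y] [IsCofibrant Y'] [WeakEquivalence f] [WeakEquivalence g] :
    WeakEquivalence (f ⊗ₘ g) := by
  have := weakEquivalence_whiskerRight f Y
  have := weakEquivalence_whiskerLeft X' g
  rw [MonoidalCategory.tensorHom_def]
  infer_instance

/-- By naturality of the unitor the arrow is `(f ▷ Y ≫ λ_Y) ≫ g`. The first factor is a weak
equivalence by the unit axiom; Ken Brown's lemma would not do, as the unit need not be cofibrant. -/
lemma weakEquivalence_unit_tensor {X Y : M} (f : X ⟶ 𝟙_ M) (g : Y ⟶ 𝟙_ M) [IsCofibrant X]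
    [IsCofibrant Y] [WeakEquivalence f] [WeakEquivalence g] :
    WeakEquivalence ((f ⊗ₘ g) ≫ (λ_ (𝟙_ M)).hom) := by
  have := unit_left f Y ‹_› ‹_› ‹_›
  rw [MonoidalCategory.tensorHom_def, assoc, leftUnitor_naturality, ← assoc]
  infer_instance

end Tensor

/-! ### A functorial cospan between objects over a base -/

section Replacement

variable {M : Type u} [Category.{v} M] [ModelCategory M]
  (data : MorphismProperty.FunctorialFactorizationData (cofibrations M) (trivialFibrations M))
  {B : M} (z : Over B)

/-- The replacement of an object `w` over `B` that receives maps from `w` and from `z`. -/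
def replacement : Over B ⥤ Over B where
  obj w := Over.mk (data.factorizationData (coprod.desc w.hom z.hom)).p
  map {w w'} f := Over.homMk (data.mapZ (Arrow.homMk (coprod.map f.left (𝟙 _)) (𝟙 B) (by simp)))
    ((data.mapZ_p _).trans (Category.comp_id _))
  map_id w := by
    ext
    refine Eq.trans ?_ (data.mapZ_id (coprod.desc w.hom z.hom))
    refine congrArg data.mapZ (Arrow.hom_ext _ _ ?_ rfl)
    simp
  map_comp f g := by
    ext
    refine Eq.trans ?_ (data.mapZ_comp _ _)
    refine congrArg data.mapZ (Arrow.hom_ext _ _ ?_ ?_)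
    · simp
    · simp

/-- The natural transformation from the identity to the replacement. -/
def toReplacement : 𝟭 (Over B) ⟶ replacement data z where
  app w := Over.homMk (coprod.inl ≫ (data.factorizationData (coprod.desc w.hom z.hom)).i) (by
    change (_ ≫ _) ≫ (data.factorizationData (coprod.desc w.hom z.hom)).p = _
    rw [assoc, MorphismProperty.MapFactorizationData.fac]
    exact coprod.inl_desc _ _)
  naturality w w' f := by
    ext
    change f.left ≫ coprod.inl ≫ _ = (coprod.inl ≫ _) ≫ data.mapZ _
    rw [assoc, data.i_mapZ]
    simp

/-- The natural transformation from the constant functor to the replacement. -/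
def constToReplacement : (Functor.const (Over B)).obj z ⟶ replacement data z where
  app w := Over.homMk (coprod.inr ≫ (data.factorizationData (coprod.desc w.hom z.hom)).i) (by
    change (_ ≫ _) ≫ (data.factorizationData (coprod.desc w.hom z.hom)).p = _
    rw [assoc, MorphismProperty.MapFactorizationData.fac]
    exact coprod.inr_desc _ _)
  naturality w w' f := by
    ext
    change 𝟙 _ ≫ coprod.inr ≫ _ = (coprod.inr ≫ _) ≫ data.mapZ _
    rw [assoc, data.i_mapZ]
    simp

/-- Since `z` is cofibrant, `w ⟶ w ⨿ z` is a cofibration, and it is followed by the cofibration of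
the factorisation. -/
lemma isCofibrant_replacement (w : Over B) [IsCofibrant w.left] [IsCofibrant z.left] :
    IsCofibrant ((replacement data z).obj w).left := by
  have h₁ : Cofibration (coprod.inl : w.left ⟶ w.left ⨿ z.left) := inferInstance
  have h₂ : Cofibration (data.factorizationData (coprod.desc w.hom z.hom)).i :=
    (cofibration_iff _).mpr (data.factorizationData (coprod.desc w.hom z.hom)).hi
  have : IsCofibrant (w.left ⨿ z.left) := isCofibrant_of_cofibration (coprod.inl : w.left ⟶ _)
  exact @isCofibrant_of_cofibration _ _ _ _ _ _ _
    (data.factorizationData (coprod.desc w.hom z.hom)).i h₂ this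

lemma weakEquivalence_replacement (w : Over B) :
    WeakEquivalence ((replacement data z).obj w).hom :=
  inferInstanceAs (WeakEquivalence (data.factorizationData (coprod.desc w.hom z.hom)).p)

end Replacement

end MonoidalModelCategory

/-! ## Coherent families indexed by the arrows of an ordinal -/

section Filling

variable {n : ℕ}

/-- A family of elements of a semigroup indexed by the edges of an ordinal extends to a
multiplicative family indexed by its arrows. -/
lemma exists_mul_family {S : Type*} [Semigroup S] (e : Fin n → S) :
    ∃ s : ∀ a b : Fin (n + 1), a < b → S,
      (∀ j : Fin n, s j.castSucc j.succ j.castSucc_lt_succ = e j) ∧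
      ∀ a b c (hab : a < b) (hbc : b < c), s a c (hab.trans hbc) = s a b hab * s b c hbc := by
  -- Recursion on the end point, which is therefore the first argument: the product of the edges
  -- from `a` to `b`, bracketed to the left. There is no unit, so the one-edge product is a separate
  -- case.
  let s : ∀ b a : Fin (n + 1), a < b → S :=
    Fin.induction (motive := fun b => ∀ a : Fin (n + 1), a < b → S)
      (fun a h => absurd h (Fin.not_lt_zero a))
      (fun j ih a h => if ha : a = j.castSucc then e j else
        ih a (lt_of_le_of_ne (Fin.le_castSucc_iff.mpr h) ha) * e j)
  have h₁ (j : Fin n) : s j.succ j.castSucc j.castSucc_lt_succ = e j := by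
    simp [s, Fin.induction_succ]
  have h₂ (a : Fin (n + 1)) (j : Fin n) (h : a < j.castSucc) :
      s j.succ a (h.trans j.castSucc_lt_succ) = s j.castSucc a h * e j := by
    simp [s, Fin.induction_succ, h.ne]
  refine ⟨fun a b h => s b a h, h₁, fun a b c hab hbc => ?_⟩
  beta_reduce
  induction c using Fin.induction with
  | zero => exact absurd hbc (Fin.not_lt_zero b)
  | succ j ih =>
    rcases (Fin.le_castSucc_iff.mpr hbc).eq_or_lt with rfl | hb
    · rw [h₂ a j hab, h₁]
    · rw [h₂ a j (hab.trans hb), h₂ b j hb, ih hb, mul_assoc]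

lemma mul_family_ext {S : Type*} [Semigroup S] {s t : ∀ a b : Fin (n + 1), a < b → S}
    (hs : ∀ a b c (hab : a < b) (hbc : b < c), s a c (hab.trans hbc) = s a b hab * s b c hbc)
    (ht : ∀ a b c (hab : a < b) (hbc : b < c), t a c (hab.trans hbc) = t a b hab * t b c hbc)
    (h : ∀ j : Fin n, s j.castSucc j.succ j.castSucc_lt_succ = t j.castSucc j.succ j.castSucc_lt_succ) :
    s = t := by
  funext a b hab
  induction b using Fin.induction with
  | zero => exact absurd hab (Fin.not_lt_zero a)
  | succ j ih =>
    rcases (Fin.le_castSucc_iff.mpr hab).eq_or_lt with rfl | ha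
    · exact h j
    · rw [hs a j.castSucc j.succ ha j.castSucc_lt_succ, ht a j.castSucc j.succ ha j.castSucc_lt_succ,
        ih ha, h j]

variable (M : Type u) [Category.{v} M] [MonoidalCategory M]

variable (n) in
/-- A family of objects of a monoidal category indexed by the arrows of an ordinal, which is
coherently multiplicative. -/
structure CoherentFamily where
  /-- the objects -/
  obj : ∀ a b : Fin (n + 1), a < b → M
  /-- the multiplicativity -/
  mul : ∀ a b c (hab : a < b) (hbc : b < c), obj a c (hab.trans hbc) ≅ obj a b hab ⊗ obj b c hbc
  coherence : ∀ a b c d (hab : a < b) (hbc : b < c) (hcd : c < d),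
    (mul a b d hab (hbc.trans hcd)).hom ≫ (_ ◁ (mul b c d hbc hcd).hom) =
      (mul a c d (hab.trans hbc) hcd).hom ≫ ((mul a b c hab hbc).hom ▷ _) ≫ (α_ _ _ _).hom

namespace CoherentFamily

variable {M} {T T' : CoherentFamily n M} {P : Fin (n + 1) → Fin (n + 1) → Prop}

/-- The constant family at the unit object. -/
def unit (M : Type u) [Category.{v} M] [MonoidalCategory M] (n : ℕ) : CoherentFamily n M where
  obj _ _ _ := 𝟙_ M
  mul _ _ _ _ _ := (λ_ (𝟙_ M)).symm
  coherence _ _ _ _ _ _ _ := by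
    dsimp
    monoidal

/-- The multiplicative families of arrows. -/
def IsMul (hP : ∀ {a b c}, a < b → b < c → P a c → P a b ∧ P b c)
    (f : ∀ a b (hab : a < b), P a b → (T.obj a b hab ⟶ T'.obj a b hab)) : Prop :=
  ∀ a b c (hab : a < b) (hbc : b < c) (h : P a c),
    f a c (hab.trans hbc) h ≫ (T'.mul a b c hab hbc).hom =
      (T.mul a b c hab hbc).hom ≫ (f a b hab (hP hab hbc h).1 ⊗ₘ f b c hbc (hP hab hbc h).2)

/-- A family of arrows indexed by the edges of an ordinal extends to a multiplicative family. -/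
lemma exists_isMul (hP : ∀ {a b c}, a < b → b < c → P a c → P a b ∧ P b c)
    (e : ∀ j : Fin n, P j.castSucc j.succ → (T.obj j.castSucc j.succ j.castSucc_lt_succ ⟶
      T'.obj j.castSucc j.succ j.castSucc_lt_succ)) :
    ∃ f : ∀ a b (hab : a < b), P a b → (T.obj a b hab ⟶ T'.obj a b hab),
      (∀ j h, f j.castSucc j.succ j.castSucc_lt_succ h = e j h) ∧ IsMul hP f := by
  -- The same recursion, conjugated by the isomorphisms `mul`. The predicate `P` passes to
  -- subintervals, so both factors are defined; it will be `True` for morphisms of diagrams and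
  -- `K.Equi` for the maps to the unit.
  let f : ∀ b a (hab : a < b), P a b → (T.obj a b hab ⟶ T'.obj a b hab) :=
    Fin.induction (motive := fun b => ∀ a (hab : a < b), P a b → (T.obj a b hab ⟶ T'.obj a b hab))
      (fun a h => absurd h (Fin.not_lt_zero a))
      (fun j ih a h hp => if ha : a = j.castSucc then by subst ha; exact e j hp else
        have ha' := lt_of_le_of_ne (Fin.le_castSucc_iff.mpr h) ha
        (T.mul a j.castSucc j.succ ha' j.castSucc_lt_succ).hom ≫
          (ih a ha' (hP ha' j.castSucc_lt_succ hp).1 ⊗ₘ e j (hP ha' j.castSucc_lt_succ hp).2) ≫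
          (T'.mul a j.castSucc j.succ ha' j.castSucc_lt_succ).inv)
  have h₁ (j : Fin n) (h : P j.castSucc j.succ) :
      f j.succ j.castSucc j.castSucc_lt_succ h = e j h := by
    simp [f, Fin.induction_succ]
  have h₂ (a : Fin (n + 1)) (j : Fin n) (h : a < j.castSucc) (hp : P a j.succ) :
      f j.succ a (h.trans j.castSucc_lt_succ) hp =
      (T.mul a j.castSucc j.succ h j.castSucc_lt_succ).hom ≫
          (f j.castSucc a h (hP h j.castSucc_lt_succ hp).1 ⊗ₘ e j (hP h j.castSucc_lt_succ hp).2) ≫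
          (T'.mul a j.castSucc j.succ h j.castSucc_lt_succ).inv := by
    simp [f, Fin.induction_succ, h.ne]
  refine ⟨fun a b h => f b a h, h₁, fun a b c hab hbc hp => ?_⟩
  beta_reduce
  induction c using Fin.induction with
  | zero => exact absurd hbc (Fin.not_lt_zero b)
  | succ j ih =>
    rcases (Fin.le_castSucc_iff.mpr hbc).eq_or_lt with rfl | hb
    · simp [h₂ a j hab, h₁]
    · have hj := j.castSucc_lt_succ
      have hp' := hP hab hbc hp
      have ih' := ih hb (hP (hab.trans hb) hj hp).1
      -- Composing with the isomorphism that splits off the last edge inside the second factor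
      -- brings both sides to a triple tensor product. There the coherence of `T'`, then that of
      -- `T`, changes the bracketing.
      rw [h₂ a j (hab.trans hb), h₂ b j hb,
        ← cancel_mono (T'.obj a b hab ◁ (T'.mul b j.castSucc j.succ hb hj).hom)]
      simp only [assoc]
      rw [T'.coherence a b j.castSucc j.succ hab hb hj, Iso.inv_hom_id_assoc, ← tensorHom_id,
        tensorHom_comp_tensorHom_assoc, ih', Category.comp_id]
      simp only [← id_tensorHom, tensorHom_comp_tensorHom, assoc, Iso.inv_hom_id, Category.comp_id]
      have co := T.coherence a b j.castSucc j.succ hab hb hj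
      rw [← Category.id_comp (f b a hab _), ← tensorHom_comp_tensorHom, id_tensorHom, reassoc_of% co,
        ← Category.id_comp (e j _), ← tensorHom_comp_tensorHom, tensorHom_id, Category.assoc,
        Category.id_comp, associator_naturality, Category.id_comp]

/-- As the `mul` of the target are isomorphisms, multiplicativity determines the value on a long
arrow from shorter ones. -/
lemma IsMul.ext {hP : ∀ {a b c}, a < b → b < c → P a c → P a b ∧ P b c}
    {f g : ∀ a b (hab : a < b), P a b → (T.obj a b hab ⟶ T'.obj a b hab)}
    (hf : IsMul hP f) (hg : IsMul hP g)
    (h : ∀ (j : Fin n) h, f j.castSucc j.succ j.castSucc_lt_succ h = g j.castSucc j.succ j.castSucc_lt_succ h) :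
    f = g := by
  funext a b hab hp
  induction b using Fin.induction with
  | zero => exact absurd hab (Fin.not_lt_zero a)
  | succ j ih =>
    rcases (Fin.le_castSucc_iff.mpr hab).eq_or_lt with rfl | ha
    · exact h j hp
    · rw [← cancel_mono (T'.mul a j.castSucc j.succ ha j.castSucc_lt_succ).hom,
        hf a j.castSucc j.succ ha j.castSucc_lt_succ, hg a j.castSucc j.succ ha j.castSucc_lt_succ,
        ih ha, h j]

end CoherentFamily

end Filling

/-! ## The fair monoid attached to a strictification of the tensor product -/

namespace FatDelta

lemma Equi.split {K : FatDelta} {a b c : Fin (K.edges + 1)} (hab : a < b) (hbc : b < c)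
    (h : K.Equi a c) : K.Equi a b ∧ K.Equi b c :=
  ⟨fun j h₁ h₂ => h j h₁ (h₂.trans hbc.le), fun j h₁ h₂ => h j (hab.le.trans h₁) h₂⟩

lemma equi_edge (K : FatDelta) (j : Fin K.edges) :
    K.Equi j.castSucc j.succ ↔ K.linked j = true := by
  refine ⟨fun h => h j le_rfl le_rfl, fun h i h₁ h₂ => ?_⟩
  obtain rfl : i = j := le_antisymm (Fin.succ_le_succ_iff.mp h₂) (Fin.castSucc_le_castSucc_iff.mp h₁)
  exact h

end FatDelta

/-- A semigroup `S` whose elements represent the cofibrant objects of `M`, in such a way that the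
multiplication of `S` represents the tensor product. -/
structure Strictification (M : Type u) [Category.{v} M] [MonoidalCategory M] [ModelCategory M] where
  /-- the semigroup -/
  S : Type (max u v)
  [semigroup : Semigroup S]
  /-- the object represented by an element -/
  r : S → M
  [isCofibrant : ∀ s, IsCofibrant (r s)]
  /-- the comparison of the multiplication with the tensor product -/
  μ : ∀ s t, r (s * t) ≅ r s ⊗ r t
  associativity : ∀ s t w, (μ (s * t) w).hom ≫ ((μ s t).hom ▷ r w) ≫ (α_ _ _ _).hom =
    eqToHom (congrArg r (mul_assoc s t w)) ≫ (μ s (t * w)).hom ≫ (r s ◁ (μ t w).hom)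
  exists_eq : ∀ (Z : M) [IsCofibrant Z], ∃ s, r s = Z

namespace Strictification

attribute [instance] semigroup isCofibrant

variable {M : Type u} [Category.{v} M] [MonoidalCategory M] [ModelCategory M]
  (𝓡 : Strictification M)

/-- The comparison isomorphism for an element that is equal to a product. -/
def μ' {s t w : 𝓡.S} (h : w = s * t) : 𝓡.r w ≅ 𝓡.r s ⊗ 𝓡.r t :=
  eqToIso (congrArg 𝓡.r h) ≪≫ 𝓡.μ s t

/-- Naming every product by a variable makes the associativity equations substitutable, and no
`eqToHom` remains in the statement. -/
lemma μ'_associativity {s t w st tw stw : 𝓡.S} (h₁ : st = s * t) (h₂ : tw = t * w)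
    (h₃ : stw = s * tw) (h₄ : stw = st * w) :
    (𝓡.μ' h₃).hom ≫ (𝓡.r s ◁ (𝓡.μ' h₂).hom) =
      (𝓡.μ' h₄).hom ≫ ((𝓡.μ' h₁).hom ▷ 𝓡.r w) ≫ (α_ _ _ _).hom := by
  subst h₁ h₂ h₄
  simp [μ', 𝓡.associativity]

/-- The coherent family given by a multiplicative family of elements. -/
def coherentFamily {n : ℕ} (s : ∀ a b : Fin (n + 1), a < b → 𝓡.S)
    (hs : ∀ a b c (hab : a < b) (hbc : b < c), s a c (hab.trans hbc) = s a b hab * s b c hbc) :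
    CoherentFamily n M where
  obj a b hab := 𝓡.r (s a b hab)
  mul a b c hab hbc := 𝓡.μ' (hs a b c hab hbc)
  coherence _ _ _ _ _ _ _ := 𝓡.μ'_associativity _ _ _ _

/-- The diagrams of shape `K`: the multiplicative families of elements of `S` indexed by the arrows
of `K`, together with a multiplicative family of weak equivalences to the unit object on the
coloured arrows. -/
structure Diag (K : FatDelta) where
  /-- the elements -/
  obj : ∀ a b : Fin (K.edges + 1), a < b → 𝓡.S
  obj_mul : ∀ a b c (hab : a < b) (hbc : b < c),
    obj a c (hab.trans hbc) = obj a b hab * obj b c hbc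
  /-- the weak equivalences to the unit object -/
  unit : ∀ a b (hab : a < b), K.Equi a b → (𝓡.r (obj a b hab) ⟶ 𝟙_ M)
  weakEquivalence_unit : ∀ a b (hab : a < b) h, WeakEquivalence (unit a b hab h)
  unit_mul : ∀ a b c (hab : a < b) (hbc : b < c) (h : K.Equi a c),
    unit a c (hab.trans hbc) h = (𝓡.μ' (obj_mul a b c hab hbc)).hom ≫
      (unit a b hab (h.split hab hbc).1 ⊗ₘ unit b c hbc (h.split hab hbc).2) ≫ (λ_ (𝟙_ M)).hom

namespace Diag

variable {𝓡} {K L P : FatDelta}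

/-- The multiplicativity of a diagram, in `M`. -/
def mul (T : 𝓡.Diag K) (a b c : Fin (K.edges + 1)) (hab : a < b) (hbc : b < c) :
    𝓡.r (T.obj a c (hab.trans hbc)) ≅ 𝓡.r (T.obj a b hab) ⊗ 𝓡.r (T.obj b c hbc) :=
  𝓡.μ' (T.obj_mul a b c hab hbc)

/-- The coherent family of objects of `M` that underlies a diagram. -/
abbrev toCoherentFamily (T : 𝓡.Diag K) : CoherentFamily K.edges M :=
  𝓡.coherentFamily T.obj T.obj_mul

/-- The arrows between diagrams. -/
@[ext]
structure Hom (T T' : 𝓡.Diag K) where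
  /-- the components -/
  app : ∀ a b (hab : a < b), 𝓡.r (T.obj a b hab) ⟶ 𝓡.r (T'.obj a b hab)
  app_mul : ∀ a b c (hab : a < b) (hbc : b < c),
    app a c (hab.trans hbc) ≫ (T'.mul a b c hab hbc).hom =
      (T.mul a b c hab hbc).hom ≫ (app a b hab ⊗ₘ app b c hbc)
  app_unit : ∀ a b (hab : a < b) h, app a b hab ≫ T'.unit a b hab h = T.unit a b hab h

instance : Category.{v} (𝓡.Diag K) where
  Hom := Hom
  id T := ⟨fun _ _ _ => 𝟙 _, fun _ _ _ _ _ => by simp, fun _ _ _ _ => by simp⟩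
  comp f g := ⟨fun a b hab => f.app a b hab ≫ g.app a b hab,
    fun a b c hab hbc => by
      rw [assoc, g.app_mul, reassoc_of% f.app_mul a b c hab hbc, tensorHom_comp_tensorHom],
    fun a b hab h => by rw [assoc, g.app_unit, f.app_unit]⟩

@[ext]
lemma hom_ext {T T' : 𝓡.Diag K} {f g : T ⟶ T'} (h : ∀ a b hab, Hom.app f a b hab = Hom.app g a b hab) : f = g :=
  Hom.ext (funext fun a => funext fun b => funext fun hab => h a b hab)

@[simp]
lemma comp_app {T T' T'' : 𝓡.Diag K} (f : T ⟶ T') (g : T' ⟶ T'') (a b : Fin (K.edges + 1))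
    (hab : a < b) : Hom.app (f ≫ g) a b hab = Hom.app f a b hab ≫ Hom.app g a b hab := rfl

/-- The restriction of a diagram. -/
def res (f : K ⟶ L) (T : 𝓡.Diag L) : 𝓡.Diag K where
  obj a b hab := T.obj (f.toFun a) (f.toFun b) (f.strictMono hab)
  obj_mul _ _ _ hab hbc := T.obj_mul _ _ _ (f.strictMono hab) (f.strictMono hbc)
  unit a b hab h := T.unit _ _ (f.strictMono hab) (f.map_equi a b hab h)
  weakEquivalence_unit _ _ _ _ := T.weakEquivalence_unit _ _ _ _
  unit_mul _ _ _ _ _ _ := T.unit_mul _ _ _ _ _ _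

/-- The restriction functor. -/
def resFunctor (f : K ⟶ L) : 𝓡.Diag L ⥤ 𝓡.Diag K where
  obj T := T.res f
  map g := ⟨fun a b hab => Hom.app g _ _ (f.strictMono hab), fun _ _ _ _ _ => Hom.app_mul g _ _ _ _ _,
    fun _ _ _ _ => Hom.app_unit g _ _ _ _⟩

variable (𝓡 K) in
/-- The coloured category of diagrams of shape `K`. -/
def ccat : CCat.{v, max u v} where
  carrier := 𝓡.Diag K
  equi := fun _ _ f => ∀ a b hab, WeakEquivalence (Hom.app f a b hab)
  isMultiplicative :=
    { id_mem := fun T a b hab => inferInstanceAs (WeakEquivalence (𝟙 (𝓡.r (T.obj a b hab))))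
      comp_mem := fun f g hf hg a b hab => by
        have := hf a b hab
        have := hg a b hab
        rw [comp_app]
        infer_instance }

variable (𝓡) in
/-- The diagram of coloured categories given by the diagrams of all shapes. -/
def nerve : FatDeltaᵒᵖ ⥤ CCat.{v, max u v} where
  obj K := ccat 𝓡 K.unop
  map f := { functor := resFunctor f.unop, map := fun _ _ _ h _ _ _ => h _ _ _ }

end Diag

/-! ### Edges and families of edges -/

/-- The diagrams of shape a single edge, which is coloured if `β = true`. -/
structure Edge (β : Bool) where
  /-- the element -/
  obj : 𝓡.S
  /-- the weak equivalence to the unit object -/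
  unit : β = true → (𝓡.r obj ⟶ 𝟙_ M)
  weakEquivalence_unit : ∀ h, WeakEquivalence (unit h)

namespace Edge

variable {𝓡} {β γ : Bool}

/-- The arrows between edges. -/
@[ext]
structure Hom (T T' : 𝓡.Edge β) where
  /-- the underlying arrow of `M` -/
  hom : 𝓡.r T.obj ⟶ 𝓡.r T'.obj
  hom_unit : ∀ h, hom ≫ T'.unit h = T.unit h

instance : Category.{v} (𝓡.Edge β) where
  Hom := Hom
  id T := ⟨𝟙 _, fun _ => by simp⟩
  comp f g := ⟨f.hom ≫ g.hom, fun h => by rw [assoc, g.hom_unit, f.hom_unit]⟩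

@[ext]
lemma hom_ext {T T' : 𝓡.Edge β} {f g : T ⟶ T'} (h : Hom.hom f = Hom.hom g) : f = g :=
  Hom.ext h

@[simp]
lemma id_hom (T : 𝓡.Edge β) : Hom.hom (𝟙 T) = 𝟙 _ := rfl

@[simp]
lemma comp_hom {T T' T'' : 𝓡.Edge β} (f : T ⟶ T') (g : T' ⟶ T'') :
    Hom.hom (f ≫ g) = Hom.hom f ≫ Hom.hom g := rfl

/-- The functor that forgets the weak equivalence to the unit object. -/
def forget (h : γ = true → β = true) : 𝓡.Edge β ⥤ 𝓡.Edge γ where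
  obj T := ⟨T.obj, fun hγ => T.unit (h hγ), fun _ => T.weakEquivalence_unit _⟩
  map f := ⟨f.hom, fun _ => f.hom_unit _⟩

end Edge

variable (K : FatDelta)

/-- The families of edges. -/
abbrev Spine : Type (max u v) := ∀ j : Fin K.edges, 𝓡.Edge (K.linked j)

/-- The coloured category of families of edges. -/
def spineCCat : CCat.{v, max u v} where
  carrier := 𝓡.Spine K
  equi := fun (x y : 𝓡.Spine K) (f : x ⟶ y) => ∀ j, WeakEquivalence (Edge.Hom.hom (f j))
  isMultiplicative :=
    { id_mem := fun T j => inferInstanceAs (WeakEquivalence (𝟙 (𝓡.r (T j).obj)))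
      comp_mem := fun f g hf hg j => by
        have := hf j
        have := hg j
        change WeakEquivalence (Edge.Hom.hom (f j) ≫ Edge.Hom.hom (g j))
        infer_instance }

variable {𝓡 K}

/-- The evaluation of diagrams at an arrow. -/
def Diag.eval (a b : Fin (K.edges + 1)) (hab : a < b) {β : Bool} (h : β = true → K.Equi a b) :
    𝓡.Diag K ⥤ 𝓡.Edge β where
  obj T := ⟨T.obj a b hab, fun hβ => T.unit a b hab (h hβ), fun _ => T.weakEquivalence_unit _ _ _ _⟩
  map f := ⟨f.app a b hab, fun _ => f.app_unit _ _ _ _⟩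

variable (𝓡 K) in
/-- The restriction of diagrams to the edges. -/
def spine : 𝓡.Diag K ⥤ 𝓡.Spine K :=
  Functor.pi' (fun j => Diag.eval j.castSucc j.succ j.castSucc_lt_succ (K.equi_edge j).mpr)

end Strictification

/-! ### Diagrams and their morphisms are determined by their edges -/

namespace Strictification

variable {M : Type u} [Category.{v} M] [MonoidalCategory M] [ModelCategory M]
  {𝓡 : Strictification M} {K L : FatDelta}

/-- The components of an arrow of diagrams form a multiplicative family. -/
lemma Diag.Hom.isMul {T T' : 𝓡.Diag K} (f : T ⟶ T') :
    CoherentFamily.IsMul (T := T.toCoherentFamily) (T' := T'.toCoherentFamily)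
      (P := fun _ _ => True) (fun _ _ _ => ⟨trivial, trivial⟩) (fun a b hab _ => Hom.app f a b hab) :=
  fun a b c hab hbc _ => Hom.app_mul f a b c hab hbc

/-- A multiplicative family of maps to the unit is a multiplicative family of arrows to the constant
coherent family at `𝟙_ M`. Extension and uniqueness for arrows thus apply to the weak units too. -/
lemma isMul_unit_iff {n : ℕ} {s : ∀ a b : Fin (n + 1), a < b → 𝓡.S}
    (hs : ∀ a b c (hab : a < b) (hbc : b < c), s a c (hab.trans hbc) = s a b hab * s b c hbc)
    {P : Fin (n + 1) → Fin (n + 1) → Prop}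
    (hP : ∀ {a b c}, a < b → b < c → P a c → P a b ∧ P b c)
    (w : ∀ a b (hab : a < b), P a b → (𝓡.r (s a b hab) ⟶ 𝟙_ M)) :
    CoherentFamily.IsMul (T := 𝓡.coherentFamily s hs) (T' := CoherentFamily.unit M n) hP w ↔
      ∀ a b c (hab : a < b) (hbc : b < c) (h : P a c), w a c (hab.trans hbc) h =
        (𝓡.μ' (hs a b c hab hbc)).hom ≫
          (w a b hab (hP hab hbc h).1 ⊗ₘ w b c hbc (hP hab hbc h).2) ≫ (λ_ (𝟙_ M)).hom := by
  refine forall_congr' fun a => forall_congr' fun b => forall_congr' fun c =>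
    forall_congr' fun hab => forall_congr' fun hbc => forall_congr' fun h => ?_
  change w a c _ h ≫ (λ_ (𝟙_ M)).inv = (𝓡.μ' (hs a b c hab hbc)).hom ≫
    (w a b hab (hP hab hbc h).1 ⊗ₘ w b c hbc (hP hab hbc h).2) ↔ _
  rw [Iso.comp_inv_eq, assoc]

lemma Diag.unit_isMul (T : 𝓡.Diag K) :
    CoherentFamily.IsMul (T := T.toCoherentFamily) (T' := CoherentFamily.unit M K.edges)
      (P := K.Equi) FatDelta.Equi.split T.unit :=
  (isMul_unit_iff T.obj_mul _ _).mpr T.unit_mul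

lemma Edge.eq_of {β : Bool} {x y : 𝓡.Edge β} (h : x.obj = y.obj)
    (h' : ∀ hβ, x.unit hβ = eqToHom (congrArg 𝓡.r h) ≫ y.unit hβ) : x = y := by
  obtain ⟨s, w, hw⟩ := x
  obtain ⟨s', w', hw'⟩ := y
  obtain rfl : s = s' := h
  obtain rfl : w = w' := by
    funext hβ
    simpa using h' hβ
  rfl

lemma Edge.unit_eq {β : Bool} {s : 𝓡.S} {w w' : β = true → (𝓡.r s ⟶ 𝟙_ M)} {hw hw'}
    (h : (⟨s, w, hw⟩ : 𝓡.Edge β) = ⟨s, w', hw'⟩) : w = w' := by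
  cases h
  rfl

instance : (spine 𝓡 K).Faithful where
  map_injective {T T'} f g h := by
    have := (Diag.Hom.isMul f).ext (Diag.Hom.isMul g)
      (fun j _ => congrArg (fun t : (spine 𝓡 K).obj T ⟶ (spine 𝓡 K).obj T' => Edge.Hom.hom (t j)) h)
    ext a b hab
    exact congrFun (congrFun (congrFun (congrFun this a) b) hab) trivial

/-- The components extend multiplicatively from the edges. Their compatibility with the units needs
no further choice: both sides are multiplicative families of maps to the unit that agree on the
edges. -/
instance : (spine 𝓡 K).Full where
  map_surjective {T T'} e := by
    obtain ⟨f, hf₁, hf₂⟩ : ∃ f : ∀ a b (hab : a < b), 𝓡.r (T.obj a b hab) ⟶ 𝓡.r (T'.obj a b hab),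
        (∀ j, f j.castSucc j.succ j.castSucc_lt_succ = Edge.Hom.hom (e j)) ∧
        ∀ a b c (hab : a < b) (hbc : b < c),
          f a c (hab.trans hbc) ≫ (𝓡.μ' (T'.obj_mul a b c hab hbc)).hom =
            (𝓡.μ' (T.obj_mul a b c hab hbc)).hom ≫ (f a b hab ⊗ₘ f b c hbc) := by
      obtain ⟨f, hf₁, hf₂⟩ := CoherentFamily.exists_isMul (T := T.toCoherentFamily)
        (T' := T'.toCoherentFamily) (P := fun _ _ => True) (fun _ _ _ => ⟨trivial, trivial⟩)
        (fun j _ => Edge.Hom.hom (e j))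
      exact ⟨fun a b hab => f a b hab trivial, fun j => hf₁ j trivial,
        fun a b c hab hbc => hf₂ a b c hab hbc trivial⟩
    have hu := (isMul_unit_iff T.obj_mul (P := K.Equi) FatDelta.Equi.split
      (fun a b hab h => f a b hab ≫ T'.unit a b hab h)).mpr (fun a b c hab hbc h => by
        rw [T'.unit_mul a b c hab hbc h, reassoc_of% hf₂ a b c hab hbc,
          tensorHom_comp_tensorHom_assoc])
    refine ⟨⟨f, hf₂,
      fun a b hab h => congrFun (congrFun (congrFun (congrFun
        (hu.ext T.unit_isMul ?_) a) b) hab) h⟩, ?_⟩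
    · intro j h
      rw [hf₁]
      exact Edge.Hom.hom_unit (e j) ((K.equi_edge j).mp h)
    · funext j
      exact Edge.hom_ext (hf₁ j)

lemma spine_obj_injective : Function.Injective (spine 𝓡 K).obj := by
  intro T T' h
  have h₁ : T.obj = T'.obj := mul_family_ext T.obj_mul T'.obj_mul
    (fun j => congrArg Edge.obj (congrFun h j))
  obtain ⟨s, hs, w, hw, hmul⟩ := T
  obtain ⟨s', hs', w', hw', hmul'⟩ := T'
  obtain rfl : s = s' := h₁
  obtain rfl : w = w' := by
    refine CoherentFamily.IsMul.ext (Diag.unit_isMul ⟨s, hs, w, hw, hmul⟩)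
      (Diag.unit_isMul ⟨s, hs', w', hw', hmul'⟩) (fun j hj => ?_)
    exact congrFun (Edge.unit_eq (congrFun h j)) ((K.equi_edge j).mp hj)
  rfl

variable [MonoidalModelCategory M]

/-- Elements are multiplied in `S` and maps to the unit are tensored along the intervals. The latter
remain weak equivalences by `weakEquivalence_unit_tensor`, one edge at a time. -/
lemma spine_obj_surjective : Function.Surjective (spine 𝓡 K).obj := by
  intro x
  obtain ⟨s, hs₁, hs₂⟩ := exists_mul_family (fun j => (x j).obj)
  obtain ⟨w, hw₁, hw₃⟩ : ∃ w : ∀ a b (hab : a < b), K.Equi a b → (𝓡.r (s a b hab) ⟶ 𝟙_ M),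
      (∀ j h, w j.castSucc j.succ j.castSucc_lt_succ h =
        eqToHom (congrArg 𝓡.r (hs₁ j)) ≫ (x j).unit ((K.equi_edge j).mp h)) ∧ _ := by
    obtain ⟨w, hw₁, hw₂⟩ := CoherentFamily.exists_isMul (T := 𝓡.coherentFamily s hs₂)
      (T' := CoherentFamily.unit M K.edges) (P := K.Equi) FatDelta.Equi.split
      (fun j h => eqToHom (congrArg 𝓡.r (hs₁ j)) ≫ (x j).unit ((K.equi_edge j).mp h))
    exact ⟨w, hw₁, (isMul_unit_iff hs₂ _ w).mp hw₂⟩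
  refine ⟨⟨s, hs₂, w, fun a b hab h => ?_, hw₃⟩, ?_⟩
  · induction b using Fin.induction with
    | zero => exact absurd hab (Fin.not_lt_zero a)
    | succ j ih =>
      have hj (h : K.Equi j.castSucc j.succ) : WeakEquivalence (w _ _ j.castSucc_lt_succ h) := by
        have := (x j).weakEquivalence_unit ((K.equi_edge j).mp h)
        rw [hw₁]
        infer_instance
      rcases (Fin.le_castSucc_iff.mpr hab).eq_or_lt with rfl | ha
      · exact hj h
      · rw [hw₃ a j.castSucc j.succ ha j.castSucc_lt_succ h]
        have := ih ha (h.split ha j.castSucc_lt_succ).1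
        have := hj (h.split ha j.castSucc_lt_succ).2
        exact MonoidalModelCategory.weakEquivalence_isIso_comp _ _
          (MonoidalModelCategory.weakEquivalence_unit_tensor _ _)
  · funext j
    exact Edge.eq_of (hs₁ j) (fun hβ => hw₁ j ((K.equi_edge j).mpr hβ))

/-- Each component is, up to isomorphism, a tensor product of components on edges, and weak
equivalences between cofibrant objects are stable under tensor product. -/
lemma equi_of_spine {T T' : 𝓡.Diag K} (f : T ⟶ T')
    (hf : ∀ j : Fin K.edges, WeakEquivalence (Diag.Hom.app f j.castSucc j.succ j.castSucc_lt_succ)) :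
    (Diag.ccat 𝓡 K).equi f := by
  intro a b hab
  induction b using Fin.induction with
  | zero => exact absurd hab (Fin.not_lt_zero a)
  | succ j ih =>
    rcases (Fin.le_castSucc_iff.mpr hab).eq_or_lt with rfl | ha
    · exact hf j
    · have h := Diag.Hom.app_mul f a j.castSucc j.succ ha j.castSucc_lt_succ
      rw [← Iso.eq_comp_inv, assoc] at h
      rw [h]
      have := ih ha
      have := hf j
      have := MonoidalModelCategory.weakEquivalence_tensorHom (Diag.Hom.app f a j.castSucc ha)
        (Diag.Hom.app f j.castSucc j.succ j.castSucc_lt_succ)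
      infer_instance

end Strictification

/-! ## Isomorphisms and fibre products of coloured categories -/

lemma CategoryTheory.Functor.exists_inverse {C D : Type*} [Category* C] [Category* D] (F : C ⥤ D)
    [F.Full] [F.Faithful] (hF : Function.Bijective F.obj) :
    ∃ G : D ⥤ C, F ⋙ G = 𝟭 C ∧ G ⋙ F = 𝟭 D := by
  let e := Equiv.ofBijective F.obj hF
  have h₁ (x : D) : F.obj (e.symm x) = x := e.apply_symm_apply x
  have h₂ (x : C) : e.symm (F.obj x) = x := e.symm_apply_apply x
  refine ⟨{ obj := e.symm
            map := fun f => F.preimage (eqToHom (h₁ _) ≫ f ≫ eqToHom (h₁ _).symm)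
            map_id := fun x => F.map_injective (by simp)
            map_comp := fun f g => F.map_injective (by simp) }, ?_, ?_⟩
  · exact CategoryTheory.Functor.ext h₂ (fun x y f => F.map_injective (by simp [eqToHom_map]))
  · exact CategoryTheory.Functor.ext h₁ (fun x y f => by simp)

namespace CCat

variable {A B C D : CCat.{v, u}}

/-- An isomorphism of categories that reflects the colours is an isomorphism. -/
lemma isIso_of_bijective (φ : A ⟶ B) [(functor φ).Full] [(functor φ).Faithful]
    (hφ : Function.Bijective (functor φ).obj)
    (h : ∀ {x y : A} (f : x ⟶ y), B.equi ((functor φ).map f) → A.equi f) : IsIso φ := by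
  obtain ⟨G, hG₁, hG₂⟩ := (functor φ).exists_inverse hφ
  have hG : ∀ {x y : B} (f : x ⟶ y), B.equi f → A.equi (G.map f) := by
    intro x y f hf
    apply h
    have := Functor.congr_hom hG₂ f
    dsimp at this
    rw [this]
    have eqToHom_mem {x y : B} (h : x = y) : B.equi (eqToHom h) := by
      subst h
      exact B.equi.id_mem _
    exact B.equi.comp_mem _ _ (eqToHom_mem _) (B.equi.comp_mem _ _ hf (eqToHom_mem _))
  let ψ : B ⟶ A := { functor := G, map := fun _ _ f hf => hG f hf }
  exact ⟨ψ, hom_ext hG₁, hom_ext hG₂⟩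

variable (A B) in
/-- The product of two coloured categories. -/
def prod : CCat.{v, u} where
  carrier := A × B
  equi := fun (x y : A.carrier × B.carrier) (f : x ⟶ y) => A.equi f.1 ∧ B.equi f.2
  isMultiplicative :=
    { id_mem := fun _ => ⟨A.equi.id_mem _, B.equi.id_mem _⟩
      comp_mem := fun _ _ hf hg => ⟨A.equi.comp_mem _ _ hf.1 hg.1, B.equi.comp_mem _ _ hf.2 hg.2⟩ }

/-- The arrow into a product. -/
def prodLift (φ : C ⟶ A) (ψ : C ⟶ B) : C ⟶ prod A B :=
  { functor := (functor φ).prod' (functor ψ)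
    map := fun _ _ _ hf => ⟨functor_map_equi φ hf, functor_map_equi ψ hf⟩ }

variable (A B) in
/-- The first projection. -/
def prodFst : prod A B ⟶ A := { functor := CategoryTheory.Prod.fst A B, map := fun _ _ _ hf => hf.1 }

variable (A B) in
/-- The second projection. -/
def prodSnd : prod A B ⟶ B := { functor := CategoryTheory.Prod.snd A B, map := fun _ _ _ hf => hf.2 }

lemma prodLift_fst (φ : C ⟶ A) (ψ : C ⟶ B) : prodLift φ ψ ≫ prodFst A B = φ := rfl

lemma prodLift_snd (φ : C ⟶ A) (ψ : C ⟶ B) : prodLift φ ψ ≫ prodSnd A B = ψ := rfl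

lemma prod_hom_ext {φ ψ : C ⟶ prod A B} (h₁ : φ ≫ prodFst A B = ψ ≫ prodFst A B)
    (h₂ : φ ≫ prodSnd A B = ψ ≫ prodSnd A B) : φ = ψ := by
  have e (χ : C ⟶ prod A B) : χ = prodLift (χ ≫ prodFst A B) (χ ≫ prodSnd A B) := rfl
  rw [e φ, e ψ, h₁, h₂]

/-- Over an object that receives at most one arrow from each source, a pullback is a product. -/
lemma isPullback_of_isIso_prodLift (fst : C ⟶ A) (snd : C ⟶ B) [IsIso (prodLift fst snd)]
    (f : A ⟶ D) (g : B ⟶ D) (hD : ∀ E : CCat.{v, u}, Subsingleton (E ⟶ D)) :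
    IsPullback fst snd f g := by
  have e₁ : inv (prodLift fst snd) ≫ fst = prodFst A B := by
    rw [IsIso.inv_comp_eq, prodLift_fst]
  have e₂ : inv (prodLift fst snd) ≫ snd = prodSnd A B := by
    rw [IsIso.inv_comp_eq, prodLift_snd]
  refine ⟨⟨(hD _).elim _ _⟩, ⟨PullbackCone.IsLimit.mk _
    (fun s => prodLift s.fst s.snd ≫ inv (prodLift fst snd)) (fun s => ?_) (fun s => ?_)
    (fun s m h₁ h₂ => ?_)⟩⟩
  · rw [assoc, e₁, prodLift_fst]
  · rw [assoc, e₂, prodLift_snd]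
  · rw [IsIso.eq_comp_inv]
    apply prod_hom_ext <;> assumption

lemma subsingleton_hom (hD : IsDiscrete D) [Subsingleton D] : Subsingleton (C ⟶ D) :=
  ⟨fun _ _ => hom_ext (CategoryTheory.Functor.ext (fun _ => Subsingleton.elim _ _)
    (fun _ _ _ => Subsingleton.elim _ _))⟩

end CCat

/-! ### Concatenation is the pushout over a dot -/

namespace FatDelta

lemma Equi.trans {K : FatDelta} {a b c : Fin (K.edges + 1)} (h : K.Equi a b) (h' : K.Equi b c) :
    K.Equi a c := by
  intro j h₁ h₂
  rcases lt_or_ge j.castSucc b with hb | hb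
  · exact h j h₁ (Fin.castSucc_lt_iff_succ_le.mp hb)
  · exact h' j hb h₂

/-- A map on vertices that is increasing and preserves the colours on the edges is an arrow. -/
def homOfEdges {K L : FatDelta} (f : Fin (K.edges + 1) → Fin (L.edges + 1))
    (hf : ∀ j : Fin K.edges, f j.castSucc < f j.succ)
    (h : ∀ j : Fin K.edges, K.linked j = true → L.Equi (f j.castSucc) (f j.succ)) : K ⟶ L where
  toFun := f
  strictMono := Fin.strictMono_iff_lt_succ.mpr hf
  map_equi a b hab hK := by
    induction b using Fin.induction with
    | zero => exact absurd hab (Fin.not_lt_zero a)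
    | succ j ih =>
      rcases (Fin.le_castSucc_iff.mpr hab).eq_or_lt with rfl | ha
      · exact h j ((K.equi_edge j).mp hK)
      · have := hK.split ha j.castSucc_lt_succ
        exact (ih ha this.1).trans (h j ((K.equi_edge j).mp this.2))

variable (K L : FatDelta)

/-- The concatenation of two strings. -/
def concat : FatDelta := ⟨K.edges + L.edges, Fin.append K.linked L.linked⟩

/-- The inclusion of the left part. -/
def inl : K ⟶ concat K L :=
  homOfEdges (fun a => ⟨a, by have := a.isLt; simp only [concat]; omega⟩)
    (fun j => Nat.lt_succ_self _)
    (fun j hj => ((concat K L).equi_edge (Fin.castAdd L.edges j)).mpr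
      ((Fin.append_left K.linked L.linked j).trans hj))

/-- The inclusion of the right part. -/
def inr : L ⟶ concat K L :=
  homOfEdges (fun a => ⟨K.edges + a, by have := a.isLt; simp only [concat]; omega⟩)
    (fun j => Nat.lt_succ_self _)
    (fun j hj => ((concat K L).equi_edge (Fin.natAdd K.edges j)).mpr
      ((Fin.append_right K.linked L.linked j).trans hj))

variable {K L}

lemma hom_ext {f g : K ⟶ L} (h : ∀ a, f.toFun a = g.toFun a) : f = g := Hom.ext (funext h)

/-- The map on vertices given by two maps that agree on the common vertex. -/
def glue {Q : FatDelta} (f : K ⟶ Q) (g : L ⟶ Q) (a : Fin (K.edges + L.edges + 1)) :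
    Fin (Q.edges + 1) :=
  if h : (a : ℕ) < K.edges + 1 then f.toFun ⟨a, h⟩ else
    g.toFun ⟨a - K.edges, by have := a.isLt; omega⟩

lemma glue_inl {Q : FatDelta} (f : K ⟶ Q) (g : L ⟶ Q) (a : Fin (K.edges + 1)) :
    glue f g ((inl K L).toFun a) = f.toFun a :=
  dif_pos a.isLt

lemma glue_inr {Q : FatDelta} (f : K ⟶ Q) (g : L ⟶ Q) (h : f.toFun (Fin.last _) = g.toFun 0)
    (a : Fin (L.edges + 1)) :
    glue f g ((inr K L).toFun a) = g.toFun a := by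
  by_cases ha : a = 0
  · subst ha
    -- The common vertex is in the range of the first branch of `glue`, so the value there is given
    -- by `f` and the compatibility is needed.
    rw [← h]
    exact dif_pos (Nat.lt_succ_self _)
  · have ha : (a : ℕ) ≠ 0 := fun h => ha (Fin.ext h)
    have : ¬ (K.edges + a < K.edges + 1) := by omega
    refine (dif_neg this).trans (congrArg g.toFun (Fin.ext ?_))
    exact Nat.add_sub_cancel_left _ _

/-- Every edge of the concatenation lies in exactly one of the two parts, and both order and colours
need only be checked on edges. -/
lemma isPushout_concat (K L : FatDelta) : IsPushout K.last L.first (inl K L) (inr K L) := by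
  refine ⟨⟨hom_ext fun _ => Fin.ext rfl⟩, ⟨PushoutCocone.IsColimit.mk _
    (fun s => ?_) (fun s => ?_) (fun s => ?_) (fun s m h₁ h₂ => ?_)⟩⟩
  · have w : s.inl.toFun (Fin.last _) = s.inr.toFun 0 :=
      congrArg (fun f : dot ⟶ s.pt => f.toFun (0 : Fin 1)) s.condition
    refine homOfEdges (glue s.inl s.inr) (fun j => ?_) (fun j => ?_)
    · induction j using Fin.addCases with
      | left j =>
        exact ((glue_inl s.inl s.inr j.castSucc).trans_lt
          (s.inl.strictMono j.castSucc_lt_succ)).trans_eq (glue_inl s.inl s.inr j.succ).symm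
      | right j =>
        exact ((glue_inr s.inl s.inr w j.castSucc).trans_lt
          (s.inr.strictMono j.castSucc_lt_succ)).trans_eq (glue_inr s.inl s.inr w j.succ).symm
    · induction j using Fin.addCases with
      | left j =>
        intro hj
        have := s.inl.map_equi _ _ j.castSucc_lt_succ
          ((K.equi_edge j).mpr ((Fin.append_left K.linked L.linked j).symm.trans hj))
        rw [← glue_inl s.inl s.inr, ← glue_inl s.inl s.inr] at this
        exact this
      | right j =>
        intro hj
        have := s.inr.map_equi _ _ j.castSucc_lt_succ
          ((L.equi_edge j).mpr ((Fin.append_right K.linked L.linked j).symm.trans hj))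
        rw [← glue_inr s.inl s.inr w, ← glue_inr s.inl s.inr w] at this
        exact this
  · exact hom_ext (glue_inl s.inl s.inr)
  · exact hom_ext (glue_inr s.inl s.inr
      (congrArg (fun f : dot ⟶ s.pt => f.toFun (0 : Fin 1)) s.condition))
  · refine hom_ext fun a => ?_
    by_cases ha : (a : ℕ) < K.edges + 1
    · exact (congrArg (fun f : K ⟶ s.pt => f.toFun ⟨a, ha⟩) h₁).trans
        (glue_inl s.inl s.inr ⟨a, ha⟩).symm
    · have ha' : (a : ℕ) - K.edges < L.edges + 1 := by
        have : (a : ℕ) < K.edges + L.edges + 1 := a.isLt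
        omega
      have e : a = (inr K L).toFun ⟨a - K.edges, ha'⟩ := Fin.ext (by
        change (a : ℕ) = K.edges + (a - K.edges)
        omega)
      rw [e]
      exact (congrArg (fun f : L ⟶ s.pt => f.toFun ⟨a - K.edges, ha'⟩) h₂).trans
        (glue_inr s.inl s.inr
          (congrArg (fun f : dot ⟶ s.pt => f.toFun (0 : Fin 1)) s.condition) _).symm

end FatDelta

/-! ## The fibre products of diagrams -/

namespace Strictification

variable {M : Type u} [Category.{v} M] [MonoidalCategory M] [ModelCategory M]
  (𝓡 : Strictification M)

instance : Unique (𝓡.Diag FatDelta.dot) where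
  default :=
    { obj := fun a b hab => absurd hab (Subsingleton.elim (α := Fin 1) a b).not_lt
      obj_mul := fun a b _ hab => absurd hab (Subsingleton.elim (α := Fin 1) a b).not_lt
      unit := fun a b hab => absurd hab (Subsingleton.elim (α := Fin 1) a b).not_lt
      weakEquivalence_unit := fun a b hab => absurd hab (Subsingleton.elim (α := Fin 1) a b).not_lt
      unit_mul := fun a b _ hab => absurd hab (Subsingleton.elim (α := Fin 1) a b).not_lt }
  uniq _ := spine_obj_injective (funext fun j => j.elim0)

instance : IsDiscrete (𝓡.Diag FatDelta.dot) where
  subsingleton _ _ := ⟨fun _ _ => (spine 𝓡 FatDelta.dot).map_injective (funext fun j => j.elim0)⟩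
  eq_of_hom _ := Subsingleton.elim _ _

variable (K L : FatDelta)

/-- The restriction of diagrams to the two parts of a concatenation. -/
abbrev split : 𝓡.Diag (K.concat L) ⥤ 𝓡.Diag K × 𝓡.Diag L :=
  (Diag.resFunctor (FatDelta.inl K L)).prod' (Diag.resFunctor (FatDelta.inr K L))

variable {K L}

/-- The edge of a diagram on the left part of a concatenation. -/
abbrev leftEdge (j : Fin K.edges) :
    𝓡.Diag K ⥤ 𝓡.Edge ((K.concat L).linked (Fin.castAdd L.edges j)) :=
  Diag.eval j.castSucc j.succ j.castSucc_lt_succ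
    (fun h => (K.equi_edge j).mpr ((Fin.append_left K.linked L.linked j).symm.trans h))

/-- The edge of a diagram on the right part of a concatenation. -/
abbrev rightEdge (j : Fin L.edges) :
    𝓡.Diag L ⥤ 𝓡.Edge ((K.concat L).linked (Fin.natAdd K.edges j)) :=
  Diag.eval j.castSucc j.succ j.castSucc_lt_succ
    (fun h => (L.equi_edge j).mpr ((Fin.append_right K.linked L.linked j).symm.trans h))

/-- The edges of the concatenation are those of the two parts, and diagrams are determined by their
edges. -/
lemma split_obj_injective : Function.Injective (𝓡.split K L).obj := by
  intro T T' h
  refine spine_obj_injective (funext fun j => ?_)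
  induction j using Fin.addCases with
  | left j => exact congrArg (fun D => (𝓡.leftEdge (L := L) j).obj D.1) h
  | right j => exact congrArg (fun D => (𝓡.rightEdge (K := K) j).obj D.2) h

instance : (𝓡.split K L).Faithful where
  map_injective {T T'} f g h := by
    refine (spine 𝓡 _).map_injective (funext fun j => ?_)
    induction j using Fin.addCases with
    | left j => exact congrArg (fun D => (𝓡.leftEdge (L := L) j).map D.1) h
    | right j => exact congrArg (fun D => (𝓡.rightEdge (K := K) j).map D.2) h

instance : (𝓡.split K L).Full where
  map_surjective {T T'} f := by
    obtain ⟨g, hg⟩ := (spine 𝓡 _).map_surjective (X := T) (Y := T')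
      (fun j => Fin.addCases (motive := fun j => (spine 𝓡 _).obj T j ⟶ (spine 𝓡 _).obj T' j)
        (fun j => (𝓡.leftEdge (L := L) j).map f.1) (fun j => (𝓡.rightEdge (K := K) j).map f.2) j)
    refine ⟨g, Prod.ext ((spine 𝓡 _).map_injective (funext fun j => ?_))
      ((spine 𝓡 _).map_injective (funext fun j => ?_))⟩
    · refine Edge.hom_ext ?_
      exact (congrArg Edge.Hom.hom ((congrFun hg (Fin.castAdd L.edges j)).trans (Fin.addCases_left j)) :)
    · refine Edge.hom_ext ?_
      exact (congrArg Edge.Hom.hom ((congrFun hg (Fin.natAdd K.edges j)).trans (Fin.addCases_right j)) :)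

variable [MonoidalModelCategory M]

lemma split_obj_surjective : Function.Surjective (𝓡.split K L).obj := by
  rintro ⟨T₁, T₂⟩
  obtain ⟨T, hT⟩ := spine_obj_surjective (𝓡 := 𝓡) (K := K.concat L)
    (fun j => Fin.addCases (motive := fun j => 𝓡.Edge ((K.concat L).linked j))
        (fun j => (𝓡.leftEdge (L := L) j).obj T₁) (fun j => (𝓡.rightEdge (K := K) j).obj T₂) j)
  refine ⟨T, Prod.ext (spine_obj_injective (funext fun j => ?_))
    (spine_obj_injective (funext fun j => ?_))⟩
  · have := congrFun hT (Fin.castAdd L.edges j)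
    beta_reduce at this
    rw [Fin.addCases_left] at this
    -- The edge has the same colour in the concatenation as in `K`, but not definitionally;
    -- `Edge.forget` between equal colours performs the transport.
    exact congrArg (Edge.forget (fun h => (Fin.append_left K.linked L.linked j).trans h)).obj this
  · have := congrFun hT (Fin.natAdd K.edges j)
    beta_reduce at this
    rw [Fin.addCases_right] at this
    exact congrArg (Edge.forget (fun h => (Fin.append_right K.linked L.linked j).trans h)).obj this

lemma isPullback_concat (K L : FatDelta) :
    IsPullback ((Diag.nerve 𝓡).map (FatDelta.inl K L).op) ((Diag.nerve 𝓡).map (FatDelta.inr K L).op)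
      ((Diag.nerve 𝓡).map K.last.op) ((Diag.nerve 𝓡).map L.first.op) := by
  have hD : IsDiscrete ((Diag.nerve 𝓡).obj (op FatDelta.dot)) :=
    inferInstanceAs (IsDiscrete (𝓡.Diag FatDelta.dot))
  have : Subsingleton ((Diag.nerve 𝓡).obj (op FatDelta.dot)) :=
    inferInstanceAs (Subsingleton (𝓡.Diag FatDelta.dot))
  have : IsIso (CCat.prodLift ((Diag.nerve 𝓡).map (FatDelta.inl K L).op)
      ((Diag.nerve 𝓡).map (FatDelta.inr K L).op)) := by
    have : (CCat.functor (CCat.prodLift ((Diag.nerve 𝓡).map (FatDelta.inl K L).op)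
      ((Diag.nerve 𝓡).map (FatDelta.inr K L).op))).Full := inferInstanceAs (𝓡.split K L).Full
    have : (CCat.functor (CCat.prodLift ((Diag.nerve 𝓡).map (FatDelta.inl K L).op)
      ((Diag.nerve 𝓡).map (FatDelta.inr K L).op))).Faithful :=
      inferInstanceAs (𝓡.split K L).Faithful
    refine CCat.isIso_of_bijective _ ⟨𝓡.split_obj_injective, 𝓡.split_obj_surjective⟩ ?_
    rintro T T' f ⟨h₁, h₂⟩
    refine equi_of_spine f fun j => ?_
    induction j using Fin.addCases with
    | left j => exact h₁ _ _ j.castSucc_lt_succ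
    | right j => exact h₂ _ _ j.castSucc_lt_succ
  exact CCat.isPullback_of_isIso_prodLift _ _ _ _ (fun _ => CCat.subsingleton_hom hD)

/-- Pushouts are unique up to isomorphism, so the concatenation is the only case to treat. -/
lemma isPullback_of_isPushout {K L P : FatDelta} {i : K ⟶ P} {j : L ⟶ P}
    (h : IsPushout K.last L.first i j) :
    IsPullback ((Diag.nerve 𝓡).map i.op) ((Diag.nerve 𝓡).map j.op)
      ((Diag.nerve 𝓡).map K.last.op) ((Diag.nerve 𝓡).map L.first.op) := by
  let e := h.isoIsPushout _ _ (FatDelta.isPushout_concat K L)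
  refine (𝓡.isPullback_concat K L).of_iso ((Diag.nerve 𝓡).mapIso e.op) (Iso.refl _) (Iso.refl _)
    (Iso.refl _) ?_ ?_ (by simp) (by simp)
  all_goals
    simp only [Iso.refl_hom, Category.comp_id, Functor.mapIso_hom, Iso.op_hom, ← Functor.map_comp,
      ← op_comp]
  · rw [IsPushout.inl_isoIsPushout_hom]
  · rw [IsPushout.inr_isoIsPushout_hom]

end Strictification

/-! ## The vertical arrows -/

namespace FatDelta

section Component

variable (K : FatDelta)

lemma component_zero : K.component 0 = 0 := by
  simp [component]

lemma component_succ (j : Fin K.edges) :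
    K.component j.succ = K.component j.castSucc + if K.linked j = true then 0 else 1 := by
  have e : Finset.univ.filter (fun i : Fin K.edges => i.castSucc < j.succ ∧ K.linked i = false) =
      Finset.univ.filter (fun i : Fin K.edges => i.castSucc < j.castSucc ∧ K.linked i = false) ∪
        if K.linked j = true then ∅ else {j} := by
    ext i
    have : i.castSucc < j.succ ↔ i.castSucc < j.castSucc ∨ i = j := by
      simp only [Fin.lt_def, Fin.ext_iff, Fin.val_castSucc, Fin.val_succ]
      omega
    by_cases hj : K.linked j = true
    · have : i = j → K.linked i = true := fun h => h ▸ hj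
      grind
    · have : i = j → K.linked i = false := fun h => h ▸ (Bool.eq_false_of_not_eq_true hj)
      grind
  rw [component, e, Finset.card_union_of_disjoint]
  · split_ifs <;> rfl
  · split_ifs <;> simp

lemma component_mono : Monotone K.component := by
  rw [Fin.monotone_iff_le_succ]
  intro j
  rw [component_succ]
  omega

variable {K}

lemma component_succ_of_not_linked {j : Fin K.edges} (hj : ¬ K.linked j = true) :
    K.component j.succ = K.component j.castSucc + 1 := by
  rw [component_succ, if_neg hj]

lemma component_eq_of_equi {a b : Fin (K.edges + 1)} (hab : a ≤ b) (h : K.Equi a b) :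
    K.component a = K.component b := by
  refine congrArg Finset.card (Finset.filter_congr fun j _ => and_congr_left fun hj => ?_)
  refine ⟨fun h' => h'.trans_le hab, fun h' => ?_⟩
  by_contra h''
  exact absurd (h j (not_lt.mp h'') (Fin.castSucc_lt_iff_succ_le.mp h')) (by simp [hj])

/-- Crossing an uncoloured edge raises the component by one, so two such edges cannot start in the
same component. -/
lemma eq_of_component_eq {i j : Fin K.edges} (hi : ¬ K.linked i = true) (hj : ¬ K.linked j = true)
    (h : K.component i.castSucc = K.component j.castSucc) : i = j := by
  have key {i j : Fin K.edges} (hi : ¬ K.linked i = true)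
      (h : K.component i.castSucc = K.component j.castSucc) : ¬ i < j := by
    intro hij
    have h₁ := component_succ_of_not_linked hi
    have h₂ := K.component_mono (show i.succ ≤ j.castSucc from hij)
    omega
  exact le_antisymm (not_lt.mp (key hj h.symm)) (not_lt.mp (key hi h))

/-- The component grows from `0` by steps of at most one, so each intermediate value is left through
some uncoloured edge. -/
lemma exists_component_eq {c : ℕ} (hc : c < K.component (Fin.last _)) :
    ∃ j : Fin K.edges, ¬ K.linked j = true ∧ K.component j.castSucc = c := by
  suffices ∀ a, c < K.component a →
      ∃ j : Fin K.edges, ¬ K.linked j = true ∧ K.component j.castSucc = c from this _ hc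
  intro a
  induction a using Fin.induction with
  | zero => simp [component_zero]
  | succ j ih =>
    intro h
    by_cases hj : K.linked j = true
    · rw [component_succ, if_pos hj] at h
      exact ih h
    · rw [component_succ, if_neg hj] at h
      by_cases hc : c < K.component j.castSucc
      · exact ih hc
      · exact ⟨j, hj, by omega⟩

end Component

/-- The edges of the target of a vertical arrow that correspond to the edges of the source. -/
lemma exists_edges_of_vertical {K L : FatDelta} {f : K ⟶ L} (hf : vertical f) :
    ∃ e : Fin K.edges → Fin L.edges, Function.Injective e ∧
      (∀ j, L.linked (e j) = K.linked j) ∧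
      (∀ j, f.toFun j.castSucc ≤ (e j).castSucc ∧ (e j).succ ≤ f.toFun j.succ ∧
        L.Equi (f.toFun j.castSucc) (e j).castSucc ∧ L.Equi (e j).succ (f.toFun j.succ)) ∧
      ∀ i, i ∉ Set.range e → L.linked i = true := by
  have h (j : Fin K.edges) : ∃ i : Fin L.edges, L.linked i = K.linked j ∧
      f.toFun j.castSucc ≤ i.castSucc ∧ i.succ ≤ f.toFun j.succ := by
    have hj := f.strictMono j.castSucc_lt_succ
    by_cases hK : K.linked j = true
    · have hL := f.map_equi _ _ j.castSucc_lt_succ ((K.equi_edge j).mpr hK)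
      -- All edges in the image of a coloured edge are coloured; the first one is taken.
      let i : Fin L.edges := ⟨f.toFun j.castSucc, by
        have := (f.toFun j.succ).isLt
        have : (f.toFun j.castSucc : ℕ) < f.toFun j.succ := hj
        omega⟩
      have hi : f.toFun j.castSucc ≤ i.castSucc ∧ i.succ ≤ f.toFun j.succ :=
        ⟨le_rfl, show (i : ℕ) + 1 ≤ _ from hj⟩
      exact ⟨i, (hL i hi.1 hi.2).trans hK.symm, hi⟩
    · by_contra! hi
      -- Were every edge in the image coloured, the component would not change across it, contrary
      -- to verticality.
      have : L.Equi (f.toFun j.castSucc) (f.toFun j.succ) := by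
        intro i h₁ h₂
        by_contra hL
        refine absurd h₂ (not_le.mpr (hi i ?_ h₁))
        rw [Bool.eq_false_of_not_eq_true hL, Bool.eq_false_of_not_eq_true hK]
      have := component_eq_of_equi hj.le this
      rw [hf.2, hf.2, component_succ_of_not_linked hK] at this
      omega
  choose e he₁ he₂ he₃ using h
  have hc (j : Fin K.edges) (hj : ¬ K.linked j = true) (i : Fin L.edges)
      (hi : ¬ L.linked i = true) (h₁ : f.toFun j.castSucc ≤ i.castSucc)
      (h₂ : i.succ ≤ f.toFun j.succ) : L.component i.castSucc = K.component j.castSucc := by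
    have h₁ := L.component_mono h₁
    have h₂ := L.component_mono h₂
    rw [hf.2] at h₁ h₂
    rw [component_succ_of_not_linked hj, component_succ_of_not_linked hi] at h₂
    omega
  -- The image of an edge contains at most one uncoloured edge, and only if the edge is itself
  -- uncoloured; so everything in it except `e j` is coloured.
  have hlink (j : Fin K.edges) (i : Fin L.edges) (h₁ : f.toFun j.castSucc ≤ i.castSucc)
      (h₂ : i.succ ≤ f.toFun j.succ) (hi : i ≠ e j) : L.linked i = true := by
    by_contra hL
    by_cases hK : K.linked j = true
    · exact hL (f.map_equi _ _ j.castSucc_lt_succ ((K.equi_edge j).mpr hK) i h₁ h₂)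
    · have he : ¬ L.linked (e j) = true := by rwa [he₁]
      exact hi (eq_of_component_eq hL he
        ((hc j hK i hL h₁ h₂).trans (hc j hK (e j) he (he₂ j) (he₃ j)).symm))
  refine ⟨e, StrictMono.injective fun j j' hj => ?_, he₁, fun j => ⟨he₂ j, he₃ j, ?_, ?_⟩, ?_⟩
  · have : f.toFun j.succ ≤ f.toFun j'.castSucc := f.strictMono.monotone hj
    exact ((he₃ j).trans this).trans (he₂ j')
  · intro i h₁ h₂
    have hi : i < e j := h₂
    exact hlink j i h₁ ((Fin.castSucc_lt_succ.le.trans' h₂ |>.trans (he₃ j))) hi.ne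
  · intro i h₁ h₂
    have hi : e j < i := h₁
    exact hlink j i ((he₂ j).trans (Fin.castSucc_le_castSucc_iff.mpr hi.le)) h₂ hi.ne'
  · intro i hi
    -- An uncoloured edge of `L` leaves some component other than the last. As `K` has as many
    -- components, an uncoloured edge `j` of `K` leaves the one with the same number, and `e j` must
    -- be the given edge.
    by_contra hL
    have h₁ := component_succ_of_not_linked hL
    have h₂ := L.component_mono (Fin.le_last i.succ)
    rw [← hf.1] at h₂
    obtain ⟨j, hj, hj'⟩ := exists_component_eq (K := K) (c := L.component i.castSucc) (by omega)
    have he : ¬ L.linked (e j) = true := by rwa [he₁]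
    exact hi ⟨j, eq_of_component_eq he hL ((hc j hj (e j) he (he₂ j) (he₃ j)).trans hj')⟩

end FatDelta

/-! ### Dropping weak units at the ends of an interval -/

namespace Strictification

variable {M : Type u} [Category.{v} M] [MonoidalCategory M] [ModelCategory M]
  {𝓡 : Strictification M} {K L : FatDelta} {β : Bool}

section Drop

variable {T T' : 𝓡.Diag K}

/-- The comparison that uses a weak equivalence to the unit object on the left. -/
def Diag.dropLeft (T : 𝓡.Diag K) {a a' b : Fin (K.edges + 1)} (ha : a < a') (hb : a' < b)
    (hE : K.Equi a a') : 𝓡.r (T.obj a b (ha.trans hb)) ⟶ 𝓡.r (T.obj a' b hb) :=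
  (T.mul a a' b ha hb).hom ≫ (T.unit a a' ha hE ▷ _) ≫ (λ_ _).hom

/-- The comparison that uses a weak equivalence to the unit object on the right. -/
def Diag.dropRight (T : 𝓡.Diag K) {a b b' : Fin (K.edges + 1)} (ha : a < b) (hb : b < b')
    (hE : K.Equi b b') : 𝓡.r (T.obj a b' (ha.trans hb)) ⟶ 𝓡.r (T.obj a b ha) :=
  (T.mul a b b' ha hb).hom ≫ (_ ◁ T.unit b b' hb hE) ≫ (ρ_ _).hom

lemma Diag.dropLeft_unit {a a' b : Fin (K.edges + 1)} (ha : a < a') (hb : a' < b)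
    (hE : K.Equi a a') (h : K.Equi a b) (h' : K.Equi a' b) :
    T.dropLeft ha hb hE ≫ T.unit a' b hb h' = T.unit a b (ha.trans hb) h := by
  rw [T.unit_mul a a' b ha hb h, MonoidalCategory.tensorHom_def]
  simp [dropLeft, Diag.mul]

/-- The multiplication of units uses the left unitor; on the right-hand side the two unitors of `𝟙_
M` have to be identified. -/
lemma Diag.dropRight_unit {a b b' : Fin (K.edges + 1)} (ha : a < b) (hb : b < b')
    (hE : K.Equi b b') (h : K.Equi a b') (h' : K.Equi a b) :
    T.dropRight ha hb hE ≫ T.unit a b ha h' = T.unit a b' (ha.trans hb) h := by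
  rw [T.unit_mul a b b' ha hb h, MonoidalCategory.tensorHom_def', unitors_equal]
  simp [dropRight, Diag.mul]

lemma Diag.dropLeft_naturality (f : T ⟶ T') {a a' b : Fin (K.edges + 1)} (ha : a < a')
    (hb : a' < b) (hE : K.Equi a a') :
    Hom.app f a b (ha.trans hb) ≫ T'.dropLeft ha hb hE = T.dropLeft ha hb hE ≫ Hom.app f a' b hb := by
  simp only [dropLeft, assoc]
  rw [reassoc_of% Hom.app_mul f a a' b ha hb, ← Hom.app_unit f a a' ha hE,
    MonoidalCategory.tensorHom_def', comp_whiskerRight]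
  simp only [assoc]
  rw [whisker_exchange_assoc, whisker_exchange_assoc, leftUnitor_naturality]

lemma Diag.dropRight_naturality (f : T ⟶ T') {a b b' : Fin (K.edges + 1)} (ha : a < b)
    (hb : b < b') (hE : K.Equi b b') :
    Hom.app f a b' (ha.trans hb) ≫ T'.dropRight ha hb hE =
      T.dropRight ha hb hE ≫ Hom.app f a b ha := by
  simp only [dropRight, assoc]
  rw [reassoc_of% Hom.app_mul f a b b' ha hb, ← Hom.app_unit f b b' hb hE,
    MonoidalCategory.tensorHom_def, MonoidalCategory.whiskerLeft_comp]
  simp only [assoc]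
  rw [← whisker_exchange_assoc, ← whisker_exchange_assoc, rightUnitor_naturality]

variable [MonoidalModelCategory M]

/-- The unit axiom makes the comparison a weak equivalence. When `a = a'` there is nothing to drop,
since a diagram has no value on a degenerate arrow, and the identity is used. -/
lemma exists_dropLeft {a a' b : Fin (K.edges + 1)} (ha : a ≤ a')
    (hb : a' < b) (hE : K.Equi a a') (h : β = true → K.Equi a b) (h' : β = true → K.Equi a' b) :
    ∃ α : Diag.eval (𝓡 := 𝓡) a b (ha.trans_lt hb) h ⟶ Diag.eval a' b hb h',
      ∀ T, WeakEquivalence (Edge.Hom.hom (α.app T)) := by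
  rcases ha.eq_or_lt with rfl | ha
  · exact ⟨𝟙 _, fun T => inferInstanceAs (WeakEquivalence (𝟙 (𝓡.r (T.obj a b hb))))⟩
  exact ⟨{ app := fun T => ⟨T.dropLeft ha hb hE, fun hβ => T.dropLeft_unit ha hb hE (h hβ) (h' hβ)⟩
           naturality := fun T T' f => Edge.hom_ext (Diag.dropLeft_naturality f ha hb hE) },
    fun T => MonoidalModelCategory.weakEquivalence_isIso_comp (T.mul a a' b ha hb).hom _
      (MonoidalModelCategory.unit_left _ _ inferInstance (T.weakEquivalence_unit a a' ha hE)
        inferInstance)⟩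

lemma exists_dropRight {a b b' : Fin (K.edges + 1)} (ha : a < b)
    (hb : b ≤ b') (hE : K.Equi b b') (h : β = true → K.Equi a b') (h' : β = true → K.Equi a b) :
    ∃ α : Diag.eval (𝓡 := 𝓡) a b' (ha.trans_le hb) h ⟶ Diag.eval a b ha h',
      ∀ T, WeakEquivalence (Edge.Hom.hom (α.app T)) := by
  rcases hb.eq_or_lt with rfl | hb
  · exact ⟨𝟙 _, fun T => inferInstanceAs (WeakEquivalence (𝟙 (𝓡.r (T.obj a b ha))))⟩
  exact ⟨{ app := fun T => ⟨T.dropRight ha hb hE, fun hβ => T.dropRight_unit ha hb hE (h hβ) (h' hβ)⟩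
           naturality := fun T T' f => Edge.hom_ext (Diag.dropRight_naturality f ha hb hE) },
    fun T => MonoidalModelCategory.weakEquivalence_isIso_comp (T.mul a b b' ha hb).hom _
      (MonoidalModelCategory.unit_right _ _ inferInstance (T.weakEquivalence_unit b b' hb hE)
        inferInstance)⟩

lemma exists_dropBoth {a a' b b' : Fin (K.edges + 1)} (ha : a ≤ a')
    (hab : a' < b) (hb : b ≤ b') (hE : K.Equi a a') (hE' : K.Equi b b')
    (h : β = true → K.Equi a b') (h' : β = true → K.Equi a' b) :
    ∃ α : Diag.eval (𝓡 := 𝓡) a b' ((ha.trans_lt hab).trans_le hb) h ⟶ Diag.eval a' b hab h',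
      ∀ T, WeakEquivalence (Edge.Hom.hom (α.app T)) := by
  obtain ⟨α, hα⟩ := exists_dropLeft (𝓡 := 𝓡) ha (hab.trans_le hb) hE h (fun hβ => (h' hβ).trans hE')
  obtain ⟨α', hα'⟩ := exists_dropRight (𝓡 := 𝓡) hab hb hE' (fun hβ => (h' hβ).trans hE') h'
  refine ⟨α ≫ α', fun T => ?_⟩
  have := hα T
  have := hα' T
  change WeakEquivalence (Edge.Hom.hom (α.app T) ≫ Edge.Hom.hom (α'.app T))
  infer_instance

end Drop

/-! ### Contractibility of the weak units -/

/-- Two-out-of-three in the triangle over the unit object. -/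
lemma Edge.weakEquivalence_hom (hβ : β = true) {x y : 𝓡.Edge β} (f : x ⟶ y) :
    WeakEquivalence (Edge.Hom.hom f) := by
  have := x.weakEquivalence_unit hβ
  have := y.weakEquivalence_unit hβ
  exact weakEquivalence_of_postcomp_of_fac (Edge.Hom.hom_unit f hβ)

/-- A cofibrant replacement of the unit object is a weak unit. -/
lemma Edge.nonempty [MonoidalModelCategory M] : Nonempty (𝓡.Edge β) := by
  let d := MorphismProperty.factorizationData (cofibrations M) (trivialFibrations M)
    (initial.to (𝟙_ M))
  have : Cofibration d.i := (cofibration_iff _).mpr d.hi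
  have : IsCofibrant d.Z := (isCofibrant_iff_of_isInitial d.i initialIsInitial).mpr this
  obtain ⟨s, hs⟩ := 𝓡.exists_eq d.Z
  have : WeakEquivalence d.p := inferInstance
  exact ⟨⟨s, fun _ => eqToHom hs ≫ d.p, fun _ => inferInstance⟩⟩

/-- Coloured edges can be connected functorially to a given one. -/
lemma Edge.exists_cospan [MonoidalModelCategory M] (hβ : β = true) (z : 𝓡.Edge β) :
    ∃ R : 𝓡.Edge β ⥤ 𝓡.Edge β, Nonempty (𝟭 _ ⟶ R) ∧ Nonempty ((Functor.const _).obj z ⟶ R) := by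
  obtain ⟨⟨data⟩⟩ := MonoidalModelCategory.functorial₁ (M := M)
  let toOver : 𝓡.Edge β ⥤ Over (𝟙_ M) :=
    { obj := fun x => Over.mk (x.unit hβ)
      map := fun f => Over.homMk (Edge.Hom.hom f) (Edge.Hom.hom_unit f hβ) }
  let P := MonoidalModelCategory.replacement data (toOver.obj z)
  have h (x : 𝓡.Edge β) : ∃ s, 𝓡.r s = (P.obj (toOver.obj x)).left := by
    have : IsCofibrant (toOver.obj x).left := inferInstanceAs (IsCofibrant (𝓡.r x.obj))
    have : IsCofibrant (toOver.obj z).left := inferInstanceAs (IsCofibrant (𝓡.r z.obj))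
    have := MonoidalModelCategory.isCofibrant_replacement data (toOver.obj z) (toOver.obj x)
    exact 𝓡.exists_eq _
  choose s hs using h
  have (x : 𝓡.Edge β) : WeakEquivalence (P.obj (toOver.obj x)).hom :=
    MonoidalModelCategory.weakEquivalence_replacement data (toOver.obj z) (toOver.obj x)
  -- The replacement of `x ⨿ z` over the unit is only equal to some `r s`, so the functor is
  -- conjugated by `eqToHom`.
  let R : 𝓡.Edge β ⥤ 𝓡.Edge β :=
    { obj := fun x => ⟨s x, fun _ => eqToHom (hs x) ≫ (P.obj (toOver.obj x)).hom,
        fun _ => MonoidalModelCategory.weakEquivalence_isIso_comp _ _ (this x)⟩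
      map := fun {x y} f => ⟨eqToHom (hs x) ≫ (P.map (toOver.map f)).left ≫ eqToHom (hs y).symm,
        fun _ => by simp⟩
      map_id := fun x => Edge.hom_ext (by simp)
      map_comp := fun f g => Edge.hom_ext (by simp) }
  let α := MonoidalModelCategory.toReplacement data (toOver.obj z)
  let γ := MonoidalModelCategory.constToReplacement data (toOver.obj z)
  have key {z z' : Over (𝟙_ M)} (f : z ⟶ z') {Z : M} (h : Z = z'.left) :
      (f.left ≫ eqToHom h.symm) ≫ eqToHom h ≫ z'.hom = z.hom := by simp
  have key' {x y : 𝓡.Edge β} (f : x ⟶ y) {A A' : Over (𝟙_ M)}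
      (u : A ⟶ P.obj (toOver.obj x)) (u' : A' ⟶ P.obj (toOver.obj y)) (g : A ⟶ A')
      (h : g ≫ u' = u ≫ P.map (toOver.map f)) :
      g.left ≫ u'.left ≫ eqToHom (hs y).symm = (u.left ≫ eqToHom (hs x).symm) ≫
        eqToHom (hs x) ≫ (P.map (toOver.map f)).left ≫ eqToHom (hs y).symm := by
    have := congrArg (fun t => t.left ≫ eqToHom (hs y).symm) h
    simpa using this
  exact ⟨R, ⟨{ app := fun x => ⟨(α.app (toOver.obj x)).left ≫ eqToHom (hs x).symm,
                 fun _ => key (α.app (toOver.obj x)) (hs x)⟩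
               naturality := fun x y f => Edge.hom_ext
                 (key' f _ _ (toOver.map f) (α.naturality (toOver.map f))) }⟩,
    ⟨{ app := fun x => ⟨(γ.app (toOver.obj x)).left ≫ eqToHom (hs x).symm,
         fun _ => key (γ.app (toOver.obj x)) (hs x)⟩
       naturality := fun x y f => Edge.hom_ext
         (key' f _ _ (𝟙 (toOver.obj z)) (γ.naturality (toOver.map f))) }⟩⟩

end Strictification

/-! ### Vertical arrows give equifunctors -/

namespace Strictification

variable {M : Type u} [Category.{v} M] [MonoidalCategory M] [ModelCategory M]
  [MonoidalModelCategory M] (𝓡 : Strictification M) {K L : FatDelta}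

/-- The restriction of diagrams to the edges, as an arrow of coloured categories. -/
def spineMap (K : FatDelta) : Diag.ccat 𝓡 K ⟶ 𝓡.spineCCat K :=
  { functor := spine 𝓡 K, map := fun _ _ _ hf j => hf _ _ j.castSucc_lt_succ }

instance (K : FatDelta) : IsIso (𝓡.spineMap K) := by
  have : (CCat.functor (𝓡.spineMap K)).Full := inferInstanceAs (spine 𝓡 K).Full
  have : (CCat.functor (𝓡.spineMap K)).Faithful := inferInstanceAs (spine 𝓡 K).Faithful
  exact CCat.isIso_of_bijective _ ⟨spine_obj_injective, spine_obj_surjective⟩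
    (fun f hf => equi_of_spine f hf)

variable {e : Fin K.edges → Fin L.edges}

/-- The projection of families of edges. -/
def spineProj (e : Fin K.edges → Fin L.edges) (he : ∀ j, L.linked (e j) = K.linked j) :
    𝓡.spineCCat L ⟶ 𝓡.spineCCat K where
  functor := Functor.pi' (fun j => Pi.eval _ (e j) ⋙ Edge.forget (fun h => (he j).trans h))
  map _ _ _ hf j := hf (e j)

/-- The components of a homotopy inverse to the projection. -/
lemma exists_inverse_component (inj : Function.Injective e)
    (he : ∀ j, L.linked (e j) = K.linked j) (he' : ∀ i, i ∉ Set.range e → L.linked i = true)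
    (i : Fin L.edges) :
    ∃ (G : 𝓡.Spine K ⥤ 𝓡.Edge (L.linked i)) (P : 𝓡.Spine L ⥤ 𝓡.Edge (L.linked i))
      (α : Pi.eval _ i ⟶ P) (γ : CCat.functor (𝓡.spineProj e he) ⋙ G ⟶ P),
      (∀ j (h : e j = i), G ⋙ Edge.forget (fun h' => h ▸ (he j).trans h') = Pi.eval _ j) ∧
      (∀ {x y : 𝓡.Spine K} (f : x ⟶ y), (𝓡.spineCCat K).equi f →
        WeakEquivalence (Edge.Hom.hom (G.map f))) ∧
      (∀ {x y : 𝓡.Spine L} (f : x ⟶ y), (𝓡.spineCCat L).equi f →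
        WeakEquivalence (Edge.Hom.hom (P.map f))) ∧
      (∀ x, WeakEquivalence (Edge.Hom.hom (α.app x))) ∧
      ∀ x, WeakEquivalence (Edge.Hom.hom (γ.app x)) := by
  by_cases hi : i ∈ Set.range e
  · obtain ⟨j, rfl⟩ := hi
    refine ⟨Pi.eval _ j ⋙ Edge.forget (fun h => (he j).symm.trans h), Pi.eval _ (e j), 𝟙 _,
      𝟙 (Pi.eval _ (e j)), fun j' h => ?_, fun f hf => hf j, fun f hf => hf (e j),
      fun x => inferInstanceAs (WeakEquivalence (𝟙 _)), fun x => inferInstanceAs (WeakEquivalence (𝟙 _))⟩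
    obtain rfl := inj h
    rfl
  -- An edge outside the range of `e` is coloured: the inverse puts a fixed weak unit `z` there, and
  -- the cospan from the identity and from `z` to `R` connects it to the given weak unit.
  · have hl := he' i hi
    obtain ⟨z⟩ := Edge.nonempty (𝓡 := 𝓡) (β := L.linked i)
    obtain ⟨R, ⟨α⟩, ⟨γ⟩⟩ := Edge.exists_cospan hl z
    exact ⟨(Functor.const _).obj z, Pi.eval _ i ⋙ R,
      { app := fun x => α.app (x i), naturality := fun x y f => α.naturality (f i) },
      { app := fun x => γ.app (x i), naturality := fun x y f => γ.naturality (f i) }, fun j h => absurd ⟨j, h⟩ hi,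
      fun f _ => Edge.weakEquivalence_hom hl _, fun f _ => Edge.weakEquivalence_hom hl _,
      fun x => Edge.weakEquivalence_hom hl _, fun x => Edge.weakEquivalence_hom hl _⟩

/-- The section `σ` copies the matched edges and fills the others with fixed weak units. Projecting
after `σ` is strictly the identity; the other composite is joined to the identity by a cospan of
coloured transformations through `ρ`. -/
lemma isIso_toHo_spineProj (inj : Function.Injective e)
    (he : ∀ j, L.linked (e j) = K.linked j) (he' : ∀ i, i ∉ Set.range e → L.linked i = true) :
    IsIso (CCat.toHo.map (𝓡.spineProj e he)) := by
  choose G P α γ hG hG' hP hα hγ using 𝓡.exists_inverse_component inj he he'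
  let σ : 𝓡.spineCCat K ⟶ 𝓡.spineCCat L :=
    { functor := Functor.pi' G, map := fun _ _ f hf i => hG' i f hf }
  let ρ : 𝓡.spineCCat L ⟶ 𝓡.spineCCat L :=
    { functor := Functor.pi' P, map := fun _ _ f hf i => hP i f hf }
  have h₁ : σ ≫ 𝓡.spineProj e he = 𝟙 _ := by
    refine CCat.hom_ext (Functor.pi_ext _ _ fun j => ?_)
    exact hG (e j) j rfl
  let A : CCat.ColouredTrans (𝟙 (𝓡.spineCCat L)) ρ :=
    { trans := { app := fun x i => (α i).app x
                 naturality := fun x y f => funext fun i => (α i).naturality f }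
      equi := fun x i => hα i x }
  let B : CCat.ColouredTrans (𝓡.spineProj e he ≫ σ) ρ :=
    { trans := { app := fun x i => (γ i).app x
                 naturality := fun x y f => funext fun i => (γ i).naturality f }
      equi := fun x i => hγ i x }
  refine ⟨CCat.toHo.map σ, ?_, ?_⟩
  · rw [← Functor.map_comp, CCat.toHo_map_eq B, ← CCat.toHo_map_eq A, CategoryTheory.Functor.map_id]
  · rw [← Functor.map_comp, h₁, CategoryTheory.Functor.map_id]

/-- Over each edge of `K`, dropping the weak units on both sides of the matched edge is a coloured
transformation. So in the homotopy category restriction along `f` followed by an isomorphism equals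
an isomorphism followed by `spineProj`. -/
lemma equifunctors_of_vertical {f : K ⟶ L} (hf : FatDelta.vertical f) :
    CCat.equifunctors ((Diag.nerve 𝓡).map f.op) := by
  obtain ⟨e, inj, he, he', hl⟩ := FatDelta.exists_edges_of_vertical hf
  have h (j : Fin K.edges) := exists_dropBoth (𝓡 := 𝓡) (β := K.linked j) (he' j).1
    (e j).castSucc_lt_succ (he' j).2.1 (he' j).2.2.1 (he' j).2.2.2
    (fun h => f.map_equi _ _ j.castSucc_lt_succ ((K.equi_edge j).mpr h))
    (fun h => (L.equi_edge (e j)).mpr ((he j).trans h))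
  choose α hα using h
  let φ : Diag.ccat 𝓡 L ⟶ Diag.ccat 𝓡 K := (Diag.nerve 𝓡).map f.op
  let A : CCat.ColouredTrans (φ ≫ 𝓡.spineMap K) (𝓡.spineMap L ≫ 𝓡.spineProj e he) :=
    { trans := { app := fun T j => (α j).app T
                 naturality := fun T T' g => funext fun j => (α j).naturality g }
      equi := fun T j => hα j T }
  have hA := CCat.toHo_map_eq A
  have := 𝓡.isIso_toHo_spineProj inj he hl
  rw [Functor.map_comp, Functor.map_comp] at hA
  have : IsIso (CCat.toHo.map φ ≫ CCat.toHo.map (𝓡.spineMap K)) := by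
    rw [hA]
    infer_instance
  have : IsIso (CCat.toHo.map φ) := IsIso.of_isIso_comp_right _ (CCat.toHo.map (𝓡.spineMap K))
  exact CCat.equifunctors_of_isIso φ

lemma isFairMonoid : IsFairMonoid (Diag.nerve 𝓡) where
  discrete := inferInstanceAs (IsDiscrete (𝓡.Diag FatDelta.dot))
  segal _ _ h := 𝓡.isPullback_of_isPushout h
  colours _ hf := 𝓡.equifunctors_of_vertical hf
  singleton := ⟨inferInstanceAs (Unique (𝓡.Diag FatDelta.dot))⟩

end Strictification

/-! ## The identification of the arrows and of the weak units -/

namespace Strictification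

variable {M : Type u} [Category.{v} M] [MonoidalCategory M] [ModelCategory M]

section

variable (𝓡 : Strictification M)

variable {𝓡} in
lemma exists_spine_map_eq {K : FatDelta} {T T' : 𝓡.Diag K}
    (e : (spine 𝓡 K).obj T ⟶ (spine 𝓡 K).obj T') : ∃ f : T ⟶ T', (spine 𝓡 K).map f = e :=
  (spine 𝓡 K).map_surjective e

/-- The unique edge of a diagram whose shape is an arrow. -/
def arrowEdge (β : Bool) : 𝓡.Diag ⟨1, fun _ => β⟩ ⥤ 𝓡.Edge β :=
  Diag.eval (K := ⟨1, fun _ => β⟩) (0 : Fin 2) (1 : Fin 2)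
    (show (0 : Fin 2) < 1 by decide) (fun h _ _ _ => h)

instance (β : Bool) : (𝓡.arrowEdge β).Faithful where
  map_injective {T T'} f g h := (spine 𝓡 _).map_injective (funext fun j => by
    obtain rfl : j = (0 : Fin 1) := Subsingleton.elim (α := Fin 1) _ _
    exact h)

instance (β : Bool) : (𝓡.arrowEdge β).Full where
  map_surjective {T T'} g := by
    obtain ⟨f, hf⟩ := exists_spine_map_eq (T := T) (T' := T')
      (fun j => Fin.cases (n := 0) (motive := fun j => (spine 𝓡 _).obj T j ⟶ (spine 𝓡 _).obj T' j)
        g (fun i => i.elim0) j)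
    exact ⟨f, congrFun hf (0 : Fin 1)⟩

lemma arrowEdge_obj_injective (β : Bool) : Function.Injective (𝓡.arrowEdge β).obj := by
  intro T T' h
  refine spine_obj_injective (funext fun j => ?_)
  obtain rfl : j = (0 : Fin 1) := Subsingleton.elim (α := Fin 1) _ _
  exact h

lemma arrowEdge_obj_surjective [MonoidalModelCategory M] (β : Bool) :
    Function.Surjective (𝓡.arrowEdge β).obj := by
  intro x
  obtain ⟨T, hT⟩ := spine_obj_surjective (𝓡 := 𝓡) (K := ⟨1, fun _ => β⟩) (fun _ => x)
  exact ⟨T, congrFun hT (0 : Fin 1)⟩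

instance [MonoidalModelCategory M] (β : Bool) : (𝓡.arrowEdge β).EssSurj where
  mem_essImage x := by
    obtain ⟨T, rfl⟩ := 𝓡.arrowEdge_obj_surjective β x
    exact Functor.obj_mem_essImage _ _

instance [MonoidalModelCategory M] (β : Bool) : (𝓡.arrowEdge β).IsEquivalence where

/-- The cofibrant object represented by an element. -/
abbrev cofibrantObject (s : 𝓡.S) : CofibrantObject M := CofibrantObject.mk (𝓡.r s)

lemma cofibrantObject_surjective : Function.Surjective 𝓡.cofibrantObject := by
  rintro ⟨Z, hZ⟩
  have : IsCofibrant Z := hZ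
  obtain ⟨s, rfl⟩ := 𝓡.exists_eq Z
  exact ⟨s, rfl⟩

/-- The uncoloured edges are the cofibrant objects. -/
def edgeToCofibrant : 𝓡.Edge false ⥤ CofibrantObject M where
  obj x := 𝓡.cofibrantObject x.obj
  map f := CofibrantObject.homMk (Edge.Hom.hom f)

lemma edgeToCofibrant_obj_surjective : Function.Surjective 𝓡.edgeToCofibrant.obj := by
  intro Z
  obtain ⟨s, rfl⟩ := 𝓡.cofibrantObject_surjective Z
  exact ⟨⟨s, nofun, nofun⟩, rfl⟩

instance : 𝓡.edgeToCofibrant.IsEquivalence where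
  faithful := ⟨fun h => Edge.hom_ext (congrArg InducedCategory.Hom.hom h)⟩
  full := ⟨fun f => ⟨⟨f.hom, nofun⟩, rfl⟩⟩
  essSurj := ⟨fun Z => by
    obtain ⟨x, rfl⟩ := 𝓡.edgeToCofibrant_obj_surjective Z
    exact Functor.obj_mem_essImage _ _⟩

/-- The coloured edges are the weak units. -/
def edgeToWeakUnits : 𝓡.Edge true ⥤ WeakUnits M where
  obj x := ⟨CostructuredArrow.mk (S := CofibrantObject.ι) (Y := 𝓡.cofibrantObject x.obj)
    (x.unit rfl), x.weakEquivalence_unit rfl⟩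
  map f := ⟨CostructuredArrow.homMk (CofibrantObject.homMk (Edge.Hom.hom f)) (Edge.Hom.hom_unit f rfl)⟩

lemma edgeToWeakUnits_obj_surjective : Function.Surjective 𝓡.edgeToWeakUnits.obj := by
  rintro ⟨⟨Z, ⟨⟨⟩⟩, w⟩, hw⟩
  obtain ⟨s, rfl⟩ := 𝓡.cofibrantObject_surjective Z
  exact ⟨⟨s, fun _ => w, fun _ => hw⟩, rfl⟩

instance : 𝓡.edgeToWeakUnits.IsEquivalence where
  faithful := ⟨fun h => Edge.hom_ext (congrArg (fun t => t.hom.left.hom) h)⟩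
  full := ⟨fun f => ⟨⟨f.hom.left.hom, fun _ => CostructuredArrow.w f.hom⟩, rfl⟩⟩
  essSurj := ⟨fun Z => by
    obtain ⟨x, rfl⟩ := 𝓡.edgeToWeakUnits_obj_surjective Z
    exact Functor.obj_mem_essImage _ _⟩

/-- The comparison of the composition law with the tensor product. -/
def tensorData : FatDelta.TensorData M (Diag.nerve 𝓡) where
  F := 𝓡.arrowEdge false ⋙ 𝓡.edgeToCofibrant
  μ := NatIso.ofComponents
    (fun T : 𝓡.Diag (FatDelta.hops 2) => T.mul (0 : Fin 3) (1 : Fin 3) (2 : Fin 3) (by decide) (by decide))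
    (fun {T T' : 𝓡.Diag (FatDelta.hops 2)} f => Diag.Hom.app_mul f (0 : Fin 3) (1 : Fin 3) (2 : Fin 3) (by decide) (by decide))

/-- The equalities of objects behind the `eqToHom` in `TensorData.mul` hold definitionally for
`Diag.nerve`. -/
lemma tensorData_mul {K : FatDelta} (T : 𝓡.Diag K) (a b c : Fin (K.edges + 1)) (hab : a < b)
    (hbc : b < c) : 𝓡.tensorData.mul (K := K) T a b c hab hbc = (T.mul a b c hab hbc).hom := by
  have key {X Y Z : M} (f : X ⟶ Y ⊗ Z) :
    eqToHom (rfl : X = X) ≫ f ≫ (eqToHom (rfl : Y = Y) ⊗ₘ eqToHom (rfl : Z = Z)) = f := by simp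
  exact key (T.mul a b c hab hbc).hom

lemma links_equi {n : ℕ} (a b : Fin (n + 1)) : (FatDelta.links n).Equi a b := fun _ _ _ => rfl

/-- The weak equivalences from the coloured edges to the unit object. -/
def unitTrans : (FatDelta.res (Diag.nerve 𝓡)
      (FatDelta.arrow (FatDelta.links 1) (0 : Fin 2) (1 : Fin 2) (by decide)) ⋙ 𝓡.tensorData.F) ⋙
    CofibrantObject.ι ⟶ (Functor.const _).obj (𝟙_ M) where
  app (T : 𝓡.Diag (FatDelta.links 1)) :=
    T.unit (0 : Fin 2) (1 : Fin 2) (by decide) (links_equi _ _)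
  naturality (T T' : 𝓡.Diag (FatDelta.links 1)) f :=
    (Diag.Hom.app_unit f (0 : Fin 2) (1 : Fin 2) (by decide) (links_equi _ _)).trans
      (Category.comp_id _).symm

lemma weakEquivalence_unitTrans (T : (Diag.nerve 𝓡).obj (op (FatDelta.links 1))) :
    WeakEquivalence (𝓡.unitTrans.app T) :=
  Diag.weakEquivalence_unit (K := FatDelta.links 1) T _ _ _ _

/-- The fair monoid of cofibrant objects. -/
def cofibrantFairMonoid [MonoidalModelCategory M] : CofibrantFairMonoid M (Diag.nerve 𝓡) where
  toTensorData := 𝓡.tensorData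
  isEquivalence := inferInstanceAs (𝓡.arrowEdge false ⋙ 𝓡.edgeToCofibrant).IsEquivalence
  equi_iff {T T'} f := by
    refine ⟨fun h => h (0 : Fin 2) (1 : Fin 2) (by decide), fun h => equi_of_spine f fun j => ?_⟩
    obtain rfl : j = (0 : Fin 1) := Subsingleton.elim (α := Fin 1) _ _
    exact h
  associativity (T : 𝓡.Diag (FatDelta.hops 3)) := by
    have key {A B C AB BC X : M} {p p' : X ⟶ A ⊗ BC} {q q' : BC ⟶ B ⊗ C} {p₁ p₁' : X ⟶ AB ⊗ C}
        {q₁ q₁' : AB ⟶ A ⊗ B} (hp : p = p') (hq : q = q') (hp₁ : p₁ = p₁') (hq₁ : q₁ = q₁')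
        (h : p' ≫ (A ◁ q') = p₁' ≫ (q₁' ▷ C) ≫ (α_ A B C).hom) :
        p ≫ (A ◁ q) = p₁ ≫ (q₁ ▷ C) ≫ (α_ A B C).hom := by rw [hp, hq, hp₁, hq₁, h]
    exact key (𝓡.tensorData_mul T _ _ _ _ _) (𝓡.tensorData_mul T _ _ _ _ _)
      (𝓡.tensorData_mul T _ _ _ _ _) (𝓡.tensorData_mul T _ _ _ _ _) (𝓡.μ'_associativity _ _ _ _)
  ε := 𝓡.unitTrans
  ε_weakEquivalence := 𝓡.weakEquivalence_unitTrans
  isEquivalence_units := inferInstanceAs (𝓡.arrowEdge true ⋙ 𝓡.edgeToWeakUnits).IsEquivalence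
  equi_units := by
    refine le_antisymm le_top fun T T' f _ => equi_of_spine f fun j => ?_
    exact Edge.weakEquivalence_hom rfl ((spine 𝓡 (FatDelta.links 1)).map f j)
  unit_mul (T : 𝓡.Diag (FatDelta.links 2)) := by
    have key {X Y Z : M} {f f' : X ⟶ Y ⊗ Z} (hf : f = f') {u : X ⟶ 𝟙_ M} {g : Y ⟶ 𝟙_ M}
        {h : Z ⟶ 𝟙_ M} (e : u = f' ≫ (g ⊗ₘ h) ≫ (λ_ (𝟙_ M)).hom) :
        eqToHom (rfl : X = X) ≫ u = f ≫ ((eqToHom (rfl : Y = Y) ≫ g) ⊗ₘ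
          (eqToHom (rfl : Z = Z) ≫ h)) ≫ (λ_ (𝟙_ M)).hom := by simp [e, hf]
    exact key (𝓡.tensorData_mul T _ _ _ _ _) (T.unit_mul (0 : Fin 3) (1 : Fin 3) (2 : Fin 3) (by decide) (by decide)
      (links_equi _ _))

lemma isStrict_cofibrantFairMonoid [MonoidalModelCategory M]
    (h : Function.Injective 𝓡.r) (hμ : ∀ s t, ∃ h, (𝓡.μ s t).hom = eqToHom h) :
    𝓡.cofibrantFairMonoid.IsStrict where
  bijective := by
    refine Function.Bijective.comp (g := 𝓡.edgeToCofibrant.obj) ⟨fun x y hxy => ?_,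
      𝓡.edgeToCofibrant_obj_surjective⟩
      ⟨𝓡.arrowEdge_obj_injective false, 𝓡.arrowEdge_obj_surjective false⟩
    exact Edge.eq_of (h (congrArg (fun t => t.obj) hxy)) nofun
  bijective_units := by
    refine Function.Bijective.comp (g := 𝓡.edgeToWeakUnits.obj) ⟨fun x y hxy => ?_,
      𝓡.edgeToWeakUnits_obj_surjective⟩
      ⟨𝓡.arrowEdge_obj_injective true, 𝓡.arrowEdge_obj_surjective true⟩
    obtain ⟨s, w, hw⟩ := x
    obtain ⟨s', w', hw'⟩ := y
    obtain rfl : s = s' := h (congrArg (fun t => t.obj.left.obj) hxy)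
    have := congr_arg_heq (fun t => t.obj.hom) hxy
    obtain rfl : w = w' := funext fun _ => eq_of_heq this
    rfl
  μ_eq (T : 𝓡.Diag (FatDelta.hops 2)) := by
    obtain ⟨h, e⟩ := hμ (T.obj (0 : Fin 3) (1 : Fin 3) (by decide)) (T.obj (1 : Fin 3) (2 : Fin 3) (by decide))
    refine ⟨(congrArg 𝓡.r (T.obj_mul (0 : Fin 3) (1 : Fin 3) (2 : Fin 3) (by decide) (by decide))).trans h, ?_⟩
    exact Eq.trans (congrArg (eqToHom (congrArg 𝓡.r (T.obj_mul (0 : Fin 3) (1 : Fin 3) (2 : Fin 3)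
      (by decide) (by decide))) ≫ ·) e) (eqToHom_trans _ _)

end

/-! ### The two strictifications -/

/-- The strictification in the case of a strictly associative tensor product. -/
def ofStrictlyAssociative [MonoidalModelCategory M] (h : StrictlyAssociative M) :
    Strictification M where
  S := ULift.{max u v} (CofibrantObject M)
  semigroup :=
    { mul := fun s t => ⟨⟨s.down.obj ⊗ t.down.obj,
        MonoidalModelCategory.isCofibrant_tensor s.down.obj t.down.obj⟩⟩
      mul_assoc := fun s t w => ULift.ext _ _ (ObjectProperty.FullSubcategory.ext
        (h s.down.obj t.down.obj w.down.obj).choose) }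
  r s := s.down.obj
  isCofibrant s := s.down.property
  μ s t := Iso.refl (s.down.obj ⊗ t.down.obj)
  associativity s t w := by
    obtain ⟨h₁, h₂⟩ := h s.down.obj t.down.obj w.down.obj
    change 𝟙 _ ≫ (𝟙 (s.down.obj ⊗ t.down.obj) ▷ w.down.obj) ≫ (α_ _ _ _).hom =
      eqToHom h₁ ≫ 𝟙 _ ≫ (s.down.obj ◁ 𝟙 (t.down.obj ⊗ w.down.obj))
    simp [h₂]
  exists_eq Z _ := ⟨⟨CofibrantObject.mk Z⟩, rfl⟩

/-- The tensor product of a non-empty list. -/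
def listTensor (x : CofibrantObject M) : List (CofibrantObject M) → M
  | [] => x.obj
  | y :: l => x.obj ⊗ listTensor y l

/-- The tensor product of a concatenation. -/
def listTensorAppend (x : CofibrantObject M) : ∀ (l : List (CofibrantObject M)) (y : CofibrantObject M)
    (m : List (CofibrantObject M)), listTensor x (l ++ y :: m) ≅ listTensor x l ⊗ listTensor y m
  | [], y, m => Iso.refl (x.obj ⊗ listTensor y m)
  | z :: l, y, m => whiskerLeftIso x.obj (listTensorAppend z l y m) ≪≫
      (α_ x.obj (listTensor z l) (listTensor y m)).symm

/-- Induction on the first list; the inductive step is the pentagon together with naturality of the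
associator. -/
lemma listTensorAppend_associativity (x : CofibrantObject M) (l : List (CofibrantObject M))
    (y : CofibrantObject M) (m : List (CofibrantObject M)) (z : CofibrantObject M)
    (n : List (CofibrantObject M)) :
    (listTensorAppend x (l ++ y :: m) z n).hom ≫
        ((listTensorAppend x l y m).hom ▷ listTensor z n) ≫ (α_ _ _ _).hom =
      eqToHom (congrArg (listTensor x) (List.append_assoc l (y :: m) (z :: n))) ≫
        (listTensorAppend x l y (m ++ z :: n)).hom ≫
        (listTensor x l ◁ (listTensorAppend y m z n).hom) := by
  induction l generalizing x with
  | nil =>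
    change (x.obj ◁ (listTensorAppend y m z n).hom ≫ (α_ _ _ _).inv) ≫
      (𝟙 (x.obj ⊗ listTensor y m) ▷ _) ≫ (α_ _ _ _).hom = 𝟙 _ ≫ 𝟙 _ ≫ (x.obj ◁ _)
    simp
  | cons w l ih =>
    -- This moves the transport between bracketings of lists inside the factor `x ◁ _`, where the
    -- whiskered induction hypothesis applies.
    have e {A B : M} (h : A = B) (h' : x.obj ⊗ A = x.obj ⊗ B) : eqToHom h' = x.obj ◁ eqToHom h := by
      subst h
      simp
    have ih := congrArg (x.obj ◁ ·) (ih w)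
    simp only [MonoidalCategory.whiskerLeft_comp] at ih
    rw [← e _ (congrArg (listTensor x) (List.append_assoc (w :: l) (y :: m) (z :: n)))] at ih
    change (x.obj ◁ (listTensorAppend w (l ++ y :: m) z n).hom ≫ (α_ _ _ _).inv) ≫
      ((x.obj ◁ (listTensorAppend w l y m).hom ≫ (α_ _ _ _).inv) ▷ _) ≫
      (α_ (x.obj ⊗ listTensor w l) (listTensor y m) (listTensor z n)).hom =
      eqToHom _ ≫ (x.obj ◁ (listTensorAppend w l y (m ++ z :: n)).hom ≫ (α_ _ _ _).inv) ≫
      ((x.obj ⊗ listTensor w l) ◁ (listTensorAppend y m z n).hom)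
    simp only [assoc, comp_whiskerRight]
    have := reassoc_of% ih
    simp only [tensor_whiskerLeft, Iso.inv_hom_id_assoc] at this ⊢
    rw [← this, ← associator_inv_naturality_middle_assoc]
    simp

lemma isCofibrant_listTensor [MonoidalModelCategory M] (x : CofibrantObject M)
    (l : List (CofibrantObject M)) : IsCofibrant (listTensor x l) := by
  induction l generalizing x with
  | nil => exact x.property
  | cons y l ih =>
    have := ih y
    exact MonoidalModelCategory.isCofibrant_tensor x.obj (listTensor y l)

variable (M) in
/-- The strictification given by the lists of cofibrant objects. -/
def free [MonoidalModelCategory M] : Strictification M where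
  S := ULift.{max u v} (FreeSemigroup (CofibrantObject M))
  r s := listTensor s.down.head s.down.tail
  isCofibrant _ := isCofibrant_listTensor _ _
  μ _ _ := listTensorAppend _ _ _ _
  associativity _ _ _ := listTensorAppend_associativity _ _ _ _ _ _
  exists_eq Z _ := ⟨⟨FreeSemigroup.of (CofibrantObject.mk Z)⟩, rfl⟩

end Strictification

end

theorem mainTheorem9 {M : Type u} [Category.{v} M] [MonoidalCategory M] [ModelCategory M]
    [MonoidalModelCategory M] :
    ∃ X : FatDeltaᵒᵖ ⥤ CCat.{v, max u v}, IsFairMonoid X ∧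
      ∃ R : CofibrantFairMonoid M X, StrictlyAssociative M → R.IsStrict := by
  by_cases h : StrictlyAssociative M
  -- The free semigroup cannot give strictness: the lists `[X, Y]` and `[X ⊗ Y]` represent the same
  -- object. Here `r` is injective and `μ` is an identity.
  · let 𝓡 := Strictification.ofStrictlyAssociative h
    refine ⟨_, 𝓡.isFairMonoid, 𝓡.cofibrantFairMonoid, fun _ => 𝓡.isStrict_cofibrantFairMonoid ?_
      fun s t => ⟨rfl, rfl⟩⟩
    exact fun s t hst => ULift.ext _ _ (ObjectProperty.FullSubcategory.ext hst)
  · exact ⟨_, (Strictification.free M).isFairMonoid, (Strictification.free M).cofibrantFairMonoid,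
      fun h' => absurd h' h⟩
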